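/- **Setting.** Let $m\ge 1$, $n,\ell\ge 0$, $r=2\ell$, $J=\begin{bmatrix}0&I_\ell\\-I_\ell&0\end{bmatrix}$. Let $P(\lambda)=\sum_{i=0}^m\lambda^iA_i$ with $A_i\in\mathbb C^{n\times n}$, $A_m\ne 0$. A matrix polynomial or rational matrix $X(\lambda)$ is called $T$-even if $X(-\lambda)^T=X(\lambda)$; a $T$-even rational matrix is also called Hamiltonian. Let $G(\lambda)\in\mathbb C(\lambda)^{n\times n}$ be Hamiltonian, and let $G(\lambda)=P(\lambda)+C(\lambda I_r-A)^{-1}B$ be a Hamiltonian realization, that is, $P$ is $T$-even, $(JA)^T=JA$ and $JB=C^T$. Assume that it is minimal: $r$ is the smallest size of $\lambda E'-A'$ among all realizations $G=P'+C'(\lambda E'-A')^{-1}B'$ with $P'$ a matrix polynomial and $E'$ nonsingular. Put $\mathcal S(\lambda)=\begin{bmatrix}P(\lambda)&C\\B&A-\lambda I_r\end{bmatrix}$. **Index tuples.** For $0\le p\le k$ with $k-p$ even, the admissible tuple of $\{0,\dots,k\}$ of index $p$ is $(k-1:k,\;k-3:k-2,\;\dots,\;p+1:p+2,\;0:p)$,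 and its symmetric complement is $(k-1,k-3,\dots,p+1,\;0:p-1,\;0:p-2,\dots,0:1,\;0)$, the part after $p+1$ being absent if $p=0$; here $a:b$ stands for $a,a+1,\dots,b$. Let $0\le h\le m-1$ be even. Let $\mathbf w$ be the admissible tuple of $\{0,\dots,h\}$ of index $0$, with symmetric complement $\mathbf c_w$. Let $\mathbf z+m$ be an admissible tuple of $\{0,\dots,m-h-1\}$, with index $\mathrm{Ind}(\mathbf z+m)$ and symmetric complement $\mathbf c_z+m$. Assume that $\mathrm{Ind}(\mathbf z+m)=0$ if $A_m$ is singular. Let $i_0(\mathbf w)$ be the largest $s$ such that $(s,\dots,1,0)$ is a subtuple (obtained by deleting entries) of $\mathbf w$. **The pencil.** For $X\in\mathbb C^{n\times n}$ let $M_0(X)=\mathrm{diag}(I_{(m-1)n},X)$, $M_{-m}(X)=\mathrm{diag}(X,I_{(m-1)n})$ and, for $1\le i\le m-1$, $M_i(X)=\mathrm{diag}\left(I_{(m-i-1)n},\begin{bmatrix}X&I_n\\I_n&0\end{bmatrix},I_{(i-1)n}\right)$, $M_{-i}(X)=\mathrm{diag}\left(I_{(m-i-1)n},\begin{bmatrix}0&I_n\\I_n&X\end{bmatrix},I_{(i-1)n}\right)$.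 Let $M_i^P=M_i(-A_i)$ for $0\le i\le m-1$, $M_{-i}^P=M_{-i}(A_i)$ for $1\le i\le m$, and $M^P_{(t_1,\dots,t_k)}=M^P_{t_1}\cdots M^P_{t_k}$. Put $$L(\lambda)=(\lambda M^P_{\mathbf z}-M^P_{\mathbf w})\,M^P_{\mathbf c_w}M^P_{\mathbf c_z}.$$ A quasi-identity matrix is a matrix $Q=\epsilon_1I_n\oplus\cdots\oplus\epsilon_mI_n$ with $\epsilon_i\in\{1,-1\}$; $\epsilon_j$ is its $j$-th parameter. **Rosenbrock strong linearization.** Consider a pencil $\mathbb L(\lambda)=\begin{bmatrix}\mathcal X-\lambda\mathcal Y&\mathcal C\\\mathcal B&H-\lambda K\end{bmatrix}$ of size $mn+r$ with $K\in\mathbb C^{r\times r}$ nonsingular, with transfer function $\mathbb G(\lambda)=\mathcal X-\lambda\mathcal Y+\mathcal C(\lambda K-H)^{-1}\mathcal B$. It is a Rosenbrock strong linearization of $G(\lambda)$ if it is irreducible (this realization of $\mathbb G$ is minimal) and: (a) there are unimodular matrix polynomials $U(\lambda),V(\lambda)$ of size $mn$ and nonsingular $U_0,V_0\in\mathbb C^{r\times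 r}$ with $\mathrm{diag}(U,U_0)\,\mathbb L\,\mathrm{diag}(V,V_0)=\mathrm{diag}(I_{(m-1)n},\mathcal S)$; (b) there are biproper rational matrices $\mathcal O_\ell,\mathcal O_r$ of size $mn$ (they converge to nonsingular matrices as $\lambda\to\infty$) with $\mathcal O_\ell\,\lambda^{-1}\mathbb G\,\mathcal O_r=\mathrm{diag}(I_{(m-1)n},\lambda^{-m}G)$. **Theorem.** There is a choice of signs $\epsilon_1,\dots,\epsilon_m\in\{1,-1\}$, depending only on $m$, $h$ and $\mathbf z$, such that for every size $n$ and every $T$-even $P$ of degree $m$ as above, the quasi-identity matrix $Q$ with parameters $\epsilon_1,\dots,\epsilon_m$ makes $QL(\lambda)$ $T$-even. For the given $P$, the quasi-identity matrix $Q$ for which $QL(\lambda)$ is $T$-even is unique up to multiplication by $-1$. For this $Q$, let $\mathbf s$ be its $(m-i_0(\mathbf w))$-th parameter. Then $$\mathbb T(\lambda)=\begin{bmatrix}\mathbf s\,QL(\lambda)&e_{m-i_0(\mathbf w)}\otimes B^TJ^T\\ e_{m-i_0(\mathbf w)}^T\otimes B&A-\lambda I_r\end{bmatrix}$$ (where $e_j$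 is the $j$-th column of $I_m$) is Hamiltonian, i.e. $\mathrm{diag}(I_{mn},J)\,\mathbb T(\lambda)$ is $T$-even, and $\mathbb T(\lambda)$ is a Rosenbrock strong linearization of $G(\lambda)$. Its transfer function $\mathbb G(\lambda)=\mathbf s\,QL(\lambda)+(e_{m-i_0(\mathbf w)}\otimes B^TJ^T)(\lambda I_r-A)^{-1}(e_{m-i_0(\mathbf w)}^T\otimes B)$ is Hamiltonian. -/

import Mathlib

open Filter Topology
open scoped Polynomial Matrix

noncomputable section

namespace HamLin

/-! ### Polynomial and rational matrices -/

variable {ι κ σ : Type}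

/-- A constant matrix, regarded as a matrix polynomial. -/
def toPoly (M : Matrix ι κ ℂ) : Matrix ι κ ℂ[X] := M.map Polynomial.C

/-- A matrix polynomial, regarded as a rational matrix. -/
def toRat (M : Matrix ι κ ℂ[X]) : Matrix ι κ (RatFunc ℂ) := M.map (algebraMap ℂ[X] (RatFunc ℂ))

/-- The coefficient matrix of `λ ^ k` in the matrix polynomial `P(λ)`. -/
def coeffMat (P : Matrix ι κ ℂ[X]) (k : ℕ) : Matrix ι κ ℂ := P.map (fun p => p.coeff k)

/-- `P(λ) = ∑_{i ≤ m} λ ^ i A_i` with `A_m ≠ 0`. -/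
def HasDegree (P : Matrix ι κ ℂ[X]) (m : ℕ) : Prop :=
  coeffMat P m ≠ 0 ∧ ∀ k, m < k → coeffMat P k = 0

/-- `P(λ)` is a matrix pencil `X - λ Y`. -/
def IsPencil (P : Matrix ι κ ℂ[X]) : Prop :=
  ∃ M N : Matrix ι κ ℂ, P = toPoly M - (Polynomial.X : ℂ[X]) • toPoly N

/-- `T`-even matrix polynomials: `P(-λ)ᵀ = P(λ)`. -/
def IsTEven (P : Matrix ι ι ℂ[X]) : Prop := (P.map (fun p => p.comp (-Polynomial.X)))ᵀ = P

/-- The substitution `λ ↦ -λ` in the field of rational functions. -/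
def negSubst : RatFunc ℂ →+* RatFunc ℂ :=
  RatFunc.mapRingHom (Polynomial.algEquivAevalNegX : ℂ[X] ≃ₐ[ℂ] ℂ[X])
    (nonZeroDivisors_le_comap_nonZeroDivisors_of_injective _
      (Polynomial.algEquivAevalNegX : ℂ[X] ≃ₐ[ℂ] ℂ[X]).injective)

/-- Hamiltonian rational matrices: `G(-λ)ᵀ = G(λ)`. -/
def IsHamiltonianRat (G : Matrix ι ι (RatFunc ℂ)) : Prop := (G.map negSubst)ᵀ = G

/-- Unimodular matrix polynomials: the determinant is a nonzero constant. -/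
def IsUnimodular [Fintype ι] [DecidableEq ι] (U : Matrix ι ι ℂ[X]) : Prop :=
  ∃ c : ℂ, c ≠ 0 ∧ U.det = Polynomial.C c

/-- Biproper rational matrices: `F(z)` converges to a nonsingular matrix as `z → ∞`. -/
def IsBiproper [Fintype ι] [DecidableEq ι] (F : Matrix ι ι (RatFunc ℂ)) : Prop :=
  ∃ D : Matrix ι ι ℂ, IsUnit D.det ∧
    ∀ i j, Tendsto (fun z : ℂ => (F i j).eval (RingHom.id ℂ) z) (Bornology.cobounded ℂ)
      (𝓝 (D i j))

/-! ### Realizations and system matrices -/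

/-- The data of a realization `G(λ) = P(λ) + C (λ E - A)⁻¹ B` with `E` nonsingular, equivalently
of a system matrix `[P(λ), C; B, A - λ E]`. -/
structure SystemData (ι σ : Type) [Fintype σ] [DecidableEq σ] where
  P : Matrix ι ι ℂ[X]
  C : Matrix ι σ ℂ
  B : Matrix σ ι ℂ
  A : Matrix σ σ ℂ
  E : Matrix σ σ ℂ
  isUnit_det_E : IsUnit E.det

namespace SystemData

variable [Fintype σ] [DecidableEq σ]

/-- The system matrix `[P(λ), C; B, A - λ E]`. -/
def toMatrix (S : SystemData ι σ) : Matrix (ι ⊕ σ) (ι ⊕ σ) ℂ[X] :=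
  Matrix.fromBlocks S.P (toPoly S.C) (toPoly S.B)
    (toPoly S.A - (Polynomial.X : ℂ[X]) • toPoly S.E)

/-- The transfer function `P(λ) + C (λ E - A)⁻¹ B`. -/
def transfer (S : SystemData ι σ) : Matrix ι ι (RatFunc ℂ) :=
  toRat S.P + toRat (toPoly S.C) *
    (toRat ((Polynomial.X : ℂ[X]) • toPoly S.E - toPoly S.A))⁻¹ * toRat (toPoly S.B)

/-- The realization is minimal (the system matrix is irreducible): the size of the pencil
`λ E - A` is the smallest among all realizations of the same rational matrix. -/
def IsMinimal (S : SystemData ι σ) : Prop :=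
  ∀ (r : ℕ) (S' : SystemData ι (Fin r)), S'.transfer = S.transfer → Fintype.card σ ≤ r

end SystemData

/-! ### Block matrices with `m × m` blocks of size `n × n` -/

/-- `diag(I_{(m-1)n}, X)`. -/
def idDiag {R : Type} [Zero R] [One R] (m : ℕ) {n : ℕ} (X : Matrix (Fin n) (Fin n) R) :
    Matrix (Fin m × Fin n) (Fin m × Fin n) R :=
  Matrix.comp _ _ _ _ _ (Matrix.of fun a b : Fin m =>
    if a = b then (if (a : ℕ) + 1 = m then X else 1) else 0)

/-- `e_k ⊗ X`, where `e_k` is the `k`-th column of `I_m` (with `k` counted from `1`). -/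
def colBlock {R : Type} [Zero R] (m : ℕ) {n : ℕ} (k : ℕ) (X : Matrix (Fin n) σ R) :
    Matrix (Fin m × Fin n) σ R :=
  Matrix.of fun a j => if (a.1 : ℕ) + 1 = k then X a.2 j else 0

/-- `e_kᵀ ⊗ X`, where `e_k` is the `k`-th column of `I_m` (with `k` counted from `1`). -/
def rowBlock {R : Type} [Zero R] (m : ℕ) {n : ℕ} (k : ℕ) (X : Matrix σ (Fin n) R) :
    Matrix σ (Fin m × Fin n) R :=
  Matrix.of fun i b => if (b.1 : ℕ) + 1 = k then X i b.2 else 0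

/-! ### Rosenbrock strong linearizations -/

/-- `diag(I_{(m-1)n}, S(λ))`, for the system matrix `S(λ) = [P(λ), C; B, A - λ E]`: the last of
the `m` blocks of size `n`, together with the trailing block, carries `S(λ)`. -/
def paddedSystem [Fintype σ] [DecidableEq σ] (m : ℕ) {n : ℕ} (S : SystemData (Fin n) σ) :
    Matrix ((Fin m × Fin n) ⊕ σ) ((Fin m × Fin n) ⊕ σ) ℂ[X] :=
  Matrix.fromBlocks (idDiag m S.P) (colBlock m m (toPoly S.C)) (rowBlock m m (toPoly S.B))
    (toPoly S.A - (Polynomial.X : ℂ[X]) • toPoly S.E)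

/-- `T` is (the system matrix of) a Rosenbrock strong linearization of the rational matrix
`G(λ)`, the transfer function of `S`, where the polynomial part of `S` has degree `m`. -/
structure IsRosenbrockStrongLinearization [Fintype σ] [DecidableEq σ] {m n : ℕ}
    (S : SystemData (Fin n) σ) (T : SystemData (Fin m × Fin n) σ) : Prop where
  /-- the leading block of `T` is a pencil -/
  isPencil : IsPencil T.P
  /-- `T` is irreducible -/
  isMinimal : T.IsMinimal
  /-- `diag(U(λ), U₀) T(λ) diag(V(λ), V₀) = diag(I, S(λ))` -/
  exists_unimodular : ∃ (U V : Matrix (Fin m × Fin n) (Fin m × Fin n) ℂ[X])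
    (U₀ V₀ : Matrix σ σ ℂ), IsUnimodular U ∧ IsUnimodular V ∧ IsUnit U₀.det ∧ IsUnit V₀.det ∧
      Matrix.fromBlocks U 0 0 (toPoly U₀) * T.toMatrix * Matrix.fromBlocks V 0 0 (toPoly V₀)
        = paddedSystem m S
  /-- `O_l(λ) λ⁻¹ 𝔾(λ) O_r(λ) = diag(I, λ⁻ᵐ G(λ))`, with `𝔾` the transfer function of `T` -/
  exists_biproper : ∃ Ol Or : Matrix (Fin m × Fin n) (Fin m × Fin n) (RatFunc ℂ),
    IsBiproper Ol ∧ IsBiproper Or ∧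
      Ol * ((RatFunc.X : RatFunc ℂ)⁻¹ • T.transfer) * Or
        = idDiag m (((RatFunc.X : RatFunc ℂ) ^ m)⁻¹ • S.transfer)

/-! ### Hamiltonian structure -/

/-- `J = [0, I; -I, 0]`, of size `2ℓ`. -/
def J (ℓ : ℕ) : Matrix (Fin ℓ ⊕ Fin ℓ) (Fin ℓ ⊕ Fin ℓ) ℂ := Matrix.fromBlocks 0 1 (-1) 0

/-- `S` is a Hamiltonian realization of `G(λ)`, of the form `G(λ) = P(λ) + C (λ I - A)⁻¹ B` of
state dimension `r = 2ℓ`: `P(λ)` is `T`-even, `A` is Hamiltonian and `J B = Cᵀ`. -/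
structure IsHamiltonianRealization {ℓ : ℕ} (G : Matrix ι ι (RatFunc ℂ))
    (S : SystemData ι (Fin ℓ ⊕ Fin ℓ)) : Prop where
  transfer_eq : S.transfer = G
  E_eq_one : S.E = 1
  isTEven_P : IsTEven S.P
  hamiltonian_A : (J ℓ * S.A)ᵀ = J ℓ * S.A
  J_mul_B : J ℓ * S.B = S.Cᵀ

/-- `S` is a Hamiltonian system matrix: `E = I` and `diag(I, J) S(λ)` is `T`-even. -/
def IsHamiltonianSystem [Fintype ι] [DecidableEq ι] {ℓ : ℕ}
    (S : SystemData ι (Fin ℓ ⊕ Fin ℓ)) : Prop :=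
  S.E = 1 ∧ IsTEven (Matrix.fromBlocks 1 0 0 (toPoly (J ℓ)) * S.toMatrix)

/-! ### Fiedler matrices -/

/-- The elementary matrices `M_i(X)`, `-m ≤ i ≤ m - 1`, with `m × m` blocks of size `n × n`:
`M_0(X) = diag(I, X)`, `M_{-m}(X) = diag(X, I)` and, for `1 ≤ i ≤ m - 1`, the matrices `M_i(X)`
and `M_{-i}(X)` have the diagonal blocks `[X, I; I, 0]` and `[0, I; I, X]`, respectively, in the
block rows and columns `m - i`, `m - i + 1` (counted from `1`), and agree with the identity
elsewhere. -/
def elemMat (m : ℕ) {n : ℕ} (i : ℤ) (X : Matrix (Fin n) (Fin n) ℂ) :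
    Matrix (Fin m × Fin n) (Fin m × Fin n) ℂ :=
  if i = 0 then idDiag m X
  else Matrix.comp _ _ _ _ _ (Matrix.of fun a b : Fin m =>
    if i = -(m : ℤ) then
      if a = b then (if (a : ℕ) = 0 then X else 1) else 0
    else
      if (a : ℕ) + 1 = m - i.natAbs ∧ (b : ℕ) + 1 = m - i.natAbs then
        (if 0 < i then X else 0)
      else if (a : ℕ) + 1 = m - i.natAbs ∧ (b : ℕ) = m - i.natAbs then 1
      else if (a : ℕ) = m - i.natAbs ∧ (b : ℕ) + 1 = m - i.natAbs then 1
      else if (a : ℕ) = m - i.natAbs ∧ (b : ℕ) = m - i.natAbs then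
        (if 0 < i then 0 else X)
      else if a = b then 1 else 0)

/-- The Fiedler matrices of `P(λ) = ∑ λ ^ i A_i`: `M_i^P = M_i(-A_i)` for `i ≥ 0` and
`M_i^P = M_i(A_{-i})` for `i < 0`. -/
def fiedlerMat (m : ℕ) {n : ℕ} (P : Matrix (Fin n) (Fin n) ℂ[X]) (i : ℤ) :
    Matrix (Fin m × Fin n) (Fin m × Fin n) ℂ :=
  if 0 ≤ i then elemMat m i (-coeffMat P i.natAbs) else elemMat m i (coeffMat P i.natAbs)

/-- `M_t^P = M_{t_1}^P ⋯ M_{t_k}^P` for an index tuple `t = (t_1, …, t_k)`. -/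
def fiedlerProd (m : ℕ) {n : ℕ} (P : Matrix (Fin n) (Fin n) ℂ[X]) (t : List ℤ) :
    Matrix (Fin m × Fin n) (Fin m × Fin n) ℂ :=
  (t.map (fiedlerMat m P)).prod

/-! ### Index tuples -/

/-- The number of consecutive inversions of the index tuple `t` at `i`: the largest `s` for which
`(i + s, …, i + 1, i)` is a subtuple of `t`, and `-1` if `i` does not occur in `t`. -/
def consecInv (i : ℤ) (t : List ℤ) : ℤ :=
  if i ∈ t then
    (Nat.findGreatest (fun s : ℕ =>
      ((List.range (s + 1)).reverse.map (fun k : ℕ => i + (k : ℤ))).Sublist t) t.length : ℕ)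
  else -1

/-- The admissible tuple `(h-1:h, h-3:h-2, …, p+1:p+2, 0:p)` of `{0:h}` of index `p`, where
`p ≤ h` and `h - p` is even. -/
def admissibleTuple (h p : ℕ) : List ℤ :=
  (List.range ((h - p) / 2)).reverse.flatMap
      (fun j : ℕ => [(p : ℤ) + 2 * j + 1, (p : ℤ) + 2 * j + 2])
    ++ (List.range (p + 1)).map (fun k : ℕ => (k : ℤ))

/-- The symmetric complement `(h-1, h-3, …, p+1, 0:p-1, 0:p-2, …, 0:1, 0)` of the admissible tuple
of `{0:h}` of index `p`. -/
def symmComplement (h p : ℕ) : List ℤ :=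
  (List.range ((h - p) / 2)).reverse.map (fun j : ℕ => (p : ℤ) + 2 * j + 1)
    ++ (List.range p).reverse.flatMap
      (fun q : ℕ => (List.range (q + 1)).map (fun k : ℕ => (k : ℤ)))

/-- The simple admissible tuple `w` of `{0:h}`: its index is `0` if `h` is even and `1` if `h` is
odd. -/
def tupleW (h : ℕ) : List ℤ := admissibleTuple h (h % 2)

/-- The symmetric complement `c_w` of the simple admissible tuple `w` of `{0:h}`. -/
def tupleCW (h : ℕ) : List ℤ := symmComplement h (h % 2)

/-- The tuple `z` such that `z + m` is the admissible tuple of `{0:m-h-1}` of index `p`. -/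
def tupleZ (m h p : ℕ) : List ℤ := (admissibleTuple (m - h - 1) p).map (fun i => i - (m : ℤ))

/-- The tuple `c_z` such that `c_z + m` is the symmetric complement of `z + m`. -/
def tupleCZ (m h p : ℕ) : List ℤ := (symmComplement (m - h - 1) p).map (fun i => i - (m : ℤ))

/-! ### The pencils -/

/-- `L(λ) = (λ M_z^P - M_w^P) M_{c_w}^P M_{c_z}^P`. -/
def pencilL (m h p : ℕ) {n : ℕ} (P : Matrix (Fin n) (Fin n) ℂ[X]) :
    Matrix (Fin m × Fin n) (Fin m × Fin n) ℂ[X] :=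
  ((Polynomial.X : ℂ[X]) • toPoly (fiedlerProd m P (tupleZ m h p))
      - toPoly (fiedlerProd m P (tupleW h)))
    * toPoly (fiedlerProd m P (tupleCW h)) * toPoly (fiedlerProd m P (tupleCZ m h p))

/-- The quasi-identity matrix `ε_1 I_n ⊕ ⋯ ⊕ ε_m I_n`, `ε_i = ± 1`. -/
def quasiIdentity {m : ℕ} (n : ℕ) (ε : Fin m → ℤˣ) :
    Matrix (Fin m × Fin n) (Fin m × Fin n) ℂ :=
  Matrix.diagonal fun a => (((ε a.1 : ℤˣ) : ℤ) : ℂ)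

/-- The `k`-th parameter of a quasi-identity matrix, `1 ≤ k ≤ m` (with `k` counted from `1`;
the value outside of this range is immaterial). -/
def parameter {m : ℕ} (ε : Fin m → ℤˣ) (k : ℕ) : ℂ :=
  if hk : k - 1 < m then (((ε ⟨k - 1, hk⟩ : ℤˣ) : ℤ) : ℂ) else 1

/-- The position `m - i_0(w)`, counted from `1`. -/
def position (m h : ℕ) : ℕ := ((m : ℤ) - consecInv 0 (tupleW h)).toNat

/-- `s Q L(λ)`, where `s` is the `(m - i_0(w))`-th parameter of `Q`. -/
def signedPencil (m h p : ℕ) {n : ℕ} (ε : Fin m → ℤˣ) (P : Matrix (Fin n) (Fin n) ℂ[X]) :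
    Matrix (Fin m × Fin n) (Fin m × Fin n) ℂ[X] :=
  toPoly (parameter ε (position m h) • quasiIdentity n ε) * pencilL m h p P

/-- The bordered pencil
`𝕋(λ) = [s Q L(λ), e_{m - i_0(w)} ⊗ Bᵀ Jᵀ; e_{m - i_0(w)}ᵀ ⊗ B, A - λ I]`. -/
def borderedPencil (m h p : ℕ) {n ℓ : ℕ} (ε : Fin m → ℤˣ)
    (S : SystemData (Fin n) (Fin ℓ ⊕ Fin ℓ)) :
    SystemData (Fin m × Fin n) (Fin ℓ ⊕ Fin ℓ) where
  P := signedPencil m h p ε S.P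
  C := colBlock m (position m h) (S.Bᵀ * (J ℓ)ᵀ)
  B := rowBlock m (position m h) S.B
  A := S.A
  E := 1
  isUnit_det_E := by simp

end HamLin

end

/-! All reductions are carried out for block matrices over an arbitrary ring of blocks and an
arbitrary sequence of coefficients, so that the same identities serve over constants, polynomials
and proper rational functions. With h = 2e and m = 2e + 1 + (p + 2s), the pencil L(λ) is λ
`leadBlock` − `constBlock`.

Finite part. Since w is a list of pairs followed by 0, L = M (λ M⁻¹ M_z − M_0) W, where M is the
product over w without 0 and W = M_{c_w} M_{c_z}. Both are invertible: neither contains M_0, and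
M_{-m} occurs in W only for p > 0, where A_m is nonsingular. The middle factor is a Fiedler pencil.
Its first block is removed by a Schur complement that replaces A_{m-1} by A_{m-1} + λ A_m, a Horner
step, and induction gives diag(I, P) (`exists_equiv_fiedler`). These transformations fix the last
block, while M and W relate the last unit vector to the one at m − i_0(w); hence the borders of 𝕋
become those of diag(I, S) (`exists_equiv_pencilL`). Minimality is inherited because multiplication
by polynomial matrices does not raise the state dimension (`exists_realization_mul`).

Infinity. M_0 is affine in A_0, so the transfer function 𝔾 is sQ times the pencil L formed with A_0
+ C(λI − A)⁻¹B in place of A_0 (`constBlock_update_zero`). This new coefficient is proper, and λ⁻¹𝔾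
is a reversed pencil in y = λ⁻¹ over `properRing`, whose invertible matrices are biproper
(`exists_equiv_reversed_blockPencil`).

Symmetry. For T-even P the coefficients satisfy A_iᵀ = (−1)^i A_i. Transposition reverses products,
and a tuple followed by its symmetric complement is a palindrome up to commutations; hence
transposing the coefficients of L amounts to replacing A_i by (−1)^i A_i. A diagonal matrix of signs
can be pushed through the product factor by factor and absorbs these changes, provided that certain
ratios of neighbouring signs have prescribed values. Each neighbouring pair is prescribed once, so a
solution exists (`exists_isSignPattern`). Conversely, the quotient of two solutions is constant
along the nonzero blocks of the coefficients of L, and these connect all block indices because A_m ≠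
0 (`eq_of_blockLinked`). -/

noncomputable section

namespace HamLin

/-! ### Elementary block matrices over an arbitrary ring -/

/-- The block pattern of `elemMat`, over an arbitrary ring of blocks. -/
def blockElem {S : Type*} [Zero S] [One S] (m : ℕ) (i : ℤ) (X : S) : Matrix (Fin m) (Fin m) S :=
  if i = 0 then Matrix.of fun a b : Fin m =>
    if a = b then (if (a : ℕ) + 1 = m then X else 1) else 0
  else Matrix.of fun a b : Fin m =>
    if i = -(m : ℤ) then
      if a = b then (if (a : ℕ) = 0 then X else 1) else 0
    else
      if (a : ℕ) + 1 = m - i.natAbs ∧ (b : ℕ) + 1 = m - i.natAbs then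
        (if 0 < i then X else 0)
      else if (a : ℕ) + 1 = m - i.natAbs ∧ (b : ℕ) = m - i.natAbs then 1
      else if (a : ℕ) = m - i.natAbs ∧ (b : ℕ) + 1 = m - i.natAbs then 1
      else if (a : ℕ) = m - i.natAbs ∧ (b : ℕ) = m - i.natAbs then
        (if 0 < i then 0 else X)
      else if a = b then 1 else 0

theorem elemMat_eq_comp (m : ℕ) {n : ℕ} (i : ℤ) (X : Matrix (Fin n) (Fin n) ℂ) :
    elemMat m i X = Matrix.comp _ _ _ _ _ (blockElem m i X) := by
  unfold elemMat blockElem idDiag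
  split_ifs <;> rfl

theorem blockElem_map {S S' : Type*} [Semiring S] [Semiring S'] (f : S →+* S') (m : ℕ) (i : ℤ)
    (X : S) : (blockElem m i X).map f = blockElem m i (f X) := by
  unfold blockElem
  ext a b
  split_ifs <;> simp only [Matrix.map_apply, Matrix.of_apply] <;> split_ifs <;> simp

section Entries

variable {S : Type*} [Zero S] [One S] {m : ℕ}

theorem blockElem_zero_apply (X : S) (a b : Fin m) :
    blockElem m 0 X a b = if a = b then (if (a : ℕ) + 1 = m then X else 1) else 0 := by
  simp [blockElem]

theorem blockElem_top_apply (hm : 0 < m) (X : S) (a b : Fin m) :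
    blockElem m (-(m : ℤ)) X a b = if a = b then (if (a : ℕ) = 0 then X else 1) else 0 := by
  rw [blockElem, if_neg (by omega)]
  simp

theorem blockElem_neg_apply {i : ℕ} (hi : 0 < i) (him : i < m) (X : S) (a b : Fin m) :
    blockElem m (-(i : ℤ)) X a b =
      if (a : ℕ) + 1 = m - i ∧ (b : ℕ) + 1 = m - i then 0
      else if (a : ℕ) + 1 = m - i ∧ (b : ℕ) = m - i then 1
      else if (a : ℕ) = m - i ∧ (b : ℕ) + 1 = m - i then 1
      else if (a : ℕ) = m - i ∧ (b : ℕ) = m - i then X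
      else if a = b then 1 else 0 := by
  have h₁ : -(i : ℤ) ≠ -(m : ℤ) := by omega
  have h₂ : ¬ 0 < -(i : ℤ) := by omega
  rw [blockElem, if_neg (by omega), Matrix.of_apply, if_neg h₁, if_neg h₂, if_neg h₂,
    Int.natAbs_neg, Int.natAbs_natCast]

theorem blockElem_pos_apply {i : ℕ} (hi : 0 < i) (X : S) (a b : Fin m) :
    blockElem m (i : ℤ) X a b =
      if (a : ℕ) + 1 = m - i ∧ (b : ℕ) + 1 = m - i then X
      else if (a : ℕ) + 1 = m - i ∧ (b : ℕ) = m - i then 1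
      else if (a : ℕ) = m - i ∧ (b : ℕ) + 1 = m - i then 1
      else if (a : ℕ) = m - i ∧ (b : ℕ) = m - i then 0
      else if a = b then 1 else 0 := by
  have h₁ : (i : ℤ) ≠ -(m : ℤ) := by omega
  have h₂ : 0 < (i : ℤ) := by omega
  rw [blockElem, if_neg (by omega), Matrix.of_apply, if_neg h₁, if_pos h₂, if_pos h₂,
    Int.natAbs_natCast]

end Entries

/-! ### Splitting off the first block row and column -/

section Border

variable {S : Type*} {m : ℕ}

/-- The bordered matrix `[a, r; c, D]`. -/
def border (a : S) (r c : Fin m → S) (D : Matrix (Fin m) (Fin m) S) :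
    Matrix (Fin (m + 1)) (Fin (m + 1)) S :=
  Matrix.of (Fin.cons (Fin.cons a r) fun i => Fin.cons (c i) (D i))

@[simp] theorem border_zero_zero (a : S) (r c : Fin m → S) (D : Matrix (Fin m) (Fin m) S) :
    border a r c D 0 0 = a := rfl

@[simp] theorem border_zero_succ (a : S) (r c : Fin m → S) (D : Matrix (Fin m) (Fin m) S)
    (j : Fin m) : border a r c D 0 j.succ = r j := rfl

@[simp] theorem border_succ_zero (a : S) (r c : Fin m → S) (D : Matrix (Fin m) (Fin m) S)
    (i : Fin m) : border a r c D i.succ 0 = c i := rfl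

@[simp] theorem border_succ_succ (a : S) (r c : Fin m → S) (D : Matrix (Fin m) (Fin m) S)
    (i j : Fin m) : border a r c D i.succ j.succ = D i j := rfl

theorem border_ext {M N : Matrix (Fin (m + 1)) (Fin (m + 1)) S} (h₀ : M 0 0 = N 0 0)
    (h₁ : ∀ j : Fin m, M 0 j.succ = N 0 j.succ) (h₂ : ∀ i : Fin m, M i.succ 0 = N i.succ 0)
    (h₃ : ∀ i j : Fin m, M i.succ j.succ = N i.succ j.succ) : M = N := by
  ext i j
  refine Fin.cases (Fin.cases h₀ h₁ j) (fun i => Fin.cases (h₂ i) (h₃ i) j) i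

variable [Ring S]

theorem border_mul (a a' : S) (r c r' c' : Fin m → S) (D D' : Matrix (Fin m) (Fin m) S) :
    border a r c D * border a' r' c' D'
      = border (a * a' + r ⬝ᵥ c') (fun j => a * r' j + (r ᵥ* D') j)
          (fun i => c i * a' + (D *ᵥ c') i) (Matrix.vecMulVec c r' + D * D') := by
  refine border_ext ?_ ?_ ?_ ?_ <;> intros <;>
    simp [Matrix.mul_apply, Fin.sum_univ_succ, dotProduct, Matrix.vecMul, Matrix.mulVec,
      Matrix.vecMulVec_apply]

theorem border_one : border (1 : S) 0 0 (1 : Matrix (Fin m) (Fin m) S) = 1 := by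
  refine border_ext ?_ ?_ ?_ ?_ <;> intros <;> simp [Matrix.one_apply, Fin.ext_iff]

/-- `D ↦ diag(1, D)`. -/
def borderHom : Matrix (Fin m) (Fin m) S →* Matrix (Fin (m + 1)) (Fin (m + 1)) S where
  toFun D := border 1 0 0 D
  map_one' := border_one
  map_mul' D D' := by
    rw [border_mul]
    refine border_ext ?_ ?_ ?_ ?_ <;> intros <;> simp

theorem borderHom_apply (D : Matrix (Fin m) (Fin m) S) : borderHom D = border 1 0 0 D := rfl

theorem isUnit_border_lower (c : Fin m → S) : IsUnit (border (-1) 0 c 1) := by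
  have h : border (-1) 0 c 1 * border (-1) 0 c 1 = 1 := by
    rw [border_mul, ← border_one]
    refine border_ext ?_ ?_ ?_ ?_ <;> intros <;> simp
  exact ⟨⟨_, _, h, h⟩, rfl⟩

theorem isUnit_border_upper (r : Fin m → S) : IsUnit (border 1 r 0 1) := by
  have h : ∀ r : Fin m → S, border 1 r 0 1 * border 1 (-r) 0 1 = 1 := fun r => by
    rw [border_mul, ← border_one]
    refine border_ext ?_ ?_ ?_ ?_ <;> intros <;> simp
  exact ⟨⟨_, _, h r, by simpa using h (-r)⟩, rfl⟩

/-- Block elimination with pivot −1, the corner entry of a Fiedler pencil; the pivot explains the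
plus sign in the Schur complement. -/
theorem border_elim (r c : Fin m → S) (D : Matrix (Fin m) (Fin m) S) :
    border (-1) 0 c 1 * border (-1) r c D * border 1 r 0 1
      = borderHom (D + Matrix.vecMulVec c r) := by
  rw [border_mul, border_mul, borderHom_apply]
  refine border_ext ?_ ?_ ?_ ?_ <;> intros <;> simp [Matrix.vecMulVec_apply, add_comm]

theorem blockElem_top (m : ℕ) (X : S) :
    blockElem (m + 2) (-((m + 2 : ℕ) : ℤ)) X = border X 0 0 1 := by
  refine border_ext ?_ ?_ ?_ ?_ <;> intros <;> rw [blockElem_top_apply (by omega)] <;>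
    simp [Matrix.one_apply, eq_comm]

/-- Apart from M_{-(m+2)}, this is the only factor of negative index that involves the first block.
With that block deleted it becomes the factor carrying the leading coefficient in size m + 1, which
is what drives the induction on the number of blocks. -/
theorem blockElem_second (m : ℕ) (X : S) :
    blockElem (m + 2) (-((m + 1 : ℕ) : ℤ)) X
      = border 0 (Pi.single 0 1) (Pi.single 0 1) (blockElem (m + 1) (-((m + 1 : ℕ) : ℤ)) X) := by
  refine border_ext ?_ ?_ ?_ ?_ <;> intros <;> rw [blockElem_neg_apply (by omega) (by omega)]
  · simp
  · simp [Pi.single_apply, -Fin.val_eq_zero_iff, Fin.ext_iff]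
  · simp [Pi.single_apply, -Fin.val_eq_zero_iff, Fin.ext_iff]
  · rename_i i j
    rw [border_succ_succ, blockElem_top_apply (by omega)]
    have h : m + 2 - (m + 1) = 1 := by omega
    simp only [h, Fin.val_succ, Fin.ext_iff]
    split_ifs <;> first | rfl | omega

theorem blockElem_succ (m i : ℕ) (hi : i ≤ m) (X : S) :
    blockElem (m + 2) (-(i : ℤ)) X = borderHom (blockElem (m + 1) (-(i : ℤ)) X) := by
  rw [borderHom_apply]
  rcases Nat.eq_zero_or_pos i with rfl | hi0
  · simp only [Nat.cast_zero, neg_zero]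
    refine border_ext ?_ ?_ ?_ ?_ <;> intros <;> rw [blockElem_zero_apply] <;>
      simp [blockElem_zero_apply, eq_comm]
  refine border_ext ?_ ?_ ?_ ?_ <;> intros <;> rw [blockElem_neg_apply (by omega) (by omega)] <;>
    have h₃ : m + 2 - i = (m - i) + 2 := by omega
  · simp [h₃]
  · simp [h₃, eq_comm]
  · simp [h₃, eq_comm]
  · have h₄ : m + 1 - i = (m - i) + 1 := by omega
    rw [border_succ_succ, blockElem_neg_apply (by omega) (by omega)]
    simp [h₃, h₄]

end Border

theorem blockElem_one_zero {S : Type*} [Ring S] (X : S) : blockElem 1 0 X = Matrix.of fun _ _ => X := by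
  ext a b
  simp [blockElem, Subsingleton.elim a b]

theorem blockElem_one_top {S : Type*} [Ring S] (X : S) :
    blockElem 1 (-(1 : ℤ)) X = Matrix.of fun _ _ => X := by
  ext a b
  simp [blockElem, Subsingleton.elim a b]

/-! ### Products over index tuples -/

section ListProducts

variable {M : Type*} [Monoid M]

theorem commute_prod_map {ι : Type*} (g : ι → M) (x : M) (t : List ι)
    (h : ∀ i ∈ t, Commute x (g i)) : Commute x (t.map g).prod := by
  induction t with
  | nil => simp
  | cons a t ih =>
    rw [List.map_cons, List.prod_cons]
    exact (h a (by simp)).mul_right (ih fun i hi => h i (by simp [hi]))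

/-- In a product in which `g c` commutes with all factors but `g d`, the factor `g c` can be moved
next to `g d`. -/
theorem exists_prod_eq_of_adjacent {ι : Type*} [DecidableEq ι] (g : ι → M) {c d : ι}
    {t : List ι} (ht : t.Nodup) (hc : c ∈ t) (hd : d ∈ t) (hcd : c ≠ d)
    (h : ∀ i ∈ t, i ≠ d → Commute (g c) (g i)) :
    ∃ a b : List ι, (a ++ d :: b).Perm (t.erase c) ∧
      ((t.map g).prod = (a.map g).prod * (g c * g d) * (b.map g).prod ∨
        (t.map g).prod = (a.map g).prod * (g d * g c) * (b.map g).prod) := by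
  -- The tuple is cut at `d`. On whichever side `c` stands, it passes over the entries between, none
  -- of which is `d`.
  obtain ⟨t₁, t₂, rfl⟩ := List.append_of_mem hd
  have hd' : d ∉ t₁ ∧ d ∉ t₂ := by
    rw [List.nodup_middle] at ht
    simpa using (List.nodup_cons.1 ht).1
  rcases List.mem_append.1 hc with hc | hc
  · obtain ⟨a₁, a₂, rfl⟩ := List.append_of_mem hc
    refine ⟨a₁ ++ a₂, t₂, ?_, Or.inl ?_⟩
    · have : (a₁ ++ c :: a₂ ++ d :: t₂).Perm (c :: (a₁ ++ a₂ ++ d :: t₂)) := by simp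
      exact (by simpa using (this.erase c).symm)
    · have hcomm : Commute (g c) (a₂.map g).prod := commute_prod_map g _ _ fun i hi =>
        h i (by simp [hi]) fun hid => hd'.1 (by simp [← hid, hi])
      simp only [List.map_append, List.map_cons, List.prod_append, List.prod_cons, mul_assoc]
      rw [← mul_assoc (g c), hcomm.eq, mul_assoc]
  · have hc : c ∈ t₂ := by simpa [hcd] using hc
    obtain ⟨a₁, a₂, rfl⟩ := List.append_of_mem hc
    refine ⟨t₁, a₁ ++ a₂, ?_, Or.inr ?_⟩
    · have : (t₁ ++ d :: (a₁ ++ c :: a₂)).Perm (c :: (t₁ ++ d :: (a₁ ++ a₂))) := by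
        rw [List.perm_iff_count]
        intro a
        simp only [List.count_append, List.count_cons]
        omega
      exact (by simpa using (this.erase c).symm)
    · have hcomm : Commute (g c) (a₁.map g).prod := commute_prod_map g _ _ fun i hi =>
        h i (by simp [hi]) fun hid => hd'.2 (by simp [← hid, hi])
      simp only [List.map_append, List.map_cons, List.prod_append, List.prod_cons, mul_assoc]
      rw [← mul_assoc (a₁.map g).prod, ← hcomm.eq, mul_assoc]

end ListProducts

/-! ### Reduction of Fiedler pencils -/

section Reduction

variable {S : Type*} [Ring S]

/-- One factor is diag(X, I), the other is diag(1, ∗), so they act on different blocks. -/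
theorem commute_blockElem_top {m i : ℕ} (hi : i ≤ m) (X Y : S) :
    Commute (blockElem (m + 2) (-((m + 2 : ℕ) : ℤ)) X) (blockElem (m + 2) (-(i : ℤ)) Y) := by
  rw [blockElem_top, blockElem_succ m i hi, borderHom_apply, Commute, SemiconjBy, border_mul,
    border_mul]
  refine border_ext ?_ ?_ ?_ ?_ <;> intros <;> simp

theorem map_blockElem_prod_succ {m : ℕ} (A : ℕ → S) (t : List ℕ) (ht : ∀ i ∈ t, i ≤ m) :
    (t.map fun i : ℕ => blockElem (m + 2) (-(i : ℤ)) (A i)).prod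
      = borderHom (t.map fun i : ℕ => blockElem (m + 1) (-(i : ℤ)) (A i)).prod := by
  rw [map_list_prod, List.map_map]
  congr 1
  exact List.map_congr_left fun i hi => blockElem_succ m i (ht i hi) (A i)

theorem borderHom_apply_last {m : ℕ} (U : Matrix (Fin (m + 1)) (Fin (m + 1)) S) (a : Fin (m + 2))
    (hU : ∀ a, U a (Fin.last m) = if a = Fin.last m then 1 else 0) :
    borderHom U a (Fin.last (m + 1)) = if a = Fin.last (m + 1) then 1 else 0 := by
  rw [borderHom_apply, ← Fin.succ_last]
  refine Fin.cases ?_ (fun a => ?_) a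
  · rw [border_zero_succ, if_neg (Fin.succ_ne_zero _).symm]
    rfl
  · simp only [border_succ_succ, hU, Fin.succ_inj]

theorem borderHom_last_apply {m : ℕ} (V : Matrix (Fin (m + 1)) (Fin (m + 1)) S) (b : Fin (m + 2))
    (hV : ∀ b, V (Fin.last m) b = if b = Fin.last m then 1 else 0) :
    borderHom V (Fin.last (m + 1)) b = if b = Fin.last (m + 1) then 1 else 0 := by
  rw [borderHom_apply, ← Fin.succ_last]
  refine Fin.cases ?_ (fun b => ?_) b
  · rw [border_succ_zero, if_neg (Fin.succ_ne_zero _).symm]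
    rfl
  · simp only [border_succ_succ, hV, Fin.succ_inj]

theorem isUnit_borderHom {m : ℕ} {U : Matrix (Fin m) (Fin m) S} (h : IsUnit U) :
    IsUnit (borderHom U) := h.map borderHom

variable {R : Type*} [CommRing R] [Algebra R S]

/-- The elimination of the first block of a Fiedler pencil. -/
theorem fiedler_step (x : R) {m : ℕ} (u v T₀ : S) (Z₁ Z₂ W : Matrix (Fin (m + 1)) (Fin (m + 1)) S) :
    ∃ r c : Fin (m + 1) → S,
      border (-1) 0 c 1 *
        (x • (borderHom Z₁ * border 0 (Pi.single 0 u) (Pi.single 0 v)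
          (blockElem (m + 1) (-((m + 1 : ℕ) : ℤ)) T₀) * borderHom Z₂) - borderHom W)
        * border 1 r 0 1
      = borderHom (x • (Z₁ * blockElem (m + 1) (-((m + 1 : ℕ) : ℤ)) (T₀ + x • (v * u)) * Z₂)
          - W) := by
  -- The first block row and column of the pencil itself, outside the corner −1.
  refine ⟨fun j => x • (u * Z₂ 0 j), fun i => x • (Z₁ i 0 * v), ?_⟩
  have hK : x • (borderHom Z₁ * border 0 (Pi.single 0 u) (Pi.single 0 v)
          (blockElem (m + 1) (-((m + 1 : ℕ) : ℤ)) T₀) * borderHom Z₂) - borderHom W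
      = border (-1) (fun j => x • (u * Z₂ 0 j)) (fun i => x • (Z₁ i 0 * v))
          (x • (Z₁ * blockElem (m + 1) (-((m + 1 : ℕ) : ℤ)) T₀ * Z₂) - W) := by
    simp only [borderHom_apply, border_mul]
    refine border_ext ?_ ?_ ?_ ?_ <;> intros <;>
      simp [Matrix.vecMul, Matrix.mulVec, dotProduct, Pi.single_apply]
  rw [hK, border_elim]
  congr 1
  have hT : blockElem (m + 1) (-((m + 1 : ℕ) : ℤ)) (T₀ + x • (v * u))
      = blockElem (m + 1) (-((m + 1 : ℕ) : ℤ)) T₀ + x • Matrix.single 0 0 (v * u) := by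
    ext a b
    simp only [Matrix.add_apply, Matrix.smul_apply, Matrix.single_apply]
    rw [blockElem_top_apply (by omega), blockElem_top_apply (by omega)]
    by_cases ha : a = 0
    · subst ha
      by_cases hb : 0 = b <;> simp [hb]
    · have ha' : (a : ℕ) ≠ 0 := by simpa using ha
      simp [ha', Ne.symm ha]
  rw [hT]
  -- The Schur complement contributes x² Z₁ E (vu) Z₂ with E the first diagonal unit. One x belongs
  -- to the pencil; the other is absorbed in the new coefficient T₀ + x vu.
  have : Matrix.vecMulVec (fun i => x • (Z₁ i 0 * v)) (fun j => x • (u * Z₂ 0 j))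
      = x • (Z₁ * (x • Matrix.single 0 0 (v * u)) * Z₂) := by
    ext i j
    simp [Matrix.vecMulVec_apply, Matrix.mul_apply, Matrix.single_apply, ite_and, mul_assoc]
  rw [this, mul_add, add_mul, smul_add]
  abel

/-- The order of the two adjacent factors decides whether A (m + 2) sits in the first row or in the
first column. In both cases the product v * u equals A (m + 2), so the coefficient is updated in the
same way. -/
theorem fiedler_step_prod (x : R) {m : ℕ} (A : ℕ → S) (a b t : List ℕ)
    (W : Matrix (Fin (m + 1)) (Fin (m + 1)) S)
    (ha : ∀ i ∈ a, i ≤ m) (hb : ∀ i ∈ b, i ≤ m)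
    (hp : let g := fun i : ℕ => blockElem (m + 2) (-(i : ℤ)) (A i)
      (t.map g).prod = (a.map g).prod * (g (m + 2) * g (m + 1)) * (b.map g).prod ∨
        (t.map g).prod = (a.map g).prod * (g (m + 1) * g (m + 2)) * (b.map g).prod) :
    ∃ r c : Fin (m + 1) → S,
      border (-1) 0 c 1 *
        (x • (t.map fun i : ℕ => blockElem (m + 2) (-(i : ℤ)) (A i)).prod - borderHom W)
        * border 1 r 0 1
      = borderHom (x • ((a ++ (m + 1) :: b).map fun i : ℕ => blockElem (m + 1) (-(i : ℤ))
          (Function.update A (m + 1) (A (m + 1) + x • A (m + 2)) i)).prod - W) := by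
  have hu : ∀ l : List ℕ, (∀ i ∈ l, i ≤ m) →
      l.map (fun i : ℕ => blockElem (m + 1) (-(i : ℤ))
        (Function.update A (m + 1) (A (m + 1) + x • A (m + 2)) i))
      = l.map fun i : ℕ => blockElem (m + 1) (-(i : ℤ)) (A i) := fun l hl =>
    List.map_congr_left fun i hi => by
      rw [Function.update_of_ne (by have := hl i hi; omega)]
  rw [List.map_append, List.map_cons, hu a ha, hu b hb, Function.update_self, List.prod_append,
    List.prod_cons, ← mul_assoc]
  dsimp only at hp
  rw [map_blockElem_prod_succ A a ha, map_blockElem_prod_succ A b hb, blockElem_top,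
    blockElem_second] at hp
  have h₁ : border (A (m + 2)) 0 0 (1 : Matrix (Fin (m + 1)) (Fin (m + 1)) S) *
      border 0 (Pi.single 0 1) (Pi.single 0 1)
        (blockElem (m + 1) (-((m + 1 : ℕ) : ℤ)) (A (m + 1)))
      = border 0 (Pi.single 0 (A (m + 2))) (Pi.single 0 1)
        (blockElem (m + 1) (-((m + 1 : ℕ) : ℤ)) (A (m + 1))) := by
    rw [border_mul]
    refine border_ext ?_ ?_ ?_ ?_ <;> intros <;> simp [Pi.single_apply, Matrix.one_apply]
  have h₂ : border 0 (Pi.single 0 1) (Pi.single 0 1)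
        (blockElem (m + 1) (-((m + 1 : ℕ) : ℤ)) (A (m + 1))) *
      border (A (m + 2)) 0 0 (1 : Matrix (Fin (m + 1)) (Fin (m + 1)) S)
      = border 0 (Pi.single 0 1) (Pi.single 0 (A (m + 2)))
        (blockElem (m + 1) (-((m + 1 : ℕ) : ℤ)) (A (m + 1))) := by
    rw [border_mul]
    refine border_ext ?_ ?_ ?_ ?_ <;> intros <;> simp [Pi.single_apply]
  rw [h₁, h₂] at hp
  rcases hp with hp | hp <;> rw [hp]
  · simpa using fiedler_step x (A (m + 2)) 1 (A (m + 1)) _ _ W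
  · simpa using fiedler_step x 1 (A (m + 2)) (A (m + 1)) _ _ W

/-- Fiedler pencils `x M_t - M_0`, where `t` lists `-m, …, -1` in any order, are equivalent to
`diag(I, ∑ x ^ i A_i)`, by transformations that fix the last block column, respectively row. -/
theorem exists_equiv_fiedler (x : R) (m : ℕ) (A : ℕ → S) (t : List ℕ) (ht : t.Nodup)
    (hmem : ∀ i, i ∈ t ↔ 1 ≤ i ∧ i ≤ m + 1) :
    ∃ U V : Matrix (Fin (m + 1)) (Fin (m + 1)) S, IsUnit U ∧ IsUnit V ∧
      (∀ a, U a (Fin.last m) = if a = Fin.last m then 1 else 0) ∧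
      (∀ b, V (Fin.last m) b = if b = Fin.last m then 1 else 0) ∧
      U * (x • (t.map fun i : ℕ => blockElem (m + 1) (-(i : ℤ)) (A i)).prod
          - blockElem (m + 1) 0 (-A 0)) * V
        = blockElem (m + 1) 0 (∑ i ∈ Finset.range (m + 2), x ^ i • A i) := by
  induction m generalizing A t with
  | zero =>
    have ht' : t = [1] := by
      refine List.perm_singleton.1 ((List.perm_ext_iff_of_nodup ht (by simp)).2 fun i => ?_)
      rw [hmem]
      simp
      omega
    subst ht'
    refine ⟨1, 1, isUnit_one, isUnit_one, fun a => by simp [Matrix.one_apply],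
      fun b => by simp [Matrix.one_apply, eq_comm], ?_⟩
    simp only [List.map_cons, List.map_nil, List.prod_cons, List.prod_nil, mul_one, one_mul,
      Nat.cast_one]
    rw [blockElem_one_top, blockElem_one_zero, blockElem_one_zero]
    ext a b
    simp [Finset.sum_range_succ, add_comm]
  | succ m ih =>
    have hc : m + 2 ∈ t := (hmem _).2 (by omega)
    have hd : m + 1 ∈ t := (hmem _).2 (by omega)
    -- The factor with the leading coefficient commutes with all factors except its neighbour of
    -- index −(m + 1), next to which it is moved.
    obtain ⟨a, b, hperm, hprod⟩ := exists_prod_eq_of_adjacent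
      (fun i : ℕ => blockElem (m + 2) (-(i : ℤ)) (A i)) ht hc hd (by omega) fun i hi hne => by
        by_cases h : i = m + 2
        · subst h; exact Commute.refl _
        · exact commute_blockElem_top (by have := (hmem i).1 hi; omega) _ _
    have hnd : (a ++ (m + 1) :: b).Nodup := hperm.nodup_iff.2 (ht.erase _)
    have hmem' : ∀ i, i ∈ a ++ (m + 1) :: b ↔ 1 ≤ i ∧ i ≤ m + 1 := fun i => by
      rw [hperm.mem_iff, ht.mem_erase_iff, hmem]
      omega
    have hnot : m + 1 ∉ a ++ b := by
      rw [List.nodup_middle] at hnd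
      exact (List.nodup_cons.1 hnd).1
    have hle : ∀ i ∈ a ++ b, i ≤ m := fun i hi => by
      have := (hmem' i).1 (by simp at hi ⊢; tauto)
      have : i ≠ m + 1 := fun h => hnot (h ▸ hi)
      omega
    obtain ⟨r, c, hrc⟩ := fiedler_step_prod x A a b t (blockElem (m + 1) 0 (-A 0))
      (fun i hi => hle i (by simp [hi])) (fun i hi => hle i (by simp [hi])) hprod
    obtain ⟨U, V, hU, hV, hU', hV', hUV⟩ :=
      ih (Function.update A (m + 1) (A (m + 1) + x • A (m + 2))) _ hnd hmem'
    rw [Function.update_of_ne (by omega)] at hUV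
    have h0 := blockElem_succ m 0 (Nat.zero_le _) (-A 0)
    simp only [Nat.cast_zero, neg_zero] at h0
    refine ⟨borderHom U * border (-1) 0 c 1, border 1 r 0 1 * borderHom V,
      (isUnit_borderHom hU).mul (isUnit_border_lower c),
      (isUnit_border_upper r).mul (isUnit_borderHom hV), fun a => ?_, fun b => ?_, ?_⟩
    -- The elimination matrix differs from a diagonal one only in its first column, so its last
    -- column is a unit vector and that of the product is inherited from `borderHom U`.
    · rw [Matrix.mul_apply, Finset.sum_eq_single (Fin.last (m + 1))]
      · rw [borderHom_apply_last U a hU', ← Fin.succ_last, border_succ_succ]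
        simp
      · intro j _ hj
        have : border (-1) 0 c 1 j (Fin.last (m + 1)) = 0 := by
          rw [← Fin.succ_last] at hj ⊢
          refine Fin.cases (fun _ => rfl) (fun j hj => ?_) j hj
          rw [border_succ_succ, Matrix.one_apply_ne (fun h => hj (by rw [h]))]
        rw [this, mul_zero]
      · simp
    · rw [Matrix.mul_apply, Finset.sum_eq_single (Fin.last (m + 1))]
      · rw [borderHom_last_apply V b hV', ← Fin.succ_last, border_succ_succ]
        simp
      · intro j _ hj
        have : border 1 r 0 1 (Fin.last (m + 1)) j = 0 := by
          rw [← Fin.succ_last] at hj ⊢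
          refine Fin.cases (fun _ => rfl) (fun j hj => ?_) j hj
          rw [border_succ_succ, Matrix.one_apply_ne (fun h => hj (by rw [← h]))]
        rw [this, zero_mul]
      · simp
    · rw [h0]
      have : ∀ K, borderHom U * border (-1) 0 c 1 * K * (border 1 r 0 1 * borderHom V)
          = borderHom U * (border (-1) 0 c 1 * K * border 1 r 0 1) * borderHom V := fun K => by
        simp only [mul_assoc]
      rw [this, hrc, ← map_mul, ← map_mul, hUV]
      have h1 := blockElem_succ m 0 (Nat.zero_le _) (∑ i ∈ Finset.range (m + 3), x ^ i • A i)
      simp only [Nat.cast_zero, neg_zero] at h1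
      rw [h1]
      congr 2
      -- The Horner identity x^(m+1) (A_{m+1} + x A_{m+2}) = x^(m+1) A_{m+1} + x^(m+2) A_{m+2}.
      rw [show m + 1 + 2 = m + 3 from rfl, Finset.sum_range_succ (n := m + 2),
        Finset.sum_range_succ (n := m + 1), Finset.sum_range_succ (n := m + 1),
        Function.update_self, smul_add, smul_smul, ← pow_succ, add_assoc]
      rw [← add_assoc]
      congr 2
      refine Finset.sum_congr rfl fun i hi => ?_
      rw [Function.update_of_ne (by have := Finset.mem_range.1 hi; omega)]

end Reduction

/-! ### Index tuples of natural numbers -/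

/-- The tuple `(0:p-1, 0:p-2, …, 0:1, 0)`. -/
def hankelTuple : ℕ → List ℕ
  | 0 => []
  | p + 1 => List.range (p + 1) ++ hankelTuple p

/-- The admissible tuple of `{0:p+2s}` of index `p`. -/
def admTuple (p : ℕ) : ℕ → List ℕ
  | 0 => List.range (p + 1)
  | s + 1 => (p + 2 * s + 1) :: (p + 2 * s + 2) :: admTuple p s

/-- The symmetric complement of the admissible tuple of `{0:p+2s}` of index `p`. -/
def admCompl (p : ℕ) : ℕ → List ℕ
  | 0 => hankelTuple p
  | s + 1 => (p + 2 * s + 1) :: admCompl p s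

/-- The recursion splits off the first pair, which has the largest indices; later inductions run
over the number s of pairs. -/
theorem admissibleTuple_eq (p s : ℕ) :
    admissibleTuple (p + 2 * s) p = (admTuple p s).map (fun i : ℕ => (i : ℤ)) := by
  have h : (p + 2 * s - p) / 2 = s := by omega
  unfold admissibleTuple
  rw [h]
  clear h
  induction s with
  | zero => simp [admTuple]
  | succ s ih =>
    rw [List.range_succ, List.reverse_append, List.reverse_singleton, List.singleton_append,
      List.flatMap_cons, List.append_assoc, ih, admTuple]
    simp

theorem hankelTuple_eq (p : ℕ) :
    (List.range p).reverse.flatMap (fun q : ℕ => (List.range (q + 1)).map (fun k : ℕ => (k : ℤ)))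
      = (hankelTuple p).map (fun i : ℕ => (i : ℤ)) := by
  induction p with
  | zero => simp [hankelTuple]
  | succ p ih =>
    rw [List.range_succ, List.reverse_append, List.reverse_singleton, List.singleton_append,
      List.flatMap_cons, ih, hankelTuple, List.map_append]

theorem symmComplement_eq (p s : ℕ) :
    symmComplement (p + 2 * s) p = (admCompl p s).map (fun i : ℕ => (i : ℤ)) := by
  have h : (p + 2 * s - p) / 2 = s := by omega
  unfold symmComplement
  rw [h, hankelTuple_eq]
  clear h
  induction s with
  | zero => simp [admCompl]
  | succ s ih =>
    rw [List.range_succ, List.reverse_append, List.reverse_singleton, List.singleton_append,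
      List.map_cons, List.cons_append, ih, admCompl]
    simp

theorem lt_of_mem_hankelTuple {p i : ℕ} (h : i ∈ hankelTuple p) : i < p := by
  induction p with
  | zero => simp [hankelTuple] at h
  | succ p ih =>
    rcases List.mem_append.1 h with h | h
    · exact List.mem_range.1 h
    · exact (ih h).trans (Nat.lt_succ_self p)

theorem mem_admTuple {p s i : ℕ} : i ∈ admTuple p s ↔ i ≤ p + 2 * s := by
  induction s with
  | zero => simp [admTuple]
  | succ s ih =>
    simp only [admTuple, List.mem_cons, ih]
    omega

theorem nodup_admTuple (p s : ℕ) : (admTuple p s).Nodup := by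
  induction s with
  | zero => exact List.nodup_range
  | succ s ih =>
    simp only [admTuple, List.nodup_cons, List.mem_cons, mem_admTuple, ih, and_true]
    omega

theorem lt_of_mem_admCompl {p s i : ℕ} (h : i ∈ admCompl p s) : i < p + 2 * s := by
  induction s with
  | zero => exact lt_of_mem_hankelTuple h
  | succ s ih =>
    rcases List.mem_cons.1 h with h | h
    · omega
    · have := ih h
      omega

/-- For index 0 the complement avoids the possibly singular factors: M_0 on the side of w, and
M_{-m} on the side of z. -/
theorem pos_of_mem_admCompl_zero {s i : ℕ} (h : i ∈ admCompl 0 s) : 0 < i := by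
  induction s with
  | zero => simp [admCompl, hankelTuple] at h
  | succ s ih =>
    rcases List.mem_cons.1 h with h | h
    · omega
    · exact ih h

/-- The tuple `(2s-1:2s, …, 3:4, 1:2)`. -/
def pairTuple : ℕ → List ℕ
  | 0 => []
  | s + 1 => (2 * s + 1) :: (2 * s + 2) :: pairTuple s

theorem admTuple_zero_eq (s : ℕ) : admTuple 0 s = pairTuple s ++ [0] := by
  induction s with
  | zero => rfl
  | succ s ih => simp [admTuple, pairTuple, ih]

theorem mem_pairTuple {s i : ℕ} : i ∈ pairTuple s ↔ 1 ≤ i ∧ i ≤ 2 * s := by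
  induction s with
  | zero => simp [pairTuple]; omega
  | succ s ih =>
    simp only [pairTuple, List.mem_cons, ih]
    omega

theorem nodup_pairTuple (s : ℕ) : (pairTuple s).Nodup := by
  have := nodup_admTuple 0 s
  rw [admTuple_zero_eq] at this
  exact (List.nodup_append.1 this).1

/-! ### Palindromic products -/

section Palindromes

variable {M : Type*} [Monoid M] (g : ℕ → M)

/-- A run passes through the Hankel tuple and leaves it reversed: its last entry p + 1 commutes with
the entries of `hankelTuple p`, which are less than p, and the rest is induction. -/
theorem prod_range_mul_hankel {p : ℕ} (hg : ∀ i j, j ≤ p → i + 2 ≤ j → Commute (g i) (g j)) :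
    ((List.range (p + 1)).map g).prod * ((hankelTuple p).map g).prod
      = ((hankelTuple p).map g).prod * ((List.range (p + 1)).reverse.map g).prod := by
  induction p with
  | zero => simp [hankelTuple]
  | succ p ih =>
    have hc : Commute (g (p + 1)) ((hankelTuple p).map g).prod :=
      commute_prod_map g _ _ fun i hi =>
        (hg i (p + 1) le_rfl (by have := lt_of_mem_hankelTuple hi; omega)).symm
    have ih' := ih fun i j hj => hg i j (by omega)
    rw [List.range_succ (n := p + 1), hankelTuple]
    simp only [List.map_append, List.prod_append, List.reverse_append, List.reverse_singleton,
      List.map_cons, List.map_nil, List.prod_singleton]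
    generalize ((List.range (p + 1)).map g).prod = r at *
    generalize ((List.range (p + 1)).reverse.map g).prod = r' at *
    generalize ((hankelTuple p).map g).prod = H at *
    calc r * g (p + 1) * (r * H) = r * (g (p + 1) * H) * r' := by rw [ih']; simp only [mul_assoc]
      _ = r * H * (g (p + 1) * r') := by rw [hc.eq]; simp only [mul_assoc]

theorem prod_reverse_hankel {p : ℕ} (hg : ∀ i j, j < p → i + 2 ≤ j → Commute (g i) (g j)) :
    ((hankelTuple p).reverse.map g).prod = ((hankelTuple p).map g).prod := by
  induction p with
  | zero => simp [hankelTuple]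
  | succ p ih =>
    rw [hankelTuple, List.reverse_append, List.map_append, List.prod_append,
      ih fun i j hj => hg i j (by omega), List.map_append, List.prod_append,
      prod_range_mul_hankel g fun i j hj => hg i j (by omega)]

/-- Each entry in front of the Hankel part exceeds all later entries by at least two, so its factor
may be moved to the other end. -/
theorem prod_reverse_admCompl {p s : ℕ}
    (hg : ∀ i j, j ≤ p + 2 * s → i + 2 ≤ j → Commute (g i) (g j)) :
    ((admCompl p s).reverse.map g).prod = ((admCompl p s).map g).prod := by
  induction s with
  | zero => exact prod_reverse_hankel g fun i j hj => hg i j (by omega)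
  | succ s ih =>
    have hc : Commute (g (p + 2 * s + 1)) ((admCompl p s).map g).prod :=
      commute_prod_map g _ _ fun i hi =>
        (hg i _ (by omega) (by have := lt_of_mem_admCompl hi; omega)).symm
    rw [admCompl, List.reverse_cons, List.map_append, List.prod_append,
      ih fun i j hj => hg i j (by omega)]
    simp [hc.eq]

/-- This is the purpose of the symmetric complement. In a new layer, p + 2s + 2 commutes with the
whole older tuple and p + 2s + 1 with the older complement; so, up to commutations, the new entries
surround the old palindrome symmetrically. -/
theorem prod_reverse_admTuple_append {p s : ℕ}
    (hg : ∀ i j, j ≤ p + 2 * s → i + 2 ≤ j → Commute (g i) (g j)) :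
    ((admTuple p s ++ admCompl p s).reverse.map g).prod
      = ((admTuple p s ++ admCompl p s).map g).prod := by
  induction s with
  | zero =>
    -- Without pairs, the tuple followed by its complement is the next Hankel tuple.
    have := prod_reverse_hankel g (p := p + 1) fun i j hj => hg i j (by omega)
    simpa [hankelTuple, admTuple, admCompl] using this
  | succ s ih =>
    have hc : Commute (g (p + 2 * s + 1)) ((admCompl p s).map g).prod :=
      commute_prod_map g _ _ fun i hi =>
        (hg i _ (by omega) (by have := lt_of_mem_admCompl hi; omega)).symm
    have hb : Commute (g (p + 2 * s + 2)) ((admTuple p s ++ admCompl p s).map g).prod :=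
      commute_prod_map g _ _ fun i hi => by
        have : i ≤ p + 2 * s := by
          rcases List.mem_append.1 hi with hi | hi
          · exact mem_admTuple.1 hi
          · exact (lt_of_mem_admCompl hi).le
        exact (hg i _ (by omega) (by omega)).symm
    have hC := prod_reverse_admCompl g (p := p) (s := s) fun i j hj => hg i j (by omega)
    have ih' := ih fun i j hj => hg i j (by omega)
    simp only [admTuple, admCompl, List.reverse_append, List.reverse_cons, List.map_append,
      List.map_cons, List.map_nil, List.prod_append, List.prod_cons, List.prod_nil, mul_one] at *
    rw [hC] at ih' ⊢
    generalize ((admTuple p s).map g).prod = Y at *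
    generalize ((admTuple p s).reverse.map g).prod = Y' at *
    generalize ((admCompl p s).map g).prod = C at *
    generalize g (p + 2 * s + 1) = a at *
    generalize g (p + 2 * s + 2) = b at *
    calc C * a * (Y' * b * a) = a * (C * Y') * b * a := by rw [← hc.eq]; simp only [mul_assoc]
      _ = a * (b * (Y * C)) * a := by rw [ih', hb.eq]; simp only [mul_assoc]
      _ = a * (b * Y) * (a * C) := by rw [hc.eq]; simp only [mul_assoc]

end Palindromes

/-! ### Matrices that agree with the identity outside of an interval of blocks -/

section Support

variable {S : Type*} [Ring S] {m : ℕ}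

/-- `M` agrees with the identity matrix outside of the rows and columns `lo, …, hi`. -/
def SupportedOn (lo hi : ℕ) (M : Matrix (Fin m) (Fin m) S) : Prop :=
  ∀ a b : Fin m, ¬ ((lo ≤ a ∧ (a : ℕ) ≤ hi) ∧ (lo ≤ b ∧ (b : ℕ) ≤ hi)) →
    M a b = (1 : Matrix (Fin m) (Fin m) S) a b

theorem SupportedOn.mono {lo hi lo' hi' : ℕ} {M : Matrix (Fin m) (Fin m) S}
    (h : SupportedOn lo hi M) (hlo : lo' ≤ lo) (hhi : hi ≤ hi') : SupportedOn lo' hi' M :=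
  fun a b hab => h a b fun ⟨⟨h₁, h₂⟩, h₃, h₄⟩ =>
    hab ⟨⟨hlo.trans h₁, h₂.trans hhi⟩, hlo.trans h₃, h₄.trans hhi⟩

theorem supportedOn_one (lo hi : ℕ) : SupportedOn lo hi (1 : Matrix (Fin m) (Fin m) S) :=
  fun _ _ _ => rfl

theorem SupportedOn.sub_one_mul_sub_one {lo hi lo' hi' : ℕ} {M N : Matrix (Fin m) (Fin m) S}
    (hM : SupportedOn lo hi M) (hN : SupportedOn lo' hi' N) (h : hi < lo' ∨ hi' < lo) :
    (M - 1) * (N - 1) = 0 := by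
  ext a b
  rw [Matrix.mul_apply]
  refine Finset.sum_eq_zero fun c _ => ?_
  rw [Matrix.sub_apply, Matrix.sub_apply]
  by_cases hc : lo ≤ c ∧ (c : ℕ) ≤ hi
  · rw [hN c b (by omega), sub_self, mul_zero]
  · rw [hM a c (fun h => hc h.2), sub_self, zero_mul]

/-- On disjoint intervals (M − 1)(N − 1) and (N − 1)(M − 1) both vanish, so MN and NM equal M + N −
1. -/
theorem SupportedOn.commute {lo hi lo' hi' : ℕ} {M N : Matrix (Fin m) (Fin m) S}
    (hM : SupportedOn lo hi M) (hN : SupportedOn lo' hi' N) (h : hi < lo' ∨ hi' < lo) :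
    Commute M N := by
  have h₁ := hM.sub_one_mul_sub_one hN h
  have h₂ := hN.sub_one_mul_sub_one hM h.symm
  have h₃ : M * N = (M - 1) * (N - 1) + M + N - 1 := by noncomm_ring
  have h₄ : N * M = (N - 1) * (M - 1) + M + N - 1 := by noncomm_ring
  rw [Commute, SemiconjBy, h₃, h₄, h₁, h₂]

theorem SupportedOn.mul {lo hi : ℕ} {M N : Matrix (Fin m) (Fin m) S}
    (hM : SupportedOn lo hi M) (hN : SupportedOn lo hi N) : SupportedOn lo hi (M * N) := by
  intro a b hab
  rw [Matrix.mul_apply]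
  by_cases ha : lo ≤ a ∧ (a : ℕ) ≤ hi
  · rw [Finset.sum_eq_single b]
    · rw [hM a b hab, hN b b (fun h => hab ⟨ha, h.1⟩), Matrix.one_apply_eq, mul_one]
    · intro c _ hc
      rw [hN c b (fun h => hab ⟨ha, h.2⟩), Matrix.one_apply_ne hc, mul_zero]
    · simp
  · rw [Finset.sum_eq_single a]
    · rw [hM a a (fun h => ha h.1), Matrix.one_apply_eq, one_mul, hN a b hab]
    · intro c _ hc
      rw [hM a c (fun h => ha h.1), Matrix.one_apply_ne hc.symm, zero_mul]
    · simp

theorem SupportedOn.list_prod {ι : Type*} {lo hi : ℕ} (g : ι → Matrix (Fin m) (Fin m) S)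
    (t : List ι) (h : ∀ i ∈ t, SupportedOn lo hi (g i)) : SupportedOn lo hi (t.map g).prod := by
  induction t with
  | nil => exact supportedOn_one lo hi
  | cons i t ih =>
    rw [List.map_cons, List.prod_cons]
    exact (h i (by simp)).mul (ih fun j hj => h j (by simp [hj]))

/-- The `a`-th vector of the standard basis. -/
def basisVec (m : ℕ) (S : Type*) [Ring S] (a : ℕ) : Fin m → S := fun i => if (i : ℕ) = a then 1 else 0

theorem basisVec_vecMul {M : Matrix (Fin m) (Fin m) S} {a : ℕ} (ha : a < m) :
    basisVec m S a ᵥ* M = M ⟨a, ha⟩ := by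
  ext j
  rw [Matrix.vecMul, dotProduct, Finset.sum_eq_single ⟨a, ha⟩]
  · simp [basisVec]
  · intro b _ hb
    have : (b : ℕ) ≠ a := fun h => hb (Fin.ext h)
    simp [basisVec, this]
  · simp

theorem mulVec_basisVec {M : Matrix (Fin m) (Fin m) S} {a : ℕ} (ha : a < m) :
    M *ᵥ basisVec m S a = fun i => M i ⟨a, ha⟩ := by
  ext j
  rw [Matrix.mulVec, dotProduct, Finset.sum_eq_single ⟨a, ha⟩]
  · simp [basisVec]
  · intro b _ hb
    have : (b : ℕ) ≠ a := fun h => hb (Fin.ext h)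
    simp [basisVec, this]
  · simp

theorem SupportedOn.vecMul {lo hi a : ℕ} {M : Matrix (Fin m) (Fin m) S} (hM : SupportedOn lo hi M)
    (ha : a < m) (h : a < lo ∨ hi < a) : basisVec m S a ᵥ* M = basisVec m S a := by
  rw [basisVec_vecMul ha]
  ext j
  rw [hM _ _ (fun h' => by have := h'.1; simp at this; omega)]
  simp [basisVec, Matrix.one_apply, Fin.ext_iff, eq_comm]

theorem SupportedOn.mulVec {lo hi a : ℕ} {M : Matrix (Fin m) (Fin m) S} (hM : SupportedOn lo hi M)
    (ha : a < m) (h : a < lo ∨ hi < a) : M *ᵥ basisVec m S a = basisVec m S a := by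
  rw [mulVec_basisVec ha]
  ext j
  rw [hM _ _ (fun h' => by have := h'.2; simp at this; omega)]
  simp [basisVec, Matrix.one_apply, Fin.ext_iff]

end Support

/-! ### Fiedler factors over an arbitrary ring of blocks -/

section Factors

variable {S : Type*} [Ring S]

/-- The factor `M_i(-A_i)`, `0 ≤ i`. -/
def lowFactor (m : ℕ) (A : ℕ → S) (i : ℕ) : Matrix (Fin m) (Fin m) S := blockElem m (i : ℤ) (-A i)

/-- The factor `M_{j-m}(A_{m-j})`, `j < m`. -/
def highFactor (m : ℕ) (A : ℕ → S) (j : ℕ) : Matrix (Fin m) (Fin m) S :=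
  blockElem m (-((m - j : ℕ) : ℤ)) (A (m - j))

variable {m : ℕ} (A : ℕ → S)

/-- Blocks are counted from 0. For i = 0 the interval extends one step beyond the last block, which
is harmless. -/
theorem supportedOn_lowFactor {i : ℕ} (hi : i < m) :
    SupportedOn (m - i - 1) (m - i) (lowFactor m A i) := by
  intro a b hab
  unfold lowFactor
  rcases Nat.eq_zero_or_pos i with rfl | hi0
  · rw [Nat.cast_zero, blockElem_zero_apply, Matrix.one_apply]
    split_ifs <;> first | rfl | (exfalso; omega)
  · rw [blockElem_pos_apply hi0, Matrix.one_apply]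
    split_ifs <;> first | rfl | (exfalso; omega)

/-- For j = 0 truncated subtraction leaves just block 0, the support of diag(A_m, I). -/
theorem supportedOn_highFactor {j : ℕ} (hj : j < m) :
    SupportedOn (j - 1) j (highFactor m A j) := by
  intro a b hab
  unfold highFactor
  rcases Nat.eq_zero_or_pos j with rfl | hj0
  · rw [Nat.sub_zero, blockElem_top_apply hj, Matrix.one_apply]
    split_ifs <;> first | rfl | (exfalso; omega)
  · rw [blockElem_neg_apply (by omega) (by omega), Matrix.one_apply]
    split_ifs <;> first | rfl | (exfalso; omega)

theorem commute_lowFactor {i j : ℕ} (hj : j < m) (hij : i + 2 ≤ j) :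
    Commute (lowFactor m A i) (lowFactor m A j) :=
  (supportedOn_lowFactor A (by omega)).commute (supportedOn_lowFactor A hj) (by omega)

theorem commute_highFactor {i j : ℕ} (hj : j < m) (hij : i + 2 ≤ j) :
    Commute (highFactor m A i) (highFactor m A j) :=
  (supportedOn_highFactor A (by omega)).commute (supportedOn_highFactor A hj) (by omega)

theorem commute_lowFactor_highFactor {i j : ℕ} (hij : i + j + 2 ≤ m) :
    Commute (lowFactor m A i) (highFactor m A j) :=
  (supportedOn_lowFactor A (by omega)).commute (supportedOn_highFactor A (by omega)) (by omega)

/-- The unit entries of the factors shift basis vectors by one place. Long products are evaluated by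
following a single basis vector through such shifts. -/
theorem lowFactor_mulVec {i : ℕ} (hi0 : 0 < i) (hi : i < m) :
    lowFactor m A i *ᵥ basisVec m S (m - i) = basisVec m S (m - i - 1) := by
  rw [mulVec_basisVec (by omega)]
  ext a
  rw [lowFactor, blockElem_pos_apply hi0, basisVec]
  simp only [Fin.ext_iff, and_true]
  split_ifs <;> first | rfl | (exfalso; omega)

theorem vecMul_lowFactor {i : ℕ} (hi0 : 0 < i) (hi : i < m) :
    basisVec m S (m - i) ᵥ* lowFactor m A i = basisVec m S (m - i - 1) := by
  rw [basisVec_vecMul (by omega : _ < m)]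
  ext a
  rw [lowFactor, blockElem_pos_apply hi0, basisVec]
  simp only [Fin.ext_iff, true_and]
  split_ifs <;> first | rfl | (exfalso; omega)

theorem vecMul_highFactor {j : ℕ} (hj : j + 1 < m) :
    basisVec m S j ᵥ* highFactor m A (j + 1) = basisVec m S (j + 1) := by
  rw [basisVec_vecMul (by omega : _ < m)]
  ext a
  rw [highFactor, blockElem_neg_apply (by omega) (by omega), basisVec]
  simp only [Fin.ext_iff]
  split_ifs <;> first | rfl | (exfalso; omega)

theorem vecMul_highFactor_succ {j : ℕ} (hj : j + 1 < m) :
    basisVec m S (j + 1) ᵥ* highFactor m A (j + 1)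
      = basisVec m S j + A (m - (j + 1)) • basisVec m S (j + 1) := by
  rw [basisVec_vecMul (by omega : _ < m)]
  ext a
  rw [highFactor, blockElem_neg_apply (by omega) (by omega), Pi.add_apply, Pi.smul_apply, basisVec,
    basisVec]
  simp only [Fin.ext_iff]
  split_ifs <;> first | (exfalso; omega) | simp

theorem vecMul_highFactor_zero (hm : 0 < m) :
    basisVec m S 0 ᵥ* highFactor m A 0 = A m • basisVec m S 0 := by
  rw [basisVec_vecMul hm]
  ext a
  rw [highFactor, Nat.sub_zero, blockElem_top_apply hm, Pi.smul_apply, basisVec]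
  simp only [Fin.ext_iff]
  split_ifs <;> first | (exfalso; omega) | simp

theorem vecMul_lowFactor_pred {i : ℕ} (hi0 : 0 < i) (hi : i < m) :
    basisVec m S (m - i - 1) ᵥ* lowFactor m A i
      = -A i • basisVec m S (m - i - 1) + basisVec m S (m - i) := by
  rw [basisVec_vecMul (by omega : _ < m)]
  ext a
  rw [lowFactor, blockElem_pos_apply hi0, Pi.add_apply, Pi.smul_apply, basisVec, basisVec]
  simp only [Fin.ext_iff]
  split_ifs <;> first | (exfalso; omega) | simp

theorem eq_one_of_basisVec_vecMul {M : Matrix (Fin m) (Fin m) S}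
    (h : ∀ a < m, basisVec m S a ᵥ* M = basisVec m S a) : M = 1 := by
  ext a b
  have := congrFun (h a a.2) b
  rw [basisVec_vecMul a.2] at this
  simpa [basisVec, Matrix.one_apply, Fin.ext_iff, eq_comm] using this

/-- `M_i(-A_i) M_{-i}(A_i) = 1`, for `0 < i < m`. -/
theorem lowFactor_mul_highFactor {i : ℕ} (hi0 : 0 < i) (hi : i < m) :
    lowFactor m A i * highFactor m A (m - i) = 1 := by
  obtain ⟨j, hj⟩ : ∃ j, m - i = j + 1 := ⟨m - i - 1, by omega⟩
  have h₁ := vecMul_lowFactor_pred A hi0 hi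
  have h₂ := vecMul_lowFactor A hi0 hi
  have h₃ := vecMul_highFactor A (m := m) (j := j) (by omega)
  have h₄ := vecMul_highFactor_succ A (m := m) (j := j) (by omega)
  have hj' : m - (j + 1) = i := by omega
  rw [hj, Nat.add_sub_cancel] at h₁ h₂
  rw [hj]
  rw [hj'] at h₄
  refine eq_one_of_basisVec_vecMul fun a ha => ?_
  rw [← Matrix.vecMul_vecMul]
  rcases eq_or_ne a j with rfl | haj
  · rw [h₁, Matrix.add_vecMul, Matrix.smul_vecMul, h₃, h₄]
    simp
  rcases eq_or_ne a (j + 1) with rfl | haj'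
  · rw [h₂, h₃]
  · rw [(supportedOn_lowFactor A hi).vecMul ha (by omega),
      (supportedOn_highFactor A (by omega : j + 1 < m)).vecMul ha (by omega)]

/-- `M_{-i}(A_i) M_i(-A_i) = 1`, for `0 < i < m`. -/
theorem highFactor_mul_lowFactor {i : ℕ} (hi0 : 0 < i) (hi : i < m) :
    highFactor m A (m - i) * lowFactor m A i = 1 := by
  obtain ⟨j, hj⟩ : ∃ j, m - i = j + 1 := ⟨m - i - 1, by omega⟩
  have h₁ := vecMul_lowFactor_pred A hi0 hi
  have h₂ := vecMul_lowFactor A hi0 hi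
  have h₃ := vecMul_highFactor A (m := m) (j := j) (by omega)
  have h₄ := vecMul_highFactor_succ A (m := m) (j := j) (by omega)
  have hj' : m - (j + 1) = i := by omega
  rw [hj, Nat.add_sub_cancel] at h₁ h₂
  rw [hj]
  rw [hj'] at h₄
  refine eq_one_of_basisVec_vecMul fun a ha => ?_
  rw [← Matrix.vecMul_vecMul]
  rcases eq_or_ne a j with rfl | haj
  · rw [h₃, h₂]
  rcases eq_or_ne a (j + 1) with rfl | haj'
  · rw [h₄, Matrix.add_vecMul, Matrix.smul_vecMul, h₁, h₂]
    simp
  · rw [(supportedOn_highFactor A (by omega : j + 1 < m)).vecMul ha (by omega),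
      (supportedOn_lowFactor A hi).vecMul ha (by omega)]

/-- For j > 0 the inverse is the low factor of opposite index, whatever its coefficient; only M_{-m}
needs an invertible A m. -/
theorem isUnit_highFactor {j : ℕ} (hj : j < m) (h : j ≠ 0 ∨ IsUnit (A m)) :
    IsUnit (highFactor m A j) := by
  rcases Nat.eq_zero_or_pos j with rfl | hj0
  · obtain ⟨u, hu⟩ := h.resolve_left (by simp)
    have hdiag : ∀ x y : S, blockElem m (-(m : ℤ)) x * blockElem m (-(m : ℤ)) y
        = blockElem m (-(m : ℤ)) (x * y) := fun x y => by
      ext a b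
      rw [Matrix.mul_apply, Finset.sum_eq_single a]
      · simp only [blockElem_top_apply hj]
        split_ifs <;> simp
      · intro c _ hc
        rw [blockElem_top_apply hj, if_neg hc.symm, zero_mul]
      · simp
    have hone : blockElem m (-(m : ℤ)) (1 : S) = 1 := by
      ext a b
      rw [blockElem_top_apply hj, Matrix.one_apply]
      simp
    rw [highFactor, Nat.sub_zero, ← hu]
    exact ⟨⟨blockElem m (-(m : ℤ)) (u : S), blockElem m (-(m : ℤ)) (↑u⁻¹ : S),
      by rw [hdiag, Units.mul_inv, hone], by rw [hdiag, Units.inv_mul, hone]⟩, rfl⟩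
  · have hj' : m - (m - j) = j := by omega
    have h₁ := highFactor_mul_lowFactor A (m := m) (i := m - j) (by omega) (by omega)
    have h₂ := lowFactor_mul_highFactor A (m := m) (i := m - j) (by omega) (by omega)
    rw [hj'] at h₁ h₂
    exact ⟨⟨_, _, h₁, h₂⟩, rfl⟩

theorem isUnit_lowFactor {i : ℕ} (hi0 : 0 < i) (hi : i < m) : IsUnit (lowFactor m A i) :=
  ⟨⟨_, _, lowFactor_mul_highFactor A hi0 hi, highFactor_mul_lowFactor A hi0 hi⟩, rfl⟩

theorem isUnit_list_prod {ι M : Type*} [Monoid M] (g : ι → M) (t : List ι)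
    (h : ∀ i ∈ t, IsUnit (g i)) : IsUnit (t.map g).prod := by
  induction t with
  | nil => simp
  | cons i t ih =>
    rw [List.map_cons, List.prod_cons]
    exact (h i (by simp)).mul (ih fun j hj => h j (by simp [hj]))

/-- `(∏ M_i(-A_i))⁻¹ = ∏ M_{-i}(A_i)`, with the second product in the opposite order. -/
theorem prod_highFactor_mul_prod (t : List ℕ) (ht : ∀ i ∈ t, 0 < i ∧ i < m) :
    (t.reverse.map fun i : ℕ => highFactor m A (m - i)).prod * (t.map (lowFactor m A)).prod
      = 1 := by
  induction t with
  | nil => simp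
  | cons i t ih =>
    have := highFactor_mul_lowFactor A (ht i (by simp)).1 (ht i (by simp)).2
    simp only [List.reverse_cons, List.map_append, List.prod_append, List.map_cons, List.map_nil,
      List.prod_cons, List.prod_nil, mul_one, mul_assoc]
    rw [← mul_assoc (highFactor m A _), this, one_mul, ih fun j hj => ht j (by simp [hj])]

theorem prod_mul_prod_highFactor (t : List ℕ) (ht : ∀ i ∈ t, 0 < i ∧ i < m) :
    (t.map (lowFactor m A)).prod * (t.reverse.map fun i : ℕ => highFactor m A (m - i)).prod
      = 1 := by
  induction t with
  | nil => simp
  | cons i t ih =>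
    have := lowFactor_mul_highFactor A (ht i (by simp)).1 (ht i (by simp)).2
    simp only [List.reverse_cons, List.map_append, List.prod_append, List.map_cons, List.map_nil,
      List.prod_cons, List.prod_nil, mul_one, mul_assoc]
    rw [← mul_assoc (t.map _).prod, ih fun j hj => ht j (by simp [hj]), one_mul, this]

end Factors

/-! ### Reduction of L(λ) and of its reversal in block form -/

section BlockPencil

variable {S : Type*} [Ring S]

/-- The leading coefficient `M_z M_{c_w} M_{c_z}`, in block form. Here `w` is the admissible tuple
of `{0:2e}` of index `0` and `z + m` is the admissible tuple of `{0:p+2s}` of index `p`. -/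
def leadBlock (m e p s : ℕ) (A : ℕ → S) : Matrix (Fin m) (Fin m) S :=
  ((admTuple p s).map (highFactor m A)).prod * ((admCompl 0 e).map (lowFactor m A)).prod *
    ((admCompl p s).map (highFactor m A)).prod

/-- The constant coefficient `M_w M_{c_w} M_{c_z}`, in block form. -/
def constBlock (m e p s : ℕ) (A : ℕ → S) : Matrix (Fin m) (Fin m) S :=
  ((admTuple 0 e).map (lowFactor m A)).prod * ((admCompl 0 e).map (lowFactor m A)).prod *
    ((admCompl p s).map (highFactor m A)).prod

/-- The position `m - i_0(w)`, counted from `0`. -/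
def blockPos (m e : ℕ) : ℕ := if e = 0 then m - 1 else m - 2

theorem list_prod_map_matrix {S S' ι : Type*} [Ring S] [Ring S'] (f : S →+* S') {m : ℕ}
    (g : ι → Matrix (Fin m) (Fin m) S) (t : List ι) :
    (t.map g).prod.map f = (t.map fun i => (g i).map f).prod := by
  have := map_list_prod f.mapMatrix (t.map g)
  rw [List.map_map] at this
  exact this

theorem lowFactor_map {S S' : Type*} [Ring S] [Ring S'] (f : S →+* S') (m : ℕ) (A : ℕ → S) (i : ℕ) :
    (lowFactor m A i).map f = lowFactor m (fun i => f (A i)) i := by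
  rw [lowFactor, blockElem_map, map_neg, lowFactor]

theorem highFactor_map {S S' : Type*} [Ring S] [Ring S'] (f : S →+* S') (m : ℕ) (A : ℕ → S) (i : ℕ) :
    (highFactor m A i).map f = highFactor m (fun i => f (A i)) i := by
  rw [highFactor, blockElem_map, highFactor]

/-- Lets one pencil be read over constants, polynomials, proper functions and rational functions. -/
theorem leadBlock_map {S S' : Type*} [Ring S] [Ring S'] (f : S →+* S') (m e p s : ℕ) (A : ℕ → S) :
    (leadBlock m e p s A).map f = leadBlock m e p s fun i => f (A i) := by
  simp only [leadBlock, Matrix.map_mul, list_prod_map_matrix, lowFactor_map, highFactor_map]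

theorem constBlock_map {S S' : Type*} [Ring S] [Ring S'] (f : S →+* S') (m e p s : ℕ) (A : ℕ → S) :
    (constBlock m e p s A).map f = constBlock m e p s fun i => f (A i) := by
  simp only [constBlock, Matrix.map_mul, list_prod_map_matrix, lowFactor_map, highFactor_map]

variable {m : ℕ} (A : ℕ → S)

/-- Only the factor of index 1 moves the last basis vector, by one place: index 2 acts earlier and
misses block m − 1, and indices above 2 miss block m − 2. This is the origin of the position m −
i_0(w). -/
theorem prod_pairTuple_mulVec {e : ℕ} (he : 2 * e < m) :
    ((pairTuple e).map (lowFactor m A)).prod *ᵥ basisVec m S (m - 1)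
      = basisVec m S (blockPos m e) := by
  induction e with
  | zero => simp [pairTuple, blockPos]
  | succ e ih =>
    rw [pairTuple, List.map_cons, List.map_cons, List.prod_cons, List.prod_cons,
      ← Matrix.mulVec_mulVec, ← Matrix.mulVec_mulVec, ih (by omega)]
    rcases Nat.eq_zero_or_pos e with rfl | he0
    · rw [blockPos, if_pos rfl, blockPos, if_neg (by omega),
        (supportedOn_lowFactor A (by omega)).mulVec (by omega) (by omega)]
      exact lowFactor_mulVec A (by omega) (by omega)
    · rw [blockPos, if_neg (by omega), blockPos, if_neg (by omega),
        (supportedOn_lowFactor A (by omega)).mulVec (by omega) (by omega),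
        (supportedOn_lowFactor A (by omega)).mulVec (by omega) (by omega)]

/-- The same shift seen from the right: the complement is (2e − 1, …, 3, 1), and only its last entry
moves the last basis vector. -/
theorem vecMul_prod_admCompl_zero {e : ℕ} (he : 2 * e < m) :
    basisVec m S (m - 1) ᵥ* ((admCompl 0 e).map (lowFactor m A)).prod
      = basisVec m S (blockPos m e) := by
  induction e with
  | zero => simp [admCompl, hankelTuple, blockPos]
  | succ e ih =>
    rw [admCompl, List.map_cons, List.prod_cons, ← Matrix.vecMul_vecMul]
    rcases Nat.eq_zero_or_pos e with rfl | he0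
    · rw [blockPos, if_neg (by omega), vecMul_lowFactor A (by omega) (by omega)]
      simp [admCompl, hankelTuple, Nat.sub_sub]
    · rw [(supportedOn_lowFactor A (by omega)).vecMul (by omega) (by omega), ih (by omega),
        blockPos, if_neg (by omega), blockPos, if_neg (by omega)]

theorem supportedOn_prod_admCompl {p s : ℕ} (h : p + 2 * s < m) :
    SupportedOn 0 (p + 2 * s - 1) ((admCompl p s).map (highFactor m A)).prod :=
  SupportedOn.list_prod _ _ fun i hi => by
    have := lt_of_mem_admCompl hi
    exact (supportedOn_highFactor A (by omega)).mono (by omega) (by omega)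

theorem vecMul_prod_compl {e p s : ℕ} (hm : m = 2 * e + 1 + (p + 2 * s)) :
    basisVec m S (m - 1) ᵥ* (((admCompl 0 e).map (lowFactor m A)).prod *
      ((admCompl p s).map (highFactor m A)).prod) = basisVec m S (blockPos m e) := by
  rw [← Matrix.vecMul_vecMul, vecMul_prod_admCompl_zero A (by omega)]
  rcases Nat.eq_zero_or_pos (p + 2 * s) with h | h
  · obtain ⟨rfl, rfl⟩ : p = 0 ∧ s = 0 := by omega
    simp [admCompl, hankelTuple]
  · refine (supportedOn_prod_admCompl A (by omega)).vecMul ?_ (Or.inr ?_) <;>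
      unfold blockPos <;> split_ifs <;> omega

theorem isUnit_prod_compl {e p s : ℕ} (hm : m = 2 * e + 1 + (p + 2 * s))
    (hA : IsUnit (A m) ∨ p = 0) :
    IsUnit (((admCompl 0 e).map (lowFactor m A)).prod *
      ((admCompl p s).map (highFactor m A)).prod) := by
  refine (isUnit_list_prod _ _ fun i hi => ?_).mul (isUnit_list_prod _ _ fun i hi => ?_)
  · have := lt_of_mem_admCompl hi
    exact isUnit_lowFactor A (pos_of_mem_admCompl_zero hi) (by omega)
  · have := lt_of_mem_admCompl hi
    refine isUnit_highFactor A (by omega) (hA.symm.imp (fun hp => ?_) id)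
    subst hp
    exact (pos_of_mem_admCompl_zero hi).ne'

variable {R : Type*} [CommRing R] [Algebra R S]

/-- The pencil `x M_z M_{c_w} M_{c_z} - M_w M_{c_w} M_{c_z}` is equivalent to
`diag(I, ∑ x ^ i A_i)`. -/
theorem exists_equiv_blockPencil (x : R) {e p s : ℕ} (hm : m = 2 * e + 1 + (p + 2 * s))
    (hA : IsUnit (A m) ∨ p = 0) :
    ∃ U V : Matrix (Fin m) (Fin m) S, IsUnit U ∧ IsUnit V ∧
      U *ᵥ basisVec m S (blockPos m e) = basisVec m S (m - 1) ∧
      basisVec m S (blockPos m e) ᵥ* V = basisVec m S (m - 1) ∧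
      U * (x • leadBlock m e p s A - constBlock m e p s A) * V
        = blockElem m 0 (∑ i ∈ Finset.range (m + 1), x ^ i • A i) := by
  obtain ⟨k, hk⟩ : ∃ k, m = k + 1 := ⟨m - 1, by omega⟩
  have hw : ∀ i ∈ pairTuple e, 0 < i ∧ i < m := fun i hi => by
    have := mem_pairTuple.1 hi
    omega
  -- Pulling the product M over w without 0 out on the left leaves x M⁻¹ M_z − M_0. Here M⁻¹
  -- supplies the indices −1, …, −2e in reverse order and M_z supplies −(2e + 1), …, −m.
  set t := (pairTuple e).reverse ++ (admTuple p s).map (m - ·) with ht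
  have hmem : ∀ i, i ∈ t ↔ 1 ≤ i ∧ i ≤ k + 1 := fun i => by
    simp only [ht, List.mem_append, List.mem_reverse, List.mem_map, mem_pairTuple, mem_admTuple]
    constructor
    · rintro (h | ⟨j, hj, rfl⟩) <;> omega
    · intro h
      by_cases hi : i ≤ 2 * e
      · exact Or.inl (by omega)
      · exact Or.inr ⟨m - i, by omega, by omega⟩
  have hnd : t.Nodup := by
    refine List.nodup_append.2 ⟨List.nodup_reverse.2 (nodup_pairTuple e), ?_, ?_⟩
    · refine (List.nodup_map_iff_inj_on (nodup_admTuple p s)).2 fun a ha b hb hab => ?_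
      have := mem_admTuple.1 ha
      have := mem_admTuple.1 hb
      omega
    · intro a ha b hb
      simp only [List.mem_reverse, mem_pairTuple, List.mem_map, mem_admTuple] at ha hb
      obtain ⟨j, hj, rfl⟩ := hb
      omega
  obtain ⟨U, V, hU, hV, hU', hV', hUV⟩ := exists_equiv_fiedler x k A t hnd hmem
  subst hk
  set N := ((pairTuple e).reverse.map fun i : ℕ => highFactor (k + 1) A (k + 1 - i)).prod with hN
  set Mw := ((pairTuple e).map (lowFactor (k + 1) A)).prod with hMw
  have hNM : N * Mw = 1 := prod_highFactor_mul_prod A _ hw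
  have hMN : Mw * N = 1 := prod_mul_prod_highFactor A _ hw
  obtain ⟨W, hW⟩ := isUnit_prod_compl A hm hA
  have ht' : (t.map fun i : ℕ => blockElem (k + 1) (-(i : ℤ)) (A i)).prod
      = N * ((admTuple p s).map (highFactor (k + 1) A)).prod := by
    rw [ht, List.map_append, List.prod_append, List.map_map, hN]
    congr 2
    refine List.map_congr_left fun i hi => ?_
    have : k + 1 - (k + 1 - i) = i := by
      have := hw i (by simpa using hi)
      omega
    rw [highFactor, this]
  have hK : x • leadBlock (k + 1) e p s A - constBlock (k + 1) e p s A
      = Mw * (x • (t.map fun i : ℕ => blockElem (k + 1) (-(i : ℤ)) (A i)).prod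
        - blockElem (k + 1) 0 (-A 0)) * W := by
    rw [ht', leadBlock, constBlock, mul_assoc, mul_assoc, ← hW, admTuple_zero_eq, List.map_append,
      List.prod_append, ← hMw, mul_sub, sub_mul, mul_smul_comm, ← mul_assoc Mw N, hMN, one_mul,
      smul_mul_assoc]
    simp [lowFactor]
  have hUe : U *ᵥ basisVec (k + 1) S k = basisVec (k + 1) S k := by
    rw [mulVec_basisVec (by omega : k < k + 1)]
    ext a
    exact (hU' a).trans (by simp [basisVec, Fin.ext_iff])
  have hVe : basisVec (k + 1) S k ᵥ* V = basisVec (k + 1) S k := by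
    rw [basisVec_vecMul (by omega : k < k + 1)]
    ext a
    exact (hV' a).trans (by simp [basisVec, Fin.ext_iff])
  refine ⟨U * N, (↑W⁻¹ : Matrix _ _ S) * V, hU.mul ⟨⟨N, Mw, hNM, hMN⟩, rfl⟩, W⁻¹.isUnit.mul hV,
    ?_, ?_, ?_⟩
  -- The basis vector at `blockPos` is M times the last one; `N` undoes M, and `U` fixes the last
  -- one.
  · have := prod_pairTuple_mulVec A (m := k + 1) (e := e) (by omega)
    rw [← this, Matrix.mulVec_mulVec, mul_assoc, ← hMw, hNM, mul_one]
    exact hUe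
  · have := vecMul_prod_compl A hm
    rw [← this, Matrix.vecMul_vecMul, ← hW, ← mul_assoc, Units.mul_inv, one_mul]
    exact hVe
  · have : U * N * (x • leadBlock (k + 1) e p s A - constBlock (k + 1) e p s A)
        * ((↑W⁻¹ : Matrix _ _ S) * V) = U * (N * Mw) * (x • (t.map fun i : ℕ =>
          blockElem (k + 1) (-(i : ℤ)) (A i)).prod - blockElem (k + 1) 0 (-A 0))
          * ((W : Matrix _ _ S) * (↑W⁻¹ : Matrix _ _ S)) * V := by
      rw [hK]
      simp only [mul_assoc]
    rw [this, hNM, Units.mul_inv, mul_one, mul_one, hUV]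

/-! ### The reversed pencil -/

/-- The block reversal. -/
def blockRev (m : ℕ) (S : Type*) [Ring S] : Matrix (Fin m) (Fin m) S :=
  (1 : Matrix (Fin m) (Fin m) S).submatrix Fin.rev id

theorem blockRev_mul_mul (M : Matrix (Fin m) (Fin m) S) :
    blockRev m S * M * blockRev m S = M.submatrix Fin.rev Fin.rev := by
  have h : blockRev m S = (1 : Matrix (Fin m) (Fin m) S).submatrix id Fin.rev := by
    ext a b
    simp [blockRev, Matrix.one_apply, Fin.rev_eq_iff]
  have h₁ : blockRev m S * M = M.submatrix Fin.rev id := by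
    rw [blockRev]
    ext a b
    simp [Matrix.mul_apply, Matrix.one_apply]
  rw [h₁, h]
  ext a b
  simp [Matrix.mul_apply, Matrix.one_apply]

theorem blockRev_mul_self : blockRev m S * blockRev m S = 1 := by
  have := blockRev_mul_mul (1 : Matrix (Fin m) (Fin m) S)
  rw [mul_one] at this
  rw [this]
  ext a b
  simp [Matrix.one_apply]

theorem isUnit_blockRev : IsUnit (blockRev m S) :=
  ⟨⟨_, _, blockRev_mul_self, blockRev_mul_self⟩, rfl⟩

theorem blockRev_conj_list_prod {ι : Type*} (g : ι → Matrix (Fin m) (Fin m) S) (t : List ι) :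
    blockRev m S * (t.map g).prod * blockRev m S
      = (t.map fun i => blockRev m S * g i * blockRev m S).prod := by
  induction t with
  | nil => simp [blockRev_mul_self]
  | cons i t ih =>
    rw [List.map_cons, List.prod_cons, List.map_cons, List.prod_cons, ← ih]
    have : ∀ X Y : Matrix (Fin m) (Fin m) S, blockRev m S * X * blockRev m S *
        (blockRev m S * Y * blockRev m S)
        = blockRev m S * X * (blockRev m S * blockRev m S) * Y * blockRev m S := fun X Y => by
      simp only [mul_assoc]
    rw [this, blockRev_mul_self, mul_one]
    simp only [mul_assoc]

/-- Reversing the blocks exchanges the patterns of indices i and −(m − i), which is how reversed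
pencils become Fiedler pencils. -/
theorem blockRev_conj_lowFactor {i : ℕ} (hi : i < m) :
    blockRev m S * lowFactor m A i * blockRev m S = blockElem m (-((m - i : ℕ) : ℤ)) (-A i) := by
  rw [blockRev_mul_mul]
  ext a b
  rw [Matrix.submatrix_apply, lowFactor]
  rcases Nat.eq_zero_or_pos i with rfl | hi0
  · rw [Nat.cast_zero, Nat.sub_zero, blockElem_zero_apply, blockElem_top_apply hi]
    simp only [Fin.rev_inj, Fin.val_rev]
    split_ifs <;> first | rfl | (exfalso; omega)
  · rw [blockElem_pos_apply hi0, blockElem_neg_apply (by omega) (by omega)]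
    simp only [Fin.rev_inj, Fin.val_rev]
    split_ifs <;> first | rfl | (exfalso; omega)

theorem blockRev_conj_top (hm : 0 < m) (X : S) :
    blockRev m S * blockElem m (-(m : ℤ)) X * blockRev m S = blockElem m 0 X := by
  rw [blockRev_mul_mul]
  ext a b
  rw [Matrix.submatrix_apply, blockElem_zero_apply, blockElem_top_apply hm]
  simp only [Fin.rev_inj, Fin.val_rev]
  split_ifs <;> first | rfl | (exfalso; omega)

theorem blockElem_zero_mul (X Y : S) :
    blockElem m 0 X * blockElem m 0 Y = blockElem m 0 (X * Y) := by
  ext a b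
  rw [Matrix.mul_apply, Finset.sum_eq_single a]
  · simp only [blockElem_zero_apply]
    split_ifs <;> simp
  · intro c _ hc
    rw [blockElem_zero_apply, if_neg hc.symm, zero_mul]
  · simp

theorem blockElem_zero_one : blockElem m 0 (1 : S) = 1 := by
  ext a b
  rw [blockElem_zero_apply, Matrix.one_apply]
  simp

/-- A pencil `M_{-m}(A_m) - y M_v`, where `v` lists `0, …, m-1` in any order, is equivalent to
`diag(I, ∑ y ^ i A_{m-i})`. -/
theorem exists_equiv_reversed_fiedler (y : R) (hm : 0 < m) (v : List ℕ) (hnd : v.Nodup)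
    (hmem : ∀ i, i ∈ v ↔ i < m) :
    ∃ U V : Matrix (Fin m) (Fin m) S, IsUnit U ∧ IsUnit V ∧
      U * (highFactor m A 0 - y • (v.map (lowFactor m A)).prod) * V
        = blockElem m 0 (∑ i ∈ Finset.range (m + 1), y ^ i • A (m - i)) := by
  obtain ⟨k, rfl⟩ : ∃ k, m = k + 1 := ⟨m - 1, by omega⟩
  have hmem' : ∀ i, i ∈ v.map (k + 1 - ·) ↔ 1 ≤ i ∧ i ≤ k + 1 := fun i => by
    simp only [List.mem_map, hmem]
    constructor
    · rintro ⟨j, hj, rfl⟩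
      omega
    · intro h
      exact ⟨k + 1 - i, by omega, by omega⟩
  have hnd' : (v.map (k + 1 - ·)).Nodup :=
    (List.nodup_map_iff_inj_on hnd).2 fun a ha b hb hab => by
      have := (hmem a).1 ha
      have := (hmem b).1 hb
      omega
  obtain ⟨U, V, hU, hV, -, -, hUV⟩ :=
    exists_equiv_fiedler y k (fun i => -A (k + 1 - i)) _ hnd' hmem'
  set K := highFactor (k + 1) A 0 - y • (v.map (lowFactor (k + 1) A)).prod with hK
  -- Up to a global sign, the reversed blocks form the Fiedler pencil of the coefficients −A_{m−i};
  -- the minus signs match M_i(−A_i).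
  have hrev : blockRev (k + 1) S * K * blockRev (k + 1) S
      = -(y • ((v.map (k + 1 - ·)).map fun i : ℕ =>
          blockElem (k + 1) (-(i : ℤ)) (-A (k + 1 - i))).prod
          - blockElem (k + 1) 0 (- -A (k + 1 - 0))) := by
    rw [hK, mul_sub, sub_mul, mul_smul_comm, smul_mul_assoc, blockRev_conj_list_prod, neg_sub,
      neg_neg, highFactor, Nat.sub_zero, blockRev_conj_top hm, List.map_map]
    congr 3
    refine List.map_congr_left fun i hi => ?_
    have hi := (hmem i).1 hi
    have : k + 1 - (k + 1 - i) = i := by omega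
    rw [blockRev_conj_lowFactor A hi, Function.comp_apply, this]
  have hneg : ∀ X : S, -blockElem (k + 1) 0 (-1) * -blockElem (k + 1) 0 X
      = blockElem (k + 1) 0 (-X) := fun X => by
    rw [neg_mul_neg, blockElem_zero_mul, neg_one_mul]
  have hD : IsUnit (-blockElem (k + 1) 0 (-1 : S)) := by
    have := hneg (-1)
    rw [neg_neg, blockElem_zero_one] at this
    exact ⟨⟨_, _, this, this⟩, rfl⟩
  -- The left factor diag(−I, …, −I, I) corrects the global sign on all blocks but the last, where
  -- the signs of the coefficients already compensate for it.
  refine ⟨-blockElem (k + 1) 0 (-1) * U * blockRev (k + 1) S, blockRev (k + 1) S * V,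
    (hD.mul hU).mul isUnit_blockRev, isUnit_blockRev.mul hV, ?_⟩
  have : -blockElem (k + 1) 0 (-1) * U * blockRev (k + 1) S * K * (blockRev (k + 1) S * V)
      = -blockElem (k + 1) 0 (-1) * (U * (blockRev (k + 1) S * K * blockRev (k + 1) S) * V) := by
    simp only [mul_assoc]
  rw [this, hrev, mul_neg U, neg_mul (U * _), hUV, hneg]
  congr 1
  simp

/-- The reversed pencil `M_z M_{c_w} M_{c_z} - y M_w M_{c_w} M_{c_z}` is equivalent to
`diag(I, ∑ y ^ i A_{m-i})`. -/
theorem exists_equiv_reversed_blockPencil (y : R) {e p s : ℕ} (hm : m = 2 * e + 1 + (p + 2 * s))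
    (hA : IsUnit (A m) ∨ p = 0) :
    ∃ U V : Matrix (Fin m) (Fin m) S, IsUnit U ∧ IsUnit V ∧
      U * (leadBlock m e p s A - y • constBlock m e p s A) * V
        = blockElem m 0 (∑ i ∈ Finset.range (m + 1), y ^ i • A (m - i)) := by
  -- The offset 0 stands for M_{-m}, the only factor of M_z that may be singular. The factors on
  -- either side of it have low factors as inverses.
  obtain ⟨z₁, z₂, hz⟩ := List.append_of_mem (mem_admTuple.2 (Nat.zero_le (p + 2 * s)))
  have hzm : ∀ i, i ∈ z₁ ++ 0 :: z₂ ↔ i ≤ p + 2 * s := fun i => by rw [← hz, mem_admTuple]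
  have hzn : (z₁ ++ 0 :: z₂).Nodup := hz ▸ nodup_admTuple p s
  have hzn' := List.nodup_middle.1 hzn
  have h0 : 0 ∉ z₁ ++ z₂ := (List.nodup_cons.1 hzn').1
  have hz12 : ∀ i, i ∈ z₁ ++ z₂ ↔ 0 < i ∧ i ≤ p + 2 * s := fun i => by
    rcases Nat.eq_zero_or_pos i with rfl | hi
    · simpa using h0
    · rw [← hzm]
      simp [hi, hi.ne']
  have hinv : ∀ l : List ℕ, (∀ i ∈ l, i ∈ z₁ ++ z₂) →
      ((l.reverse.map (m - ·)).map (lowFactor m A)).prod * (l.map (highFactor m A)).prod = 1 ∧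
      (l.map (highFactor m A)).prod * ((l.reverse.map (m - ·)).map (lowFactor m A)).prod = 1 := by
    intro l hl
    have hl' : ∀ i ∈ l.reverse.map (m - ·), 0 < i ∧ i < m := by
      intro i hi
      obtain ⟨j, hj, rfl⟩ := List.mem_map.1 hi
      have := (hz12 j).1 (hl j (by simpa using hj))
      omega
    have h₁ := prod_highFactor_mul_prod A _ hl'
    have h₂ := prod_mul_prod_highFactor A _ hl'
    have h₃ : ((l.reverse.map (m - ·)).reverse.map fun i : ℕ => highFactor m A (m - i))
        = l.map (highFactor m A) := by
      rw [← List.map_reverse, List.reverse_reverse, List.map_map]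
      refine List.map_congr_left fun i hi => ?_
      have : m - (m - i) = i := by
        have := (hz12 i).1 (hl i hi)
        omega
      rw [Function.comp_apply, this]
    rw [h₃] at h₁ h₂
    exact ⟨h₂, h₁⟩
  obtain ⟨h₁, h₁'⟩ := hinv z₁ fun i hi => by simp [hi]
  obtain ⟨h₂, h₂'⟩ := hinv z₂ fun i hi => by simp [hi]
  -- Cancelling the two outer parts of M_z isolates M_{-m} and surrounds M_w by their inverses. The
  -- entries of w are 0, …, 2e, those of the inverses 2e + 1, …, m − 1.
  set v := z₁.reverse.map (m - ·) ++ (admTuple 0 e ++ z₂.reverse.map (m - ·)) with hv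
  have hvperm : v.Perm ((z₁ ++ z₂).map (m - ·) ++ admTuple 0 e) := by
    rw [List.perm_iff_count]
    intro a
    simp only [hv, List.map_append, List.count_append, List.map_reverse, List.count_reverse]
    omega
  have hvm : ∀ i, i ∈ v ↔ i < m := fun i => by
    rw [hvperm.mem_iff, List.mem_append, List.mem_map, mem_admTuple]
    constructor
    · rintro (⟨j, hj, rfl⟩ | h)
      · have := (hz12 j).1 hj
        omega
      · omega
    · intro h
      by_cases hi : i ≤ 2 * e
      · exact Or.inr (by omega)
      · exact Or.inl ⟨m - i, (hz12 _).2 (by omega), by omega⟩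
  have hvn : v.Nodup := by
    refine hvperm.nodup_iff.2 (List.nodup_append.2 ⟨?_, nodup_admTuple 0 e, ?_⟩)
    · refine (List.nodup_map_iff_inj_on (List.nodup_cons.1 hzn').2).2 fun a ha b hb hab => ?_
      have := (hz12 a).1 ha
      have := (hz12 b).1 hb
      omega
    · intro a ha b hb
      obtain ⟨j, hj, rfl⟩ := List.mem_map.1 ha
      have := (hz12 j).1 hj
      have := mem_admTuple.1 hb
      omega
  obtain ⟨U, V, hU, hV, hUV⟩ := exists_equiv_reversed_fiedler A y (by omega) v hvn hvm
  obtain ⟨W, hW⟩ := isUnit_prod_compl A hm hA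
  have hvprod : (v.map (lowFactor m A)).prod
      = ((z₁.reverse.map (m - ·)).map (lowFactor m A)).prod *
        (((admTuple 0 e).map (lowFactor m A)).prod *
          ((z₂.reverse.map (m - ·)).map (lowFactor m A)).prod) := by
    rw [hv, List.map_append, List.map_append, List.prod_append, List.prod_append]
  have hzprod : ((admTuple p s).map (highFactor m A)).prod
      = (z₁.map (highFactor m A)).prod * (highFactor m A 0 * (z₂.map (highFactor m A)).prod) := by
    rw [hz, List.map_append, List.prod_append, List.map_cons, List.prod_cons]
  rw [hvprod] at hUV
  rw [leadBlock, constBlock, mul_assoc, mul_assoc, ← hW, hzprod]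
  generalize ((z₁.reverse.map (m - ·)).map (lowFactor m A)).prod = Z₁' at *
  generalize ((z₂.reverse.map (m - ·)).map (lowFactor m A)).prod = Z₂' at *
  generalize (z₁.map (highFactor m A)).prod = Z₁ at *
  generalize (z₂.map (highFactor m A)).prod = Z₂ at *
  generalize ((admTuple 0 e).map (lowFactor m A)).prod = Mw at *
  generalize highFactor m A 0 = T at *
  refine ⟨U * Z₁', (↑W⁻¹ : Matrix (Fin m) (Fin m) S) * Z₂' * V, hU.mul ⟨⟨Z₁', Z₁, h₁, h₁'⟩, rfl⟩,
    (W⁻¹.isUnit.mul ⟨⟨Z₂', Z₂, h₂, h₂'⟩, rfl⟩).mul hV, ?_⟩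
  have : U * Z₁' * (Z₁ * (T * Z₂) * W - y • (Mw * W)) * ((↑W⁻¹ : Matrix (Fin m) (Fin m) S) * Z₂' * V)
      = U * ((Z₁' * Z₁) * T * (Z₂ * ((W : Matrix (Fin m) (Fin m) S) * (↑W⁻¹ : Matrix (Fin m) (Fin m) S)) * Z₂')
        - y • (Z₁' * (Mw * (((W : Matrix (Fin m) (Fin m) S) * (↑W⁻¹ : Matrix (Fin m) (Fin m) S)) * Z₂')))) * V := by
    simp only [mul_sub, sub_mul, mul_smul_comm, smul_mul_assoc, mul_assoc]
  rw [this, Units.mul_inv, mul_one, one_mul, h₁, h₂', one_mul, mul_one, hUV]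

end BlockPencil

/-! ### Proper rational functions -/

/-- A denominator has finitely many roots. Near infinity evaluation therefore avoids poles, and so
respects sums and products. -/
theorem eventually_eval_denom_ne_zero (f : RatFunc ℂ) :
    ∀ᶠ z : ℂ in Bornology.cobounded ℂ, f.denom.eval₂ (RingHom.id ℂ) z ≠ 0 := by
  have h : (f.denom.rootSet ℂ)ᶜ ∈ Filter.cofinite (α := ℂ) :=
    (Polynomial.rootSet_finite f.denom ℂ).compl_mem_cofinite
  filter_upwards [Bornology.le_cofinite ℂ h] with z hz h0
  refine hz ((Polynomial.mem_rootSet_of_ne f.denom_ne_zero).2 ?_)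
  rw [Polynomial.aeval_def]
  exact h0

theorem eventually_eval_add (f g : RatFunc ℂ) : ∀ᶠ z : ℂ in Bornology.cobounded ℂ,
    (f + g).eval (RingHom.id ℂ) z = f.eval (RingHom.id ℂ) z + g.eval (RingHom.id ℂ) z := by
  filter_upwards [eventually_eval_denom_ne_zero f, eventually_eval_denom_ne_zero g] with z hf hg
  exact RatFunc.eval_add _ _ hf hg

theorem eventually_eval_mul (f g : RatFunc ℂ) : ∀ᶠ z : ℂ in Bornology.cobounded ℂ,
    (f * g).eval (RingHom.id ℂ) z = f.eval (RingHom.id ℂ) z * g.eval (RingHom.id ℂ) z := by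
  filter_upwards [eventually_eval_denom_ne_zero f, eventually_eval_denom_ne_zero g] with z hf hg
  exact RatFunc.eval_mul _ _ hf hg

/-- `f(z) → d` as `z → ∞`. -/
def HasLimitAtInfty (f : RatFunc ℂ) (d : ℂ) : Prop :=
  Tendsto (fun z : ℂ => f.eval (RingHom.id ℂ) z) (Bornology.cobounded ℂ) (𝓝 d)

theorem HasLimitAtInfty.add {f g : RatFunc ℂ} {c d : ℂ} (hf : HasLimitAtInfty f c)
    (hg : HasLimitAtInfty g d) : HasLimitAtInfty (f + g) (c + d) :=
  (Tendsto.add hf hg).congr' ((eventually_eval_add f g).mono fun _ h => h.symm)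

theorem HasLimitAtInfty.mul {f g : RatFunc ℂ} {c d : ℂ} (hf : HasLimitAtInfty f c)
    (hg : HasLimitAtInfty g d) : HasLimitAtInfty (f * g) (c * d) :=
  (Tendsto.mul hf hg).congr' ((eventually_eval_mul f g).mono fun _ h => h.symm)

theorem hasLimitAtInfty_C (c : ℂ) : HasLimitAtInfty (RatFunc.C c) c := by
  have : (fun z : ℂ => (RatFunc.C c).eval (RingHom.id ℂ) z) = fun _ => c := by
    ext z
    simp
  rw [HasLimitAtInfty, this]
  exact tendsto_const_nhds

theorem HasLimitAtInfty.inv {f : RatFunc ℂ} {c : ℂ} (hf : HasLimitAtInfty f c) (hc : c ≠ 0) :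
    HasLimitAtInfty f⁻¹ c⁻¹ := by
  have hf0 : f ≠ 0 := by
    rintro rfl
    refine hc (tendsto_nhds_unique hf ?_)
    simp
  refine (Tendsto.inv₀ hf hc).congr' ?_
  filter_upwards [eventually_eval_mul f f⁻¹] with z hz
  rw [mul_inv_cancel₀ hf0, RatFunc.eval_one] at hz
  exact inv_eq_of_mul_eq_one_right hz.symm

theorem hasLimitAtInfty_X_inv : HasLimitAtInfty (RatFunc.X : RatFunc ℂ)⁻¹ 0 := by
  refine (Filter.tendsto_inv₀_cobounded (α := ℂ)).congr' ?_
  filter_upwards [eventually_eval_mul (RatFunc.X : RatFunc ℂ) RatFunc.X⁻¹] with z hz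
  rw [mul_inv_cancel₀ RatFunc.X_ne_zero, RatFunc.eval_one, RatFunc.eval_X] at hz
  exact (eq_inv_of_mul_eq_one_right hz.symm).symm

/-- The ring of proper rational functions. -/
def properRing : Subring (RatFunc ℂ) where
  carrier := {f | ∃ d, HasLimitAtInfty f d}
  mul_mem' := fun ⟨_, hf⟩ ⟨_, hg⟩ => ⟨_, hf.mul hg⟩
  one_mem' := ⟨1, by simpa using hasLimitAtInfty_C 1⟩
  add_mem' := fun ⟨_, hf⟩ ⟨_, hg⟩ => ⟨_, hf.add hg⟩
  zero_mem' := ⟨0, by simpa using hasLimitAtInfty_C 0⟩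
  neg_mem' := fun {f} ⟨_, hf⟩ => ⟨_, by simpa using (hasLimitAtInfty_C (-1)).mul hf⟩

/-- The value at infinity of a proper rational function. -/
def valueAtInfty : properRing →+* ℂ where
  toFun f := f.2.choose
  map_one' := tendsto_nhds_unique (1 : properRing).2.choose_spec
    (by simpa using hasLimitAtInfty_C 1 : HasLimitAtInfty 1 1)
  map_mul' f g := tendsto_nhds_unique (f * g).2.choose_spec
    (f.2.choose_spec.mul g.2.choose_spec)
  map_zero' := tendsto_nhds_unique (0 : properRing).2.choose_spec
    (by simpa using hasLimitAtInfty_C 0 : HasLimitAtInfty 0 0)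
  map_add' f g := tendsto_nhds_unique (f + g).2.choose_spec
    (f.2.choose_spec.add g.2.choose_spec)

theorem hasLimitAtInfty_valueAtInfty (f : properRing) : HasLimitAtInfty f (valueAtInfty f) :=
  f.2.choose_spec

theorem valueAtInfty_eq {f : properRing} {d : ℂ} (h : HasLimitAtInfty f d) : valueAtInfty f = d :=
  tendsto_nhds_unique (hasLimitAtInfty_valueAtInfty f) h

theorem isUnit_of_valueAtInfty_ne_zero {f : properRing} (h : valueAtInfty f ≠ 0) : IsUnit f := by
  have hf := hasLimitAtInfty_valueAtInfty f
  have hf0 : (f : RatFunc ℂ) ≠ 0 := by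
    intro h0
    refine h ?_
    have : f = 0 := Subtype.ext h0
    rw [this, map_zero]
  refine IsUnit.of_mul_eq_one ⟨(f : RatFunc ℂ)⁻¹, _, hf.inv h⟩ (Subtype.ext ?_)
  exact mul_inv_cancel₀ hf0

/-- The value at infinity is a ring homomorphism and carries a unit determinant to a nonzero number.
Biproper transformations can thus be obtained from equivalence over `properRing`. -/
theorem isBiproper_of_isUnit {ι : Type} [Fintype ι] [DecidableEq ι] {M : Matrix ι ι properRing}
    (h : IsUnit M) : IsBiproper (M.map properRing.subtype) := by
  refine ⟨M.map valueAtInfty, ?_, fun i j => hasLimitAtInfty_valueAtInfty (M i j)⟩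
  have := ((Matrix.isUnit_iff_isUnit_det _).1 h).map valueAtInfty
  rwa [RingHom.map_det] at this

/-- Constants, as proper rational functions. -/
def properConst : ℂ →+* properRing :=
  (RatFunc.C : ℂ →+* RatFunc ℂ).codRestrict properRing fun c => ⟨c, hasLimitAtInfty_C c⟩

/-- `λ⁻¹`, as a proper rational function. -/
def properInv : properRing := ⟨RatFunc.X⁻¹, 0, hasLimitAtInfty_X_inv⟩

theorem toRat_toPoly {ι κ : Type} (M : Matrix ι κ ℂ) :
    toRat (toPoly M) = (M.map properConst).map properRing.subtype := by
  ext i j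
  simp only [toRat, toPoly, Matrix.map_apply, RatFunc.algebraMap_C]
  rfl

/-- `λ (λ I - A)⁻¹` is proper. -/
theorem exists_proper_resolvent {σ : Type} [Fintype σ] [DecidableEq σ] (A : Matrix σ σ ℂ) :
    ∃ N : Matrix σ σ properRing,
      (toRat ((Polynomial.X : ℂ[X]) • toPoly 1 - toPoly A))⁻¹ = N.map properRing.subtype := by
  -- λI − A = λ(I − λ⁻¹A), and the second factor equals I at infinity, hence is invertible over the
  -- proper functions.
  set M : Matrix σ σ properRing := 1 - properInv • A.map properConst with hM
  have hdet : IsUnit M.det := by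
    refine isUnit_of_valueAtInfty_ne_zero ?_
    have hv : valueAtInfty properInv = 0 := valueAtInfty_eq hasLimitAtInfty_X_inv
    have : valueAtInfty.mapMatrix M = 1 := by
      ext i j
      simp only [hM, RingHom.mapMatrix_apply, Matrix.map_apply, Matrix.sub_apply,
        Matrix.smul_apply, smul_eq_mul, map_sub, map_mul, hv, zero_mul, sub_zero]
      rw [Matrix.one_apply, Matrix.one_apply, apply_ite valueAtInfty, map_one, map_zero]
    rw [RingHom.map_det, this, Matrix.det_one]
    exact one_ne_zero
  refine ⟨properInv • M⁻¹, Matrix.inv_eq_right_inv ?_⟩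
  have h₁ : toRat ((Polynomial.X : ℂ[X]) • toPoly 1 - toPoly A)
      = (RatFunc.X : RatFunc ℂ) • M.map properRing.subtype := by
    ext i j
    have hX : (RatFunc.X : RatFunc ℂ) * RatFunc.X⁻¹ = 1 := mul_inv_cancel₀ RatFunc.X_ne_zero
    simp only [hM, toRat, toPoly, Matrix.map_apply, Matrix.sub_apply, Matrix.smul_apply,
      smul_eq_mul, map_sub, map_mul, RatFunc.algebraMap_X, RatFunc.algebraMap_C, mul_sub]
    congr 1
    · rcases eq_or_ne i j with rfl | hij
      · simp [Matrix.one_apply_eq]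
      · simp [Matrix.one_apply_ne hij]
    · simp only [properInv, properConst, Subring.subtype_apply]
      rw [← mul_assoc, hX, one_mul]
      rfl
  have h₂ : (properInv • M⁻¹).map properRing.subtype
      = (RatFunc.X : RatFunc ℂ)⁻¹ • M⁻¹.map properRing.subtype := by
    ext i j
    simp [properInv]
  rw [h₁, h₂, Matrix.smul_mul, Matrix.mul_smul, smul_smul, mul_inv_cancel₀ RatFunc.X_ne_zero,
    one_smul, ← Matrix.map_mul, Matrix.mul_nonsing_inv _ hdet]
  simp

theorem exists_proper_transfer {ι κ σ : Type} [Fintype σ] [DecidableEq σ] (C : Matrix ι σ ℂ)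
    (A : Matrix σ σ ℂ) (B : Matrix σ κ ℂ) : ∃ N : Matrix ι κ properRing,
      toRat (toPoly C) * (toRat ((Polynomial.X : ℂ[X]) • toPoly 1 - toPoly A))⁻¹
        * toRat (toPoly B) = N.map properRing.subtype := by
  obtain ⟨N, hN⟩ := exists_proper_resolvent A
  refine ⟨C.map properConst * N * B.map properConst, ?_⟩
  rw [hN, toRat_toPoly, toRat_toPoly, Matrix.map_mul, Matrix.map_mul]

/-! ### From block form to matrices over the base ring -/

section Comp

variable {R : Type} [CommRing R] {m n : ℕ}

theorem comp_mul (M N : Matrix (Fin m) (Fin m) (Matrix (Fin n) (Fin n) R)) :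
    Matrix.comp _ _ _ _ R (M * N) = Matrix.comp _ _ _ _ R M * Matrix.comp _ _ _ _ R N :=
  map_mul (Matrix.compRingEquiv (Fin m) (Fin n) R) M N

theorem isUnit_comp {M : Matrix (Fin m) (Fin m) (Matrix (Fin n) (Fin n) R)} (h : IsUnit M) :
    IsUnit (Matrix.comp _ _ _ _ R M) := h.map (Matrix.compRingEquiv (Fin m) (Fin n) R)

theorem comp_list_prod {ι : Type} (g : ι → Matrix (Fin m) (Fin m) (Matrix (Fin n) (Fin n) R))
    (t : List ι) : Matrix.comp _ _ _ _ R (t.map g).prod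
      = (t.map fun i => Matrix.comp _ _ _ _ R (g i)).prod := by
  have := map_list_prod (Matrix.compRingEquiv (Fin m) (Fin n) R) (t.map g)
  rw [List.map_map] at this
  exact this

theorem idDiag_eq_comp (X : Matrix (Fin n) (Fin n) R) :
    idDiag m X = Matrix.comp _ _ _ _ R (blockElem m 0 X) := by
  unfold idDiag blockElem
  rw [if_pos rfl]

theorem comp_mul_colBlock {σ : Type} {U : Matrix (Fin m) (Fin m) (Matrix (Fin n) (Fin n) R)}
    {a b : ℕ} (ha : a < m) (hU : U *ᵥ basisVec m _ a = basisVec m _ b) (X : Matrix (Fin n) σ R) :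
    Matrix.comp _ _ _ _ R U * colBlock m (a + 1) X = colBlock m (b + 1) X := by
  rw [mulVec_basisVec ha] at hU
  ext ⟨i, α⟩ j
  have hi := congrFun hU i
  simp only [Matrix.mul_apply, Fintype.sum_prod_type, colBlock, Matrix.of_apply, Matrix.comp_apply,
    Nat.add_right_cancel_iff]
  rw [Finset.sum_eq_single ⟨a, ha⟩]
  · simp only [if_true, hi, basisVec]
    split_ifs <;> simp [Matrix.one_apply]
  · intro c _ hc
    refine Finset.sum_eq_zero fun x _ => ?_
    rw [if_neg (fun h => hc (Fin.ext h)), mul_zero]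
  · simp

theorem rowBlock_mul_comp {σ : Type} {V : Matrix (Fin m) (Fin m) (Matrix (Fin n) (Fin n) R)}
    {a b : ℕ} (ha : a < m) (hV : basisVec m _ a ᵥ* V = basisVec m _ b) (X : Matrix σ (Fin n) R) :
    rowBlock m (a + 1) X * Matrix.comp _ _ _ _ R V = rowBlock m (b + 1) X := by
  rw [basisVec_vecMul ha] at hV
  ext j ⟨i, α⟩
  have hi := congrFun hV i
  simp only [Matrix.mul_apply, Fintype.sum_prod_type, rowBlock, Matrix.of_apply, Matrix.comp_apply,
    Nat.add_right_cancel_iff]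
  rw [Finset.sum_eq_single ⟨a, ha⟩]
  · simp only [if_true, hi, basisVec]
    split_ifs <;> simp [Matrix.one_apply]
  · intro c _ hc
    refine Finset.sum_eq_zero fun x _ => ?_
    rw [if_neg (fun h => hc (Fin.ext h)), zero_mul]
  · simp

end Comp

theorem fiedlerMat_natCast (m : ℕ) {n : ℕ} (P : Matrix (Fin n) (Fin n) ℂ[X]) (i : ℕ) :
    fiedlerMat m P (i : ℤ) = Matrix.comp _ _ _ _ ℂ (lowFactor m (coeffMat P) i) := by
  rw [fiedlerMat, if_pos (by omega), elemMat_eq_comp, lowFactor, Int.natAbs_natCast]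

theorem fiedlerMat_sub (m : ℕ) {n : ℕ} (P : Matrix (Fin n) (Fin n) ℂ[X]) {j : ℕ} (hj : j < m) :
    fiedlerMat m P ((j : ℤ) - (m : ℤ)) = Matrix.comp _ _ _ _ ℂ (highFactor m (coeffMat P) j) := by
  have h : (j : ℤ) - (m : ℤ) = -((m - j : ℕ) : ℤ) := by omega
  rw [fiedlerMat, if_neg (by omega), elemMat_eq_comp, highFactor, h, Int.natAbs_neg,
    Int.natAbs_natCast]

theorem fiedlerProd_natCast (m : ℕ) {n : ℕ} (P : Matrix (Fin n) (Fin n) ℂ[X]) (t : List ℕ) :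
    fiedlerProd m P (t.map fun i : ℕ => (i : ℤ))
      = Matrix.comp _ _ _ _ ℂ (t.map (lowFactor m (coeffMat P))).prod := by
  rw [fiedlerProd, comp_list_prod, List.map_map]
  exact congrArg List.prod (List.map_congr_left fun i _ => fiedlerMat_natCast m P i)

theorem fiedlerProd_sub (m : ℕ) {n : ℕ} (P : Matrix (Fin n) (Fin n) ℂ[X]) (t : List ℕ)
    (ht : ∀ j ∈ t, j < m) :
    fiedlerProd m P ((t.map fun i : ℕ => (i : ℤ)).map fun i => i - (m : ℤ))
      = Matrix.comp _ _ _ _ ℂ (t.map (highFactor m (coeffMat P))).prod := by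
  rw [fiedlerProd, comp_list_prod, List.map_map, List.map_map]
  exact congrArg List.prod (List.map_congr_left fun i hi => fiedlerMat_sub m P (ht i hi))

theorem toPoly_mul {ι κ τ : Type} [Fintype κ] (M : Matrix ι κ ℂ) (N : Matrix κ τ ℂ) :
    toPoly (M * N) = toPoly M * toPoly N := Matrix.map_mul

theorem toRat_mul {ι κ τ : Type} [Fintype κ] (M : Matrix ι κ ℂ[X]) (N : Matrix κ τ ℂ[X]) :
    toRat (M * N) = toRat M * toRat N := Matrix.map_mul

theorem toPoly_one {ι : Type} [DecidableEq ι] : toPoly (1 : Matrix ι ι ℂ) = 1 := by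
  simp [toPoly]

theorem toRat_add {ι κ : Type} (M N : Matrix ι κ ℂ[X]) : toRat (M + N) = toRat M + toRat N := by
  ext; simp [toRat]

theorem toRat_sub {ι κ : Type} (M N : Matrix ι κ ℂ[X]) : toRat (M - N) = toRat M - toRat N := by
  ext; simp [toRat]

theorem toRat_X_smul {ι κ : Type} (M : Matrix ι κ ℂ[X]) :
    toRat ((Polynomial.X : ℂ[X]) • M) = (RatFunc.X : RatFunc ℂ) • toRat M := by
  ext; simp [toRat, RatFunc.algebraMap_X]

theorem pencilL_eq {m e p s n : ℕ} (hm : m = 2 * e + 1 + (p + 2 * s))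
    (P : Matrix (Fin n) (Fin n) ℂ[X]) :
    pencilL m (2 * e) p P
      = (Polynomial.X : ℂ[X]) • toPoly (Matrix.comp _ _ _ _ ℂ (leadBlock m e p s (coeffMat P)))
        - toPoly (Matrix.comp _ _ _ _ ℂ (constBlock m e p s (coeffMat P))) := by
  have h₁ : m - 2 * e - 1 = p + 2 * s := by omega
  have h₂ : 2 * e % 2 = 0 := by omega
  have h₃ := admissibleTuple_eq 0 e
  have h₄ := symmComplement_eq 0 e
  rw [Nat.zero_add] at h₃ h₄
  rw [pencilL, tupleZ, tupleW, tupleCW, tupleCZ, h₁, h₂, h₃, h₄, admissibleTuple_eq,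
    symmComplement_eq, fiedlerProd_natCast, fiedlerProd_natCast, fiedlerProd_sub, fiedlerProd_sub,
    sub_mul, sub_mul, Matrix.smul_mul, Matrix.smul_mul, leadBlock, constBlock]
  · simp only [comp_mul, toPoly_mul]
  · intro j hj
    have := lt_of_mem_admCompl hj
    omega
  · intro j hj
    have := mem_admTuple.1 hj
    omega

/-- The coefficients of `P(λ)`, as constant matrix polynomials. -/
theorem sum_coeffMat {n m : ℕ} (P : Matrix (Fin n) (Fin n) ℂ[X])
    (hP : ∀ k, m < k → coeffMat P k = 0) :
    ∑ i ∈ Finset.range (m + 1), (Polynomial.X : ℂ[X]) ^ i • toPoly (coeffMat P i) = P := by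
  refine Matrix.ext fun i j => ?_
  have hdeg : (P i j).natDegree < m + 1 := by
    rw [Nat.lt_succ_iff, Polynomial.natDegree_le_iff_coeff_eq_zero]
    intro N hN
    exact congrFun (congrFun (hP N hN) i) j
  conv_rhs => rw [(P i j).as_sum_range' (m + 1) hdeg]
  rw [Matrix.sum_apply]
  refine Finset.sum_congr rfl fun k _ => ?_
  rw [Matrix.smul_apply, smul_eq_mul, toPoly, Matrix.map_apply, coeffMat, Matrix.map_apply,
    ← Polynomial.C_mul_X_pow_eq_monomial, mul_comm]

theorem toPoly_comp {m n : ℕ} (M : Matrix (Fin m) (Fin m) (Matrix (Fin n) (Fin n) ℂ)) :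
    toPoly (Matrix.comp _ _ _ _ ℂ M)
      = Matrix.comp _ _ _ _ ℂ[X] (M.map (Polynomial.C : ℂ →+* ℂ[X]).mapMatrix) := rfl

theorem blockPos_lt {m e : ℕ} (hm : 2 * e < m) : blockPos m e < m := by
  unfold blockPos
  split_ifs <;> omega

/-- `L(λ)` is unimodularly equivalent to `diag(I, P(λ))`. -/
theorem exists_equiv_pencilL {m e p s n : ℕ} (hm : m = 2 * e + 1 + (p + 2 * s))
    (P : Matrix (Fin n) (Fin n) ℂ[X]) (hP : ∀ k, m < k → coeffMat P k = 0)
    (hA : IsUnit (coeffMat P m) ∨ p = 0) :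
    ∃ U V : Matrix (Fin m × Fin n) (Fin m × Fin n) ℂ[X], IsUnit U ∧ IsUnit V ∧
      (∀ {σ : Type} (X : Matrix (Fin n) σ ℂ[X]),
        U * colBlock m (blockPos m e + 1) X = colBlock m m X) ∧
      (∀ {σ : Type} (X : Matrix σ (Fin n) ℂ[X]),
        rowBlock m (blockPos m e + 1) X * V = rowBlock m m X) ∧
      U * pencilL m (2 * e) p P * V = idDiag m P := by
  have hA' : IsUnit (toPoly (coeffMat P m)) ∨ p = 0 :=
    hA.imp_left fun h => h.map (Polynomial.C : ℂ →+* ℂ[X]).mapMatrix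
  obtain ⟨U, V, hU, hV, hU', hV', hUV⟩ := exists_equiv_blockPencil
    (fun i => toPoly (coeffMat P i)) (Polynomial.X : ℂ[X]) hm hA'
  have hm1 : m - 1 + 1 = m := by omega
  have hpos : blockPos m e < m := blockPos_lt (by omega)
  refine ⟨Matrix.comp _ _ _ _ _ U, Matrix.comp _ _ _ _ _ V, isUnit_comp hU, isUnit_comp hV,
    fun X => ?_, fun X => ?_, ?_⟩
  · have := comp_mul_colBlock hpos hU' X
    rwa [hm1] at this
  · have := rowBlock_mul_comp hpos hV' X
    rwa [hm1] at this
  · rw [pencilL_eq hm, toPoly_comp, toPoly_comp, leadBlock_map, constBlock_map]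
    have := congrArg (Matrix.comp _ _ _ _ ℂ[X]) hUV
    rw [comp_mul, comp_mul, sum_coeffMat P hP, ← idDiag_eq_comp] at this
    exact this

theorem isUnimodular_of_isUnit {ι : Type} [Fintype ι] [DecidableEq ι] {U : Matrix ι ι ℂ[X]}
    (h : IsUnit U) : IsUnimodular U := by
  obtain ⟨c, hc, hcU⟩ := Polynomial.isUnit_iff.1 ((Matrix.isUnit_iff_isUnit_det _).1 h)
  exact ⟨c, hc.ne_zero, hcU.symm⟩

/-! ### Minimality and transformations of realizations -/

section Realizations

variable {ι κ σ : Type} [Fintype σ] [DecidableEq σ]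

/-- Division with constant remainder by a pencil whose leading coefficient is invertible; by
linearity it suffices to treat powers of λ times constants. -/
theorem exists_eq_mul_pencil_add [Fintype ι] [DecidableEq ι] {E A : Matrix σ σ ℂ}
    (hE : IsUnit E.det) (M : Matrix ι σ ℂ[X]) : ∃ (Q : Matrix ι σ ℂ[X]) (C₀ : Matrix ι σ ℂ),
      M = Q * ((Polynomial.X : ℂ[X]) • toPoly E - toPoly A) + toPoly C₀ := by
  set N := (Polynomial.X : ℂ[X]) • toPoly E - toPoly A with hN
  have hconst : ∀ C₀ : Matrix ι σ ℂ, ∃ (Q : Matrix ι σ ℂ[X]) (C₁ : Matrix ι σ ℂ),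
      (Polynomial.X : ℂ[X]) • toPoly C₀ = Q * N + toPoly C₁ := fun C₀ => by
    -- λ C₀ = C₀ E⁻¹ (λE − A) + C₀ E⁻¹ A.
    refine ⟨toPoly (C₀ * E⁻¹), C₀ * E⁻¹ * A, ?_⟩
    rw [hN, Matrix.mul_sub, Matrix.mul_smul, ← toPoly_mul, ← toPoly_mul,
      Matrix.nonsing_inv_mul_cancel_right _ _ hE, sub_add_cancel]
  have hadd : ∀ M₁ M₂ : Matrix ι σ ℂ[X],
      (∃ (Q : Matrix ι σ ℂ[X]) (C₀ : Matrix ι σ ℂ), M₁ = Q * N + toPoly C₀) →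
      (∃ (Q : Matrix ι σ ℂ[X]) (C₀ : Matrix ι σ ℂ), M₂ = Q * N + toPoly C₀) →
      ∃ (Q : Matrix ι σ ℂ[X]) (C₀ : Matrix ι σ ℂ), M₁ + M₂ = Q * N + toPoly C₀ := by
    rintro _ _ ⟨Q₁, C₁, rfl⟩ ⟨Q₂, C₂, rfl⟩
    refine ⟨Q₁ + Q₂, C₁ + C₂, ?_⟩
    have : toPoly (C₁ + C₂) = toPoly C₁ + toPoly C₂ := by
      ext; simp [toPoly]
    rw [this, Matrix.add_mul]
    abel
  have hpow : ∀ (k : ℕ) (C₀ : Matrix ι σ ℂ), ∃ (Q : Matrix ι σ ℂ[X]) (C₁ : Matrix ι σ ℂ),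
      (Polynomial.X : ℂ[X]) ^ k • toPoly C₀ = Q * N + toPoly C₁ := by
    intro k
    induction k with
    | zero => exact fun C₀ => ⟨0, C₀, by simp⟩
    | succ k ih =>
      intro C₀
      obtain ⟨Q₁, C₁, h₁⟩ := ih C₀
      obtain ⟨Q₂, C₂, h₂⟩ := hconst C₁
      refine ⟨(Polynomial.X : ℂ[X]) • Q₁ + Q₂, C₂, ?_⟩
      rw [pow_succ', mul_smul, h₁, smul_add, h₂, Matrix.add_mul, Matrix.smul_mul, add_assoc]
  induction M using Matrix.induction_on' with
  | h_zero => exact ⟨0, 0, by ext; simp [toPoly]⟩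
  | h_add M₁ M₂ h₁ h₂ => exact hadd M₁ M₂ h₁ h₂
  | h_std_basis i j x =>
    induction x using Polynomial.induction_on' with
    | add x y hx hy =>
      rw [Matrix.single_add]
      exact hadd _ _ hx hy
    | monomial k a =>
      obtain ⟨Q, C₁, h⟩ := hpow k (Matrix.single i j a)
      refine ⟨Q, C₁, h ▸ ?_⟩
      ext i' j' : 2
      simp only [Matrix.smul_apply, toPoly, Matrix.map_apply, Matrix.single_apply, smul_eq_mul]
      split_ifs
      · rw [← Polynomial.C_mul_X_pow_eq_monomial, mul_comm]
      · simp

theorem exists_eq_pencil_mul_add [Fintype ι] [DecidableEq ι] {E A : Matrix σ σ ℂ}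
    (hE : IsUnit E.det) (M : Matrix σ ι ℂ[X]) : ∃ (Q : Matrix σ ι ℂ[X]) (B₀ : Matrix σ ι ℂ),
      M = ((Polynomial.X : ℂ[X]) • toPoly E - toPoly A) * Q + toPoly B₀ := by
  obtain ⟨Q, C₀, h⟩ := exists_eq_mul_pencil_add (E := Eᵀ) (A := Aᵀ) (by rwa [Matrix.det_transpose])
    Mᵀ
  refine ⟨Qᵀ, C₀ᵀ, ?_⟩
  have := congrArg Matrix.transpose h
  rw [Matrix.transpose_transpose, Matrix.transpose_add, Matrix.transpose_mul] at this
  exact this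

/-- λE − A is E times the characteristic matrix of E⁻¹A, whose determinant is monic. -/
theorem det_pencil_ne_zero {E A : Matrix σ σ ℂ} (hE : IsUnit E.det) :
    ((Polynomial.X : ℂ[X]) • toPoly E - toPoly A).det ≠ 0 := by
  have h : (Polynomial.X : ℂ[X]) • toPoly E - toPoly A
      = toPoly E * Matrix.charmatrix (E⁻¹ * A) := by
    have h₁ : Matrix.charmatrix (E⁻¹ * A)
        = (Polynomial.X : ℂ[X]) • toPoly 1 - toPoly (E⁻¹ * A) := by
      generalize E⁻¹ * A = Z
      ext i j : 2
      rcases eq_or_ne i j with rfl | hij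
      · simp [toPoly]
      · simp [toPoly, hij]
    rw [h₁, mul_sub, Matrix.mul_smul, ← toPoly_mul, ← toPoly_mul, mul_one,
      Matrix.mul_nonsing_inv_cancel_left _ _ hE]
  rw [h, Matrix.det_mul]
  refine mul_ne_zero ?_ (Matrix.charpoly_monic _).ne_zero
  have : (toPoly E).det = Polynomial.C E.det := (RingHom.map_det Polynomial.C E).symm
  rw [this]
  exact Polynomial.C_ne_zero.2 hE.ne_zero

theorem isUnit_det_toRat_pencil {E A : Matrix σ σ ℂ} (hE : IsUnit E.det) :
    IsUnit (toRat ((Polynomial.X : ℂ[X]) • toPoly E - toPoly A)).det := by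
  have : (toRat ((Polynomial.X : ℂ[X]) • toPoly E - toPoly A)).det
      = algebraMap ℂ[X] (RatFunc ℂ) ((Polynomial.X : ℂ[X]) • toPoly E - toPoly A).det :=
    (RingHom.map_det (algebraMap ℂ[X] (RatFunc ℂ)) _).symm
  rw [this]
  exact (RatFunc.algebraMap_ne_zero (det_pencil_ne_zero hE)).isUnit

/-- Multiplication by matrix polynomials does not increase the dimension of a realization. -/
theorem exists_realization_mul [Fintype ι] [DecidableEq ι] [Fintype κ] (S : SystemData κ σ)
    (L : Matrix ι κ ℂ[X]) (K : Matrix κ ι ℂ[X]) :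
    ∃ S' : SystemData ι σ, S'.transfer = toRat L * S.transfer * toRat K := by
  obtain ⟨Q₁, C₀, h₁⟩ := exists_eq_mul_pencil_add (A := S.A) S.isUnit_det_E (L * toPoly S.C)
  obtain ⟨Q₂, B₀, h₂⟩ := exists_eq_pencil_mul_add (A := S.A) S.isUnit_det_E (toPoly S.B * K)
  have hN := isUnit_det_toRat_pencil (A := S.A) S.isUnit_det_E
  refine ⟨⟨L * S.P * K + Q₁ * (toPoly S.B * K) + toPoly C₀ * Q₂, C₀, B₀, S.A, S.E,
    S.isUnit_det_E⟩, ?_⟩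
  simp only [SystemData.transfer]
  have h₁' := congrArg toRat h₁
  have h₂' := congrArg toRat h₂
  simp only [toRat_add, toRat_mul] at h₁' h₂' ⊢
  set N := toRat ((Polynomial.X : ℂ[X]) • toPoly S.E - toPoly S.A)
  -- With LC = Q₁N + C₀ and BK = NQ₂ + B₀, the quotients cancel N⁻¹ and yield polynomial terms; only
  -- C₀N⁻¹B₀ keeps the state space.
  have key : toRat L * toRat (toPoly S.C) * N⁻¹ * (toRat (toPoly S.B) * toRat K)
      = toRat Q₁ * (toRat (toPoly S.B) * toRat K) + toRat (toPoly C₀) * toRat Q₂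
        + toRat (toPoly C₀) * N⁻¹ * toRat (toPoly B₀) := by
    rw [h₁', Matrix.add_mul, Matrix.add_mul, Matrix.mul_nonsing_inv_cancel_right _ _ hN, add_assoc]
    congr 1
    rw [h₂', Matrix.mul_add, Matrix.mul_assoc, Matrix.nonsing_inv_mul_cancel_left _ _ hN]
  rw [Matrix.mul_add, Matrix.add_mul]
  have : toRat L * (toRat (toPoly S.C) * N⁻¹ * toRat (toPoly S.B)) * toRat K
      = toRat L * toRat (toPoly S.C) * N⁻¹ * (toRat (toPoly S.B) * toRat K) := by
    simp only [Matrix.mul_assoc]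
  rw [this, key]
  abel

end Realizations

/-! ### Bordered block matrices -/

section Blocks

variable {σ : Type} {m n : ℕ}

theorem toRat_idDiag (X : Matrix (Fin n) (Fin n) ℂ[X]) : toRat (idDiag m X) = idDiag m (toRat X) := by
  ext ⟨a, α⟩ ⟨b, β⟩
  simp only [toRat, idDiag, Matrix.map_apply, Matrix.comp_apply, Matrix.of_apply]
  split_ifs <;> simp [Matrix.one_apply]

theorem map_colBlock {R R' : Type} [Semiring R] [Semiring R'] (f : R →+* R') (k : ℕ)
    (X : Matrix (Fin n) σ R) : (colBlock m k X).map f = colBlock m k (X.map f) := by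
  ext ⟨a, α⟩ j
  simp only [colBlock, Matrix.map_apply, Matrix.of_apply]
  split_ifs <;> simp

theorem map_rowBlock {R R' : Type} [Semiring R] [Semiring R'] (f : R →+* R') (k : ℕ)
    (X : Matrix σ (Fin n) R) : (rowBlock m k X).map f = rowBlock m k (X.map f) := by
  ext j ⟨a, α⟩
  simp only [rowBlock, Matrix.map_apply, Matrix.of_apply]
  split_ifs <;> simp

variable [Fintype σ]

theorem colBlock_mul {τ R : Type} [Semiring R] (k : ℕ) (X : Matrix (Fin n) σ R) (N : Matrix σ τ R) :
    colBlock m k X * N = colBlock m k (X * N) := by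
  ext ⟨a, α⟩ j
  simp only [colBlock, Matrix.mul_apply, Matrix.of_apply]
  split_ifs <;> simp

theorem colBlock_mul_rowBlock {R : Type} [Semiring R] (k l : ℕ) (X : Matrix (Fin n) σ R)
    (Y : Matrix σ (Fin n) R) :
    colBlock m k X * rowBlock m l Y = Matrix.comp _ _ _ _ R (Matrix.of fun a b : Fin m =>
      if (a : ℕ) + 1 = k ∧ (b : ℕ) + 1 = l then X * Y else 0) := by
  ext ⟨a, α⟩ ⟨b, β⟩
  simp only [colBlock, rowBlock, Matrix.mul_apply, Matrix.of_apply, Matrix.comp_apply, ite_and]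
  split_ifs <;> simp [Matrix.mul_apply]

theorem idDiag_add {R : Type} [Semiring R] (P : Matrix (Fin n) (Fin n) R) (X : Matrix (Fin n) σ R)
    (Y : Matrix σ (Fin n) R) :
    idDiag m P + colBlock m m X * rowBlock m m Y = idDiag m (P + X * Y) := by
  rw [colBlock_mul_rowBlock]
  ext ⟨a, α⟩ ⟨b, β⟩
  simp only [idDiag, Matrix.add_apply, Matrix.comp_apply, Matrix.of_apply]
  by_cases hab : a = b
  · subst hab
    by_cases ha : (a : ℕ) + 1 = m <;> simp [ha]
  · have : ¬ ((a : ℕ) + 1 = m ∧ (b : ℕ) + 1 = m) := fun h => hab (Fin.ext (by omega))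
    simp [hab, this]

variable [DecidableEq σ]

/-- The state pencil is untouched, so the equivalence of system matrices acts on the transfer
functions by U and V alone. -/
theorem transfer_of_equiv {S : SystemData (Fin n) σ} {T : SystemData (Fin m × Fin n) σ}
    {U V : Matrix (Fin m × Fin n) (Fin m × Fin n) ℂ[X]} (hP : U * T.P * V = idDiag m S.P)
    (hC : U * toPoly T.C = colBlock m m (toPoly S.C))
    (hB : toPoly T.B * V = rowBlock m m (toPoly S.B)) (hA : T.A = S.A) (hE : T.E = S.E) :
    toRat U * T.transfer * toRat V = idDiag m S.transfer := by
  have hP' := congrArg toRat hP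
  have hC' := congrArg toRat hC
  have hB' := congrArg toRat hB
  have h₁ : toRat (colBlock m m (toPoly S.C)) = colBlock m m (toRat (toPoly S.C)) :=
    map_colBlock (algebraMap ℂ[X] (RatFunc ℂ)) m _
  have h₂ : toRat (rowBlock m m (toPoly S.B)) = rowBlock m m (toRat (toPoly S.B)) :=
    map_rowBlock (algebraMap ℂ[X] (RatFunc ℂ)) m _
  rw [toRat_mul, toRat_mul, toRat_idDiag] at hP'
  rw [toRat_mul, h₁] at hC'
  rw [toRat_mul, h₂] at hB'
  rw [SystemData.transfer, SystemData.transfer, ← idDiag_add, hA, hE, Matrix.mul_add,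
    Matrix.add_mul, hP', ← hB', ← colBlock_mul, ← hC']
  simp only [Matrix.mul_assoc]

theorem toMatrix_of_equiv {S : SystemData (Fin n) σ} {T : SystemData (Fin m × Fin n) σ}
    {U V : Matrix (Fin m × Fin n) (Fin m × Fin n) ℂ[X]} (hP : U * T.P * V = idDiag m S.P)
    (hC : U * toPoly T.C = colBlock m m (toPoly S.C))
    (hB : toPoly T.B * V = rowBlock m m (toPoly S.B)) (hA : T.A = S.A) (hE : T.E = S.E) :
    Matrix.fromBlocks U 0 0 (toPoly 1) * T.toMatrix * Matrix.fromBlocks V 0 0 (toPoly 1)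
      = paddedSystem m S := by
  rw [toPoly_one, SystemData.toMatrix, Matrix.fromBlocks_multiply, Matrix.fromBlocks_multiply,
    paddedSystem]
  simp [hP, hC, hB, hA, hE]

/-- The transfer function of `S` is the one of `T` multiplied by the last block row of U and the
last block column of V. Every realization of the latter thus gives one of the former of the same
dimension. -/
theorem isMinimal_of_equiv (hm : 0 < m) {S : SystemData (Fin n) σ}
    {T : SystemData (Fin m × Fin n) σ} {U V : Matrix (Fin m × Fin n) (Fin m × Fin n) ℂ[X]}
    (h : toRat U * T.transfer * toRat V = idDiag m S.transfer) (hS : S.IsMinimal) :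
    T.IsMinimal := by
  intro r S' hS'
  obtain ⟨k, rfl⟩ : ∃ k, m = k + 1 := ⟨m - 1, by omega⟩
  obtain ⟨S'', h''⟩ := exists_realization_mul S' (U.submatrix (fun α => (Fin.last k, α)) id)
    (V.submatrix id fun β => (Fin.last k, β))
  refine hS r S'' ?_
  rw [h'', hS']
  ext α β
  have := congrFun (congrFun h (Fin.last k, α)) (Fin.last k, β)
  simp only [idDiag, Matrix.comp_apply, Matrix.of_apply, Fin.val_last, if_true] at this
  rw [← this]
  rfl

end Blocks

/-! ### The position `m - i_0(w)` -/

theorem tupleW_eq (e : ℕ) : tupleW (2 * e) = (admTuple 0 e).map fun i : ℕ => (i : ℤ) := by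
  have h₂ : 2 * e % 2 = 0 := by omega
  have h₃ := admissibleTuple_eq 0 e
  rw [Nat.zero_add] at h₃
  rw [tupleW, h₂, h₃]

theorem one_zero_sublist_admTuple {e : ℕ} (he : 0 < e) : [1, 0].Sublist (admTuple 0 e) := by
  induction e with
  | zero => omega
  | succ e ih =>
    rcases Nat.eq_zero_or_pos e with rfl | he0
    · decide
    · exact ((ih he0).cons _).cons _

/-- In w the entry 2 stands directly behind the only entry 1. A chain (s, …, 1, 0) with s ≥ 2 is
therefore impossible, so i_0(w) ≤ 1. -/
theorem not_two_one_sublist_admTuple (e : ℕ) : ¬ [2, 1].Sublist (admTuple 0 e) := by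
  induction e with
  | zero => decide
  | succ e ih =>
    rcases Nat.eq_zero_or_pos e with rfl | he0
    · decide
    · intro h
      rw [admTuple, List.cons_sublist_cons', List.cons_sublist_cons'] at h
      rcases h with (h | h) | h
      · exact ih h
      · omega
      · omega

theorem two_one_sublist_range {k : ℕ} (hk : 2 ≤ k) : [2, 1].Sublist (List.range (k + 1)).reverse := by
  induction k with
  | zero => omega
  | succ k ih =>
    rcases Nat.lt_or_ge k 2 with h | h
    · obtain rfl : k = 1 := by omega
      decide
    · rw [List.range_succ, List.reverse_append]
      exact (ih h).cons _

theorem consecInv_zero_tupleW (e : ℕ) :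
    consecInv 0 (tupleW (2 * e)) = if e = 0 then 0 else 1 := by
  have hmap : ∀ s : ℕ, ((List.range (s + 1)).reverse.map (fun k : ℕ => (0 : ℤ) + (k : ℤ))).Sublist
      ((admTuple 0 e).map fun i : ℕ => (i : ℤ)) ↔ (List.range (s + 1)).reverse.Sublist
        (admTuple 0 e) := fun s => by
    simp only [zero_add]
    refine ⟨fun h => ?_, fun h => h.map _⟩
    obtain ⟨l, hl, hl'⟩ := List.sublist_map_iff.1 h
    rwa [List.map_injective_iff.2 Nat.cast_injective hl']
  have hmem : (0 : ℤ) ∈ (admTuple 0 e).map fun i : ℕ => (i : ℤ) :=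
    List.mem_map.2 ⟨0, mem_admTuple.2 (Nat.zero_le _), rfl⟩
  rw [tupleW_eq, consecInv, if_pos hmem]
  rcases Nat.eq_zero_or_pos e with rfl | he
  · rw [if_pos rfl]
    norm_cast
  · rw [if_neg he.ne']
    refine (congrArg (fun k : ℕ => (k : ℤ)) ?_).trans Nat.cast_one
    rw [Nat.findGreatest_eq_iff]
    refine ⟨?_, fun _ => ?_, fun s hs _ h => ?_⟩
    · rw [List.length_map]
      exact List.length_pos_of_mem (mem_admTuple.2 (Nat.zero_le _) : 0 ∈ admTuple 0 e)
    · rw [hmap]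
      exact one_zero_sublist_admTuple he
    · rw [hmap] at h
      exact not_two_one_sublist_admTuple e ((two_one_sublist_range hs).trans h)

theorem position_eq {m e : ℕ} (hm : 2 * e < m) : position m (2 * e) = blockPos m e + 1 := by
  rw [position, consecInv_zero_tupleW, blockPos]
  split_ifs <;> omega

/-! ### Dependence on the constant coefficient -/

section ConstantTerm

variable {S : Type*} [Ring S] {m : ℕ}

/-- A 0 enters only through M_0, which occurs in w but not in c_w. -/
theorem leadBlock_update_zero {e p s : ℕ} (hm : m = 2 * e + 1 + (p + 2 * s)) (A : ℕ → S) (Y : S) :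
    leadBlock m e p s (Function.update A 0 Y) = leadBlock m e p s A := by
  have hhigh : ∀ t : List ℕ, (∀ j ∈ t, j < m) →
      t.map (highFactor m (Function.update A 0 Y)) = t.map (highFactor m A) := fun t ht =>
    List.map_congr_left fun j hj => by
      rw [highFactor, Function.update_of_ne (by have := ht j hj; omega), highFactor]
  have hlow : (admCompl 0 e).map (lowFactor m (Function.update A 0 Y))
      = (admCompl 0 e).map (lowFactor m A) :=
    List.map_congr_left fun j hj => by
      rw [lowFactor, Function.update_of_ne (pos_of_mem_admCompl_zero hj).ne', lowFactor]
  rw [leadBlock, leadBlock, hlow, hhigh, hhigh]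
  · intro j hj
    have := lt_of_mem_admCompl hj
    omega
  · intro j hj
    have := mem_admTuple.1 hj
    omega

/-- M_0 changes by −Y in its last diagonal block, and the factors on both sides of it move the last
block to `blockPos`. The border term of 𝔾 has exactly this shape, so it can be hidden in A 0. -/
theorem constBlock_update_zero {e p s : ℕ} (hm : m = 2 * e + 1 + (p + 2 * s)) (A : ℕ → S) (Y : S) :
    constBlock m e p s (Function.update A 0 (A 0 + Y)) = constBlock m e p s A
      - Matrix.of fun a b : Fin m =>
        if (a : ℕ) + 1 = blockPos m e + 1 ∧ (b : ℕ) + 1 = blockPos m e + 1 then Y else 0 := by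
  have hhigh : (admCompl p s).map (highFactor m (Function.update A 0 (A 0 + Y)))
      = (admCompl p s).map (highFactor m A) :=
    List.map_congr_left fun j hj => by
      rw [highFactor, Function.update_of_ne (by have := lt_of_mem_admCompl hj; omega), highFactor]
  have hlow : ∀ t : List ℕ, (∀ j ∈ t, 0 < j) →
      t.map (lowFactor m (Function.update A 0 (A 0 + Y))) = t.map (lowFactor m A) := fun t ht =>
    List.map_congr_left fun j hj => by
      rw [lowFactor, Function.update_of_ne (ht j hj).ne', lowFactor]
  have hlast : m - 1 < m := by omega
  have h0 : lowFactor m (Function.update A 0 (A 0 + Y)) 0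
      = lowFactor m A 0 - Matrix.single ⟨m - 1, hlast⟩ ⟨m - 1, hlast⟩ Y := by
    rw [lowFactor, Function.update_self, lowFactor]
    ext a b
    rw [Nat.cast_zero, Matrix.sub_apply, blockElem_zero_apply, blockElem_zero_apply,
      Matrix.single_apply]
    simp only [Fin.ext_iff]
    split_ifs <;> first | (exfalso; omega) | simp
    abel
  have hcol := prod_pairTuple_mulVec A (m := m) (e := e) (by omega)
  have hrow := vecMul_prod_compl A hm
  rw [mulVec_basisVec hlast] at hcol
  rw [basisVec_vecMul hlast] at hrow
  rw [constBlock, constBlock, hhigh, hlow (admCompl 0 e) fun j => pos_of_mem_admCompl_zero,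
    admTuple_zero_eq, List.map_append, List.map_append, List.prod_append, List.prod_append,
    hlow _ fun j hj => (mem_pairTuple.1 hj).1, mul_assoc _ ((admCompl 0 e).map _).prod,
    mul_assoc _ ((admCompl 0 e).map _).prod]
  simp only [List.map_cons, List.map_nil, List.prod_singleton]
  rw [h0]
  generalize ((pairTuple e).map (lowFactor m A)).prod = M at *
  generalize ((admCompl 0 e).map (lowFactor m A)).prod * ((admCompl p s).map (highFactor m A)).prod
    = W at *
  rw [mul_sub, sub_mul]
  congr 1
  ext a b
  have hc := congrFun hcol a
  have hr := congrFun hrow b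
  rw [Matrix.mul_apply, Finset.sum_eq_single ⟨m - 1, hlast⟩, Matrix.mul_apply,
    Finset.sum_eq_single ⟨m - 1, hlast⟩]
  · simp only [Matrix.single_apply, and_true, if_true, hc, hr, basisVec, Matrix.of_apply,
      Nat.add_right_cancel_iff]
    split_ifs <;> first | (exfalso; omega) | simp
  · intro c _ hc
    rw [Matrix.single_apply, if_neg (fun h => hc h.1.symm), mul_zero]
  · simp
  · intro c _ hc
    rw [Matrix.mul_apply, Finset.sum_eq_zero, zero_mul]
    intro d _
    rw [Matrix.single_apply, if_neg (fun h => hc h.2.symm), mul_zero]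
  · simp

end ConstantTerm

/-! ### The bordered pencil -/

section Bordered

variable {m e p s n ℓ : ℕ}

/-- The matrix `s Q`. -/
def signMat (m h : ℕ) (n : ℕ) (ε : Fin m → ℤˣ) : Matrix (Fin m × Fin n) (Fin m × Fin n) ℂ :=
  parameter ε (position m h) • quasiIdentity n ε

theorem unit_cast_mul_self (u : ℤˣ) : ((u : ℤ) : ℂ) * ((u : ℤ) : ℂ) = 1 := by
  rcases Int.units_eq_one_or u with rfl | rfl <;> simp

theorem parameter_position (hm : 2 * e < m) (ε : Fin m → ℤˣ) :
    parameter ε (position m (2 * e)) = (((ε ⟨blockPos m e, blockPos_lt hm⟩ : ℤˣ) : ℤ) : ℂ) := by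
  rw [position_eq hm, parameter, dif_pos (by rw [Nat.add_sub_cancel]; exact blockPos_lt hm)]
  rfl

theorem signMat_eq (hm : 2 * e < m) (ε : Fin m → ℤˣ) : signMat m (2 * e) n ε
    = Matrix.diagonal fun a => (((ε ⟨blockPos m e, blockPos_lt hm⟩ : ℤˣ) : ℤ) : ℂ)
      * (((ε a.1 : ℤˣ) : ℤ) : ℂ) := by
  rw [signMat, parameter_position hm, quasiIdentity]
  ext a b
  rw [Matrix.smul_apply, Matrix.diagonal_apply, Matrix.diagonal_apply]
  split_ifs <;> simp

theorem signMat_mul_self (hm : 2 * e < m) (ε : Fin m → ℤˣ) :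
    signMat m (2 * e) n ε * signMat m (2 * e) n ε = 1 := by
  rw [signMat_eq hm, Matrix.diagonal_mul_diagonal, ← Matrix.diagonal_one]
  congr 1
  ext a
  rw [mul_mul_mul_comm, unit_cast_mul_self, unit_cast_mul_self, one_mul]

/-- The reason for the scalar s: at the position of the border, sQ has the sign s² = 1, so the
border column needs no correction. -/
theorem signMat_mul_colBlock (hm : 2 * e < m) (ε : Fin m → ℤˣ) {R σ : Type} [CommRing R]
    (f : ℂ →+* R) (X : Matrix (Fin n) σ R) :
    (signMat m (2 * e) n ε).map f * colBlock m (blockPos m e + 1) X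
      = colBlock m (blockPos m e + 1) X := by
  rw [signMat_eq hm, Matrix.diagonal_map (map_zero f)]
  refine Matrix.ext fun x j => ?_
  obtain ⟨a, α⟩ := x
  rw [Matrix.diagonal_mul]
  change f (_ * _) * (if (a : ℕ) + 1 = blockPos m e + 1 then X α j else 0)
    = if (a : ℕ) + 1 = blockPos m e + 1 then X α j else 0
  split_ifs with h
  · have : a = ⟨blockPos m e, blockPos_lt hm⟩ := Fin.ext (Nat.succ_injective h)
    subst this
    rw [unit_cast_mul_self, map_one, one_mul]
  · rw [mul_zero]

theorem eq_transpose_mul_J {ι : Type} {B : Matrix (Fin ℓ ⊕ Fin ℓ) ι ℂ}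
    {C : Matrix ι (Fin ℓ ⊕ Fin ℓ) ℂ}
    (h : J ℓ * B = Cᵀ) : Bᵀ * (J ℓ)ᵀ = C := by
  rw [← Matrix.transpose_mul, h, Matrix.transpose_transpose]

theorem toRat_sum_coeffMat (P : Matrix (Fin n) (Fin n) ℂ[X])
    (hP : ∀ k, m < k → coeffMat P k = 0) :
    ∑ i ∈ Finset.range (m + 1), (RatFunc.X : RatFunc ℂ) ^ i • toRat (toPoly (coeffMat P i))
      = toRat P := by
  conv_rhs => rw [← sum_coeffMat P hP]
  have : ∀ Q : Matrix (Fin n) (Fin n) ℂ[X], toRat Q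
    = (algebraMap ℂ[X] (RatFunc ℂ)).mapMatrix Q := fun _ => rfl
  rw [this, map_sum]
  refine Finset.sum_congr rfl fun i _ => ?_
  ext a b
  simp [toRat, RatFunc.algebraMap_X]

/-- With Γ = C(λI − A)⁻¹B, which is proper, 𝔾 is sQ times the pencil of the coefficients A_0 + Γ,
A_1, …, A_m. Thus λ⁻¹𝔾 is a reversed pencil in λ⁻¹ over the proper functions, and its reduced last
block is λ⁻ᵐ(P + Γ) = λ⁻ᵐG. -/
theorem exists_biproper_borderedPencil (hm : m = 2 * e + 1 + (p + 2 * s)) (ε : Fin m → ℤˣ)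
    (S : SystemData (Fin n) (Fin ℓ ⊕ Fin ℓ)) (hE : S.E = 1) (hJ : J ℓ * S.B = S.Cᵀ)
    (hP : ∀ k, m < k → coeffMat S.P k = 0) (hA : IsUnit (coeffMat S.P m) ∨ p = 0) :
    ∃ Ol Or : Matrix (Fin m × Fin n) (Fin m × Fin n) (RatFunc ℂ),
      IsBiproper Ol ∧ IsBiproper Or ∧
        Ol * ((RatFunc.X : RatFunc ℂ)⁻¹ • (borderedPencil m (2 * e) p ε S).transfer) * Or
          = idDiag m (((RatFunc.X : RatFunc ℂ) ^ m)⁻¹ • S.transfer) := by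
  have hm' : 2 * e < m := by omega
  obtain ⟨Γ, hΓ⟩ := exists_proper_transfer S.C S.A S.B
  set A : ℕ → Matrix (Fin n) (Fin n) properRing := fun i => (coeffMat S.P i).map properConst with hAdef
  have hA' : IsUnit (Function.update A 0 (A 0 + Γ) m) ∨ p = 0 := by
    rw [Function.update_of_ne (by omega)]
    exact hA.imp_left fun h => h.map properConst.mapMatrix
  obtain ⟨U, V, hU, hV, hUV⟩ :=
    exists_equiv_reversed_blockPencil (Function.update A 0 (A 0 + Γ)) properInv hm hA'
  have hD : IsUnit ((signMat m (2 * e) n ε).map properConst) :=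
    IsUnit.map properConst.mapMatrix
      (⟨⟨_, _, signMat_mul_self hm' ε, signMat_mul_self hm' ε⟩, rfl⟩ : IsUnit (signMat m (2 * e) n ε))
  refine ⟨(Matrix.comp _ _ _ _ _ U * (signMat m (2 * e) n ε).map properConst).map
      properRing.subtype, (Matrix.comp _ _ _ _ _ V).map properRing.subtype,
    isBiproper_of_isUnit ((isUnit_comp hU).mul hD), isBiproper_of_isUnit (isUnit_comp hV), ?_⟩
  rw [Matrix.map_mul, ← toRat_toPoly]
  set D := toRat (toPoly (signMat m (2 * e) n ε)) with hDdef
  have hDD : D * D = 1 := by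
    rw [hDdef, ← toRat_mul, ← toPoly_mul, signMat_mul_self hm', toPoly_one]
    simp [toRat]
  set f : Matrix (Fin n) (Fin n) properRing →+* Matrix (Fin n) (Fin n) (RatFunc ℂ) :=
    properRing.subtype.mapMatrix with hf
  have hfA : ∀ i, f (A i) = toRat (toPoly (coeffMat S.P i)) := fun i => (toRat_toPoly _).symm
  -- the transfer function, in block form
  have hT : (borderedPencil m (2 * e) p ε S).transfer = D * Matrix.comp _ _ _ _ (RatFunc ℂ)
      ((RatFunc.X : RatFunc ℂ) • (leadBlock m e p s (Function.update A 0 (A 0 + Γ))).map f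
        - (constBlock m e p s (Function.update A 0 (A 0 + Γ))).map f) := by
    have h₁ : (borderedPencil m (2 * e) p ε S).transfer = toRat (signedPencil m (2 * e) p ε S.P)
        + toRat (toPoly (colBlock m (position m (2 * e)) (S.Bᵀ * (J ℓ)ᵀ))) *
          (toRat ((Polynomial.X : ℂ[X]) • toPoly 1 - toPoly S.A))⁻¹
          * toRat (toPoly (rowBlock m (position m (2 * e)) S.B)) := rfl
    have h₂ : ∀ X : Matrix (Fin n) (Fin ℓ ⊕ Fin ℓ) ℂ, toRat (toPoly (colBlock m (blockPos m e + 1) X))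
        = colBlock m (blockPos m e + 1) (toRat (toPoly X)) := fun X => by
      rw [toPoly, map_colBlock Polynomial.C, toRat, map_colBlock (algebraMap ℂ[X] (RatFunc ℂ))]
      rfl
    have h₃ : ∀ X : Matrix (Fin ℓ ⊕ Fin ℓ) (Fin n) ℂ, toRat (toPoly (rowBlock m (blockPos m e + 1) X))
        = rowBlock m (blockPos m e + 1) (toRat (toPoly X)) := fun X => by
      rw [toPoly, map_rowBlock Polynomial.C, toRat, map_rowBlock (algebraMap ℂ[X] (RatFunc ℂ))]
      rfl
    have h₄ : D * colBlock m (blockPos m e + 1) (toRat (toPoly S.C))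
        = colBlock m (blockPos m e + 1) (toRat (toPoly S.C)) := by
      have := signMat_mul_colBlock hm' ε ((algebraMap ℂ[X] (RatFunc ℂ)).comp Polynomial.C)
        (toRat (toPoly S.C))
      exact this
    have h₅ : ∀ M : Matrix (Fin m) (Fin m) (Matrix (Fin n) (Fin n) ℂ),
        toRat (toPoly (Matrix.comp _ _ _ _ ℂ M)) = Matrix.comp _ _ _ _ (RatFunc ℂ)
          (M.map ((algebraMap ℂ[X] (RatFunc ℂ)).comp Polynomial.C).mapMatrix) := fun M => rfl
    rw [h₁, eq_transpose_mul_J hJ, position_eq hm', h₂, h₃, ← h₄, Matrix.mul_assoc D,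
      Matrix.mul_assoc D, colBlock_mul, colBlock_mul_rowBlock, hΓ, signedPencil, toRat_mul,
      ← signMat, ← hDdef, ← Matrix.mul_add, pencilL_eq hm, toRat_sub, toRat_X_smul, h₅, h₅]
    congr 1
    -- The modified coefficient lowers the constant block by the border product; as that block
    -- enters with a minus sign, the border term of 𝔾 appears with a plus.
    rw [leadBlock_update_zero hm, constBlock_update_zero hm, leadBlock_map, leadBlock_map,
      constBlock_map, Matrix.map_sub f (fun a b => map_sub f a b), constBlock_map,
      show (fun i => f (A i)) = fun i => toRat (toPoly (coeffMat S.P i)) from funext hfA]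
    refine Matrix.ext fun x y => ?_
    obtain ⟨a, α⟩ := x
    obtain ⟨b, β⟩ := y
    simp only [Matrix.add_apply, Matrix.sub_apply, Matrix.comp_apply, Matrix.smul_apply,
      Matrix.map_apply, Matrix.of_apply]
    split_ifs
    · simp only [hf, RingHom.mapMatrix_apply, Matrix.map_apply]
      exact sub_add _ _ _
    · simp only [map_zero, Matrix.zero_apply, sub_zero, add_zero]
      rfl
  have hUV' := congrArg (fun M : Matrix (Fin m) (Fin m) (Matrix (Fin n) (Fin n) properRing) =>
    Matrix.comp _ _ _ _ (RatFunc ℂ) (M.map f)) hUV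
  simp only [Matrix.map_mul, comp_mul, blockElem_map, ← idDiag_eq_comp] at hUV'
  have hK : (RatFunc.X : RatFunc ℂ)⁻¹ • Matrix.comp _ _ _ _ (RatFunc ℂ)
      ((RatFunc.X : RatFunc ℂ) • (leadBlock m e p s (Function.update A 0 (A 0 + Γ))).map f
        - (constBlock m e p s (Function.update A 0 (A 0 + Γ))).map f)
      = Matrix.comp _ _ _ _ (RatFunc ℂ) ((leadBlock m e p s (Function.update A 0 (A 0 + Γ)) -
          properInv • constBlock m e p s (Function.update A 0 (A 0 + Γ))).map f) := by
    generalize leadBlock m e p s (Function.update A 0 (A 0 + Γ)) = M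
    generalize constBlock m e p s (Function.update A 0 (A 0 + Γ)) = N
    refine Matrix.ext fun x y => ?_
    obtain ⟨a, α⟩ := x
    obtain ⟨b, β⟩ := y
    simp only [Matrix.sub_apply, Matrix.comp_apply, Matrix.smul_apply, Matrix.map_apply, hf,
      RingHom.mapMatrix_apply, Subring.subtype_apply, smul_eq_mul, mul_sub,
      AddSubgroupClass.coe_sub, MulMemClass.coe_mul]
    rw [inv_mul_cancel_left₀ RatFunc.X_ne_zero]
    rfl
  have hsum : f (∑ i ∈ Finset.range (m + 1), properInv ^ i •
      Function.update A 0 (A 0 + Γ) (m - i)) = ((RatFunc.X : RatFunc ℂ) ^ m)⁻¹ • S.transfer := by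
    have hT' : S.transfer = toRat S.P + f Γ := by
      rw [SystemData.transfer, hE, hΓ]
      rfl
    have hsmul : ∀ (i : ℕ) (Y : Matrix (Fin n) (Fin n) properRing),
        f (properInv ^ i • Y) = (RatFunc.X : RatFunc ℂ)⁻¹ ^ i • f Y := fun i Y => by
      refine Matrix.ext fun a b => ?_
      change properRing.subtype (properInv ^ i * Y a b) = _
      rw [map_mul, map_pow]
      rfl
    have hB : ∀ i, f (Function.update A 0 (A 0 + Γ) i)
        = toRat (toPoly (coeffMat S.P i)) + if i = 0 then f Γ else 0 := fun i => by
      rcases Nat.eq_zero_or_pos i with rfl | hi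
      · rw [Function.update_self, map_add, hfA, if_pos rfl]
      · rw [Function.update_of_ne hi.ne', hfA, if_neg hi.ne', add_zero]
    -- The reflection i ↦ m − i turns ∑ λ⁻ⁱ A_{m−i} into λ⁻ᵐ ∑ λⁱ A_i, with Γ attached to the term i
    -- = 0.
    rw [map_sum, hT', ← toRat_sum_coeffMat S.P hP, ← Finset.sum_range_reflect, smul_add,
      Finset.smul_sum]
    have hterm : ∀ i ∈ Finset.range (m + 1),
        f (properInv ^ (m + 1 - 1 - i) • Function.update A 0 (A 0 + Γ) (m - (m + 1 - 1 - i)))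
        = ((RatFunc.X : RatFunc ℂ) ^ m)⁻¹ • (RatFunc.X : RatFunc ℂ) ^ i •
            toRat (toPoly (coeffMat S.P i))
          + if i = 0 then ((RatFunc.X : RatFunc ℂ) ^ m)⁻¹ • f Γ else 0 := fun i hi => by
      have hi := Finset.mem_range.1 hi
      have h₁ : m - (m + 1 - 1 - i) = i := by omega
      have h₂ : (RatFunc.X : RatFunc ℂ)⁻¹ ^ (m + 1 - 1 - i)
          = ((RatFunc.X : RatFunc ℂ) ^ m)⁻¹ * RatFunc.X ^ i := by
        rw [Nat.add_sub_cancel, inv_pow, pow_sub₀ _ RatFunc.X_ne_zero (by omega), mul_inv, inv_inv]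
      rw [hsmul, h₁, hB, h₂, smul_add, mul_smul]
      congr 1
      split_ifs with h0
      · rw [h0, pow_zero, mul_one]
      · rw [smul_zero]
    rw [Finset.sum_congr rfl hterm, Finset.sum_add_distrib]
    simp
  rw [hT, ← Matrix.mul_smul, hK, ← hsum, ← hUV']
  have hmap : ∀ M : Matrix (Fin m) (Fin m) (Matrix (Fin n) (Fin n) properRing),
      (Matrix.comp _ _ _ _ _ M).map properRing.subtype
        = Matrix.comp _ _ _ _ (RatFunc ℂ) (M.map f) := fun _ => rfl
  rw [hmap, hmap]
  generalize Matrix.comp _ _ _ _ (RatFunc ℂ) (U.map f) = U'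
  generalize Matrix.comp _ _ _ _ (RatFunc ℂ) (V.map f) = V'
  rw [← mul_assoc (U' * D), mul_assoc U', hDD, mul_one]

theorem isRosenbrockStrongLinearization_borderedPencil (hm : m = 2 * e + 1 + (p + 2 * s))
    (ε : Fin m → ℤˣ) (S : SystemData (Fin n) (Fin ℓ ⊕ Fin ℓ)) (hE : S.E = 1)
    (hJ : J ℓ * S.B = S.Cᵀ) (hP : ∀ k, m < k → coeffMat S.P k = 0)
    (hA : IsUnit (coeffMat S.P m) ∨ p = 0) (hmin : S.IsMinimal) :
    IsRosenbrockStrongLinearization S (borderedPencil m (2 * e) p ε S) := by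
  have hm' : 2 * e < m := by omega
  obtain ⟨U, V, hU, hV, hUc, hVr, hUV⟩ := exists_equiv_pencilL hm S.P hP hA
  have hDD : toPoly (signMat m (2 * e) n ε) * toPoly (signMat m (2 * e) n ε) = 1 := by
    rw [← toPoly_mul, signMat_mul_self hm', toPoly_one]
  have hDP : (borderedPencil m (2 * e) p ε S).P
      = toPoly (signMat m (2 * e) n ε) * pencilL m (2 * e) p S.P := rfl
  have h₁ : U * toPoly (signMat m (2 * e) n ε) * (borderedPencil m (2 * e) p ε S).P * V
      = idDiag m S.P := by
    rw [hDP, ← mul_assoc (U * _), mul_assoc U, hDD, mul_one, hUV]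
  have h₂ : U * toPoly (signMat m (2 * e) n ε) * toPoly (borderedPencil m (2 * e) p ε S).C
      = colBlock m m (toPoly S.C) := by
    have hC : toPoly (borderedPencil m (2 * e) p ε S).C
        = colBlock m (blockPos m e + 1) (toPoly S.C) := by
      have : (borderedPencil m (2 * e) p ε S).C
        = colBlock m (position m (2 * e)) (S.Bᵀ * (J ℓ)ᵀ) := rfl
      rw [this, eq_transpose_mul_J hJ, position_eq hm', toPoly, map_colBlock Polynomial.C]
      rfl
    rw [hC, Matrix.mul_assoc, toPoly, signMat_mul_colBlock hm' ε Polynomial.C, hUc]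
  have h₃ : toPoly (borderedPencil m (2 * e) p ε S).B * V = rowBlock m m (toPoly S.B) := by
    have hB : toPoly (borderedPencil m (2 * e) p ε S).B
        = rowBlock m (blockPos m e + 1) (toPoly S.B) := by
      have : (borderedPencil m (2 * e) p ε S).B = rowBlock m (position m (2 * e)) S.B := rfl
      rw [this, position_eq hm', toPoly, map_rowBlock Polynomial.C]
      rfl
    rw [hB, hVr]
  have hD : IsUnit (toPoly (signMat m (2 * e) n ε)) := ⟨⟨_, _, hDD, hDD⟩, rfl⟩
  have htr := transfer_of_equiv h₁ h₂ h₃ rfl hE.symm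
  refine ⟨?_, isMinimal_of_equiv (by omega) htr hmin,
    ⟨_, V, 1, 1, isUnimodular_of_isUnit (hU.mul hD), isUnimodular_of_isUnit hV, by simp, by simp,
      toMatrix_of_equiv h₁ h₂ h₃ rfl hE.symm⟩,
    exists_biproper_borderedPencil hm ε S hE hJ hP hA⟩
  refine ⟨-(signMat m (2 * e) n ε * Matrix.comp _ _ _ _ ℂ (constBlock m e p s (coeffMat S.P))),
    -(signMat m (2 * e) n ε * Matrix.comp _ _ _ _ ℂ (leadBlock m e p s (coeffMat S.P))), ?_⟩
  have hneg : ∀ M : Matrix (Fin m × Fin n) (Fin m × Fin n) ℂ, toPoly (-M) = -toPoly M := fun M => by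
    ext; simp [toPoly]
  rw [hDP, pencilL_eq hm, mul_sub, Matrix.mul_smul, hneg, hneg, toPoly_mul, toPoly_mul, smul_neg,
    sub_neg_eq_add, neg_add_eq_sub]

end Bordered

/-! ### Diagonal signs and products of Fiedler factors -/

section Signs

variable {S : Type*} [Ring S] {m : ℕ}

/-- `diag(d) M = N diag(d')`, for diagonal matrices of signs. -/
def SignIntertwines (d d' : ℕ → ℤˣ) (M N : Matrix (Fin m) (Fin m) S) : Prop :=
  ∀ a b : Fin m, d a • M a b = d' b • N a b

theorem SignIntertwines.mul {d d' d'' : ℕ → ℤˣ} {M N M' N' : Matrix (Fin m) (Fin m) S}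
    (h : SignIntertwines d d' M N) (h' : SignIntertwines d' d'' M' N') :
    SignIntertwines d d'' (M * M') (N * N') := fun a b => by
  rw [Matrix.mul_apply, Matrix.mul_apply, Finset.smul_sum, Finset.smul_sum]
  refine Finset.sum_congr rfl fun c _ => ?_
  rw [← smul_mul_assoc, h a c, smul_mul_assoc, ← mul_smul_comm, h' c b, mul_smul_comm]

theorem signIntertwines_one {d d' : ℕ → ℤˣ} (h : ∀ j < m, d' j = d j) :
    SignIntertwines d d' (1 : Matrix (Fin m) (Fin m) S) 1 := fun a b => by
  rw [h b b.2, Matrix.one_apply]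
  split_ifs with hab
  · rw [hab]
  · rw [smul_zero, smul_zero]

/-- The coefficients `(-1)^i A_i`. -/
def altCoeff (A : ℕ → S) (i : ℕ) : S := (-1 : ℤˣ) ^ i • A i

theorem smul_eq_smul_smul_of_eq {u v w : ℤˣ} (h : v = u * w) (x : S) : w • x = v • u • x := by
  rw [h, smul_smul, mul_right_comm, Int.units_mul_self, one_mul]

variable (A : ℕ → S) {d d' : ℕ → ℤˣ}

/-- The entry with A_i requires d' = (−1)^i d in its block, and the two unit entries require d' to
be d with the two blocks interchanged. These requirements agree exactly under `h`. -/
theorem signIntertwines_lowFactor {i : ℕ} (hi0 : 0 < i) (hi : i < m)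
    (h : d (m - i) = (-1) ^ i * d (m - i - 1)) (h₀ : d' (m - i - 1) = (-1) ^ i * d (m - i - 1))
    (h₁ : d' (m - i) = (-1) ^ i * d (m - i))
    (h₂ : ∀ j < m, j ≠ m - i - 1 → j ≠ m - i → d' j = d j) :
    SignIntertwines d d' (lowFactor m A i) (lowFactor m (altCoeff A) i) := fun a b => by
  rw [lowFactor, lowFactor, blockElem_pos_apply hi0, blockElem_pos_apply hi0]
  have h₃ : d' (m - i) = d (m - i - 1) := by
    rw [h₁, h, ← mul_assoc, Int.units_mul_self, one_mul]
  split_ifs with h1 h2 h3 h4 h5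
  · rw [show (a : ℕ) = m - i - 1 by omega, show (b : ℕ) = m - i - 1 by omega, altCoeff, smul_neg,
      smul_neg, smul_eq_smul_smul_of_eq h₀]
  · rw [show (a : ℕ) = m - i - 1 by omega, h2.2, h₃]
  · rw [h3.1, show (b : ℕ) = m - i - 1 by omega, h, h₀]
  · rw [smul_zero, smul_zero]
  · rw [h5, h₂ b b.2 (by rw [h5] at h1; omega) (by rw [h5] at h4; omega)]
  · rw [smul_zero, smul_zero]

theorem signIntertwines_lowFactor_zero (h : ∀ j < m, d' j = d j) :
    SignIntertwines d d' (lowFactor m A 0) (lowFactor m (altCoeff A) 0) := fun a b => by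
  rw [lowFactor, lowFactor, Nat.cast_zero, blockElem_zero_apply, blockElem_zero_apply, altCoeff,
    pow_zero, one_smul, h b b.2]
  split_ifs with h1 h2
  · rw [h1]
  · rw [h1]
  · rw [smul_zero, smul_zero]

theorem signIntertwines_highFactor {j : ℕ} (hj : j + 1 < m)
    (h : d (j + 1) = (-1) ^ (m - (j + 1)) * d j) (h₀ : d' j = (-1) ^ (m - (j + 1)) * d j)
    (h₁ : d' (j + 1) = (-1) ^ (m - (j + 1)) * d (j + 1))
    (h₂ : ∀ i < m, i ≠ j → i ≠ j + 1 → d' i = d i) :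
    SignIntertwines d d' (highFactor m A (j + 1)) (highFactor m (altCoeff A) (j + 1)) :=
  fun a b => by
  rw [highFactor, highFactor, blockElem_neg_apply (by omega) (by omega),
    blockElem_neg_apply (by omega) (by omega)]
  have h₃ : d' (j + 1) = d j := by
    rw [h₁, h, ← mul_assoc, Int.units_mul_self, one_mul]
  have hij : m - (m - (j + 1)) = j + 1 := by omega
  rw [hij]
  split_ifs with h1 h2 h3 h4 h5
  · rw [smul_zero, smul_zero]
  · rw [show (a : ℕ) = j by omega, h2.2, h₃]
  · rw [h3.1, show (b : ℕ) = j by omega, h, h₀]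
  · rw [h4.1, h4.2, altCoeff, smul_eq_smul_smul_of_eq h₁]
  · rw [h5, h₂ b b.2 (by rw [h5] at h1; omega) (by rw [h5] at h4; omega)]
  · rw [smul_zero, smul_zero]

theorem signIntertwines_highFactor_zero (hm : 0 < m) (h₀ : d' 0 = (-1) ^ m * d 0)
    (h : ∀ j < m, j ≠ 0 → d' j = d j) :
    SignIntertwines d d' (highFactor m A 0) (highFactor m (altCoeff A) 0) := fun a b => by
  rw [highFactor, highFactor, Nat.sub_zero, blockElem_top_apply hm, blockElem_top_apply hm,
    altCoeff]
  split_ifs with h1 h2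
  · rw [← h1, h2, smul_eq_smul_smul_of_eq h₀]
  · rw [h1, h b b.2 (by rw [← h1]; exact h2)]
  · rw [smul_zero, smul_zero]

theorem neg_one_pow_sub_mul {i : ℕ} (hi : i ≤ m) : (-1 : ℤˣ) ^ (m - i) = (-1) ^ (m + i) := by
  rw [show m + i = m - i + 2 * i by omega, pow_add, pow_mul, neg_one_sq, one_pow, mul_one]

/-- The run `(0:q)`. -/
theorem signIntertwines_range {q : ℕ} (hq : q < m) (h : ∀ j < q, d (j + 1) = -d j)
    (h₀ : ∀ j < q, d' j = -d j) (h₁ : d' q = (-1) ^ (m + q) * d q)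
    (h₂ : ∀ j < m, q < j → d' j = d j) :
    SignIntertwines d d' ((List.range (q + 1)).map (highFactor m A)).prod
      ((List.range (q + 1)).map (highFactor m (altCoeff A))).prod := by
  induction q generalizing d' with
  | zero =>
    simp only [zero_add, List.range_one, List.map_cons, List.map_nil, List.prod_singleton]
    exact signIntertwines_highFactor_zero A hq h₁ fun j hj hj0 => h₂ j hj (by omega)
  | succ q ih =>
    rw [List.range_succ (n := q + 1), List.map_append, List.prod_append, List.map_append,
      List.prod_append]
    simp only [List.map_cons, List.map_nil, List.prod_singleton]
    have hpow : (-1 : ℤˣ) ^ (m - (q + 1)) = -(-1) ^ (m + q) := by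
      rw [neg_one_pow_sub_mul hq.le, ← add_assoc, pow_succ, mul_neg_one]
    have hs : (-1 : ℤˣ) ^ (m + q) * (-1) ^ (m + q) = 1 := Int.units_mul_self _
    -- The intermediate signs are those left after the shorter run, before the factor of offset q +
    -- 1 acts.
    refine (ih (d' := fun j => if j < q then -d j else if j = q then (-1) ^ (m + q) * d j
      else d j) (by omega) (fun j hj => h j (by omega)) (fun j hj => if_pos hj) (by simp)
      fun j _ hj => by rw [if_neg (by omega), if_neg (by omega)]).mul
      (signIntertwines_highFactor A hq ?_ ?_ ?_ ?_)
    · simp only [lt_irrefl, if_false, if_true, if_neg (show ¬ q + 1 < q by omega),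
        if_neg (show ¬ q + 1 = q by omega), hpow, neg_mul, ← mul_assoc, hs, one_mul]
      exact h q (by omega)
    · simp only [lt_irrefl, if_false, if_true, hpow, neg_mul, ← mul_assoc, hs, one_mul]
      exact h₀ q (by omega)
    · simp only [if_neg (show ¬ q + 1 < q by omega), if_neg (show ¬ q + 1 = q by omega)]
      rw [h₁, neg_one_pow_sub_mul hq.le]
    · intro i hi h1 h2
      by_cases hiq : i < q
      · simp only [if_pos hiq]
        exact h₀ i (by omega)
      · simp only [if_neg hiq, if_neg h1]
        exact h₂ i hi (by omega)

/-- Block j is negated by each run ending above j, q − 1 − j in number, and multiplied by (−1)^(m+j)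
in the run ending at j. The total sign (−1)^(m+q+1) does not depend on j. -/
theorem signIntertwines_hankel {q : ℕ} (hq : q ≤ m) (h : ∀ j, j + 1 < q → d (j + 1) = -d j)
    (h₀ : ∀ j < q, d' j = (-1) ^ (m + q + 1) * d j) (h₂ : ∀ j < m, q ≤ j → d' j = d j) :
    SignIntertwines d d' ((hankelTuple q).map (highFactor m A)).prod
      ((hankelTuple q).map (highFactor m (altCoeff A))).prod := by
  induction q generalizing d with
  | zero => exact signIntertwines_one fun j hj => h₂ j hj (by omega)
  | succ q ih =>
    rw [hankelTuple, List.map_append, List.prod_append, List.map_append, List.prod_append]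
    have hpow : (-1 : ℤˣ) ^ (m + (q + 1) + 1) = (-1) ^ (m + q) := by
      rw [show m + (q + 1) + 1 = m + q + 2 by omega, pow_add, neg_one_sq, mul_one]
    rw [hpow] at h₀
    refine (signIntertwines_range A (d' := fun j => if j < q then -d j else d' j) (by omega)
      (fun j hj => h j (by omega)) (fun j hj => if_pos hj) ?_ fun j hjm hj => ?_).mul
      (ih (by omega) (fun j hj => ?_) (fun j hj => ?_) fun j hjm hj => ?_)
    · simp only [lt_irrefl, if_false]
      exact h₀ q (by omega)
    · simp only [if_neg (show ¬ j < q by omega)]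
      exact h₂ j hjm (by omega)
    · simp only [if_pos hj, if_pos (show j < q by omega), h j (by omega)]
    · simp only [if_pos hj]
      rw [h₀ j (by omega), pow_succ, mul_neg_one, neg_mul_neg]
    · simp only [if_neg (show ¬ j < q by omega)]

theorem neg_one_pow_eq_one {i : ℕ} (h : i % 2 = 0) : (-1 : ℤˣ) ^ i = 1 :=
  (Nat.even_iff.2 h).neg_one_pow

theorem neg_one_pow_eq_neg_one {i : ℕ} (h : i % 2 = 1) : (-1 : ℤˣ) ^ i = -1 :=
  (Nat.odd_iff.2 h).neg_one_pow

variable {e p s : ℕ}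

/-- As m − p is odd, the offsets p + 2t + 1 carry coefficients of even index and those p + 2t + 2
coefficients of odd index. Hence neighbouring signs must be equal in the first case, and opposite,
with both flipped, in the second. -/
theorem signIntertwines_admTuple (hm : p + 2 * s < m) (hp : (m + p) % 2 = 1)
    (h : ∀ j < p, d (j + 1) = -d j) (ho : ∀ t < s, d (p + 2 * t + 1) = d (p + 2 * t))
    (he : ∀ t < s, d (p + 2 * t + 2) = -d (p + 2 * t + 1))
    (h₀ : ∀ j ≤ p + 2 * s, d' j = -d j) (h₂ : ∀ j < m, p + 2 * s < j → d' j = d j) :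
    SignIntertwines d d' ((admTuple p s).map (highFactor m A)).prod
      ((admTuple p s).map (highFactor m (altCoeff A))).prod := by
  induction s generalizing d with
  | zero =>
    refine signIntertwines_range A hm h (fun j hj => h₀ j (by omega)) ?_ h₂
    rw [neg_one_pow_eq_neg_one hp, neg_one_mul]
    exact h₀ p (by omega)
  | succ s ih =>
    rw [admTuple, List.map_cons, List.map_cons, List.prod_cons, List.prod_cons, List.map_cons,
      List.map_cons, List.prod_cons, List.prod_cons]
    have h1 : (-1 : ℤˣ) ^ (m - (p + 2 * s + 1)) = 1 := neg_one_pow_eq_one (by omega)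
    have h2 : (-1 : ℤˣ) ^ (m - (p + 2 * s + 1 + 1)) = -1 := neg_one_pow_eq_neg_one (by omega)
    -- The first factor keeps all signs, the second flips blocks p + 2s + 1 and p + 2s + 2, and the
    -- shorter tuple flips the others.
    refine (signIntertwines_highFactor A (d' := d) (by omega) ?_ ?_ ?_ fun _ _ _ _ => rfl).mul
      ((signIntertwines_highFactor A (j := p + 2 * s + 1)
        (d' := fun j => if j ≤ p + 2 * s then d j else d' j) (by omega) ?_ ?_ ?_ ?_).mul
      (ih (by omega) (fun j hj => ?_) (fun t ht => ?_) (fun t ht => ?_) (fun j hj => ?_)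
        fun j hjm hj => ?_))
    · rw [h1, one_mul, ho s (by omega)]
    · rw [h1, one_mul]
    · rw [h1, one_mul]
    · rw [h2, neg_one_mul, he s (by omega)]
    · rw [h2, neg_one_mul, if_neg (by omega), h₀ _ (by omega)]
    · rw [h2, neg_one_mul, if_neg (by omega), h₀ _ (by omega)]
    · intro i hi h3 h4
      split_ifs with h5
      · rfl
      · exact h₂ i hi (by omega)
    · simp only [if_pos (show j + 1 ≤ p + 2 * s by omega), if_pos (show j ≤ p + 2 * s by omega)]
      exact h j hj
    · simp only [if_pos (show p + 2 * t + 1 ≤ p + 2 * s by omega),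
        if_pos (show p + 2 * t ≤ p + 2 * s by omega)]
      exact ho t (by omega)
    · simp only [if_pos (show p + 2 * t + 2 ≤ p + 2 * s by omega),
        if_pos (show p + 2 * t + 1 ≤ p + 2 * s by omega)]
      exact he t (by omega)
    · simp only [if_pos hj]
      exact h₀ j (by omega)
    · simp only [if_neg (show ¬ j ≤ p + 2 * s by omega)]

theorem signIntertwines_admCompl (hm : p + 2 * s < m) (hp : (m + p) % 2 = 1)
    (h : ∀ j < p, d (j + 1) = -d j) (ho : ∀ t < s, d (p + 2 * t + 1) = d (p + 2 * t)) :
    SignIntertwines d d ((admCompl p s).map (highFactor m A)).prod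
      ((admCompl p s).map (highFactor m (altCoeff A))).prod := by
  induction s with
  | zero =>
    refine signIntertwines_hankel A (by omega) (fun j hj => h j (by omega)) (fun j hj => ?_)
      fun _ _ _ => rfl
    rw [neg_one_pow_eq_one (by omega), one_mul]
  | succ s ih =>
    rw [admCompl, List.map_cons, List.prod_cons, List.map_cons, List.prod_cons]
    have h1 : (-1 : ℤˣ) ^ (m - (p + 2 * s + 1)) = 1 := neg_one_pow_eq_one (by omega)
    refine (signIntertwines_highFactor A (by omega) ?_ ?_ ?_ fun _ _ _ _ => rfl).mul
      (ih (by omega) fun t ht => ho t (by omega))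
    · rw [h1, one_mul, ho s (by omega)]
    · rw [h1, one_mul]
    · rw [h1, one_mul]

/-- The complement consists of odd indices, each flipping its own pair of blocks; the pairs are
disjoint and fill the last 2e blocks. -/
theorem signIntertwines_admCompl_low (hm : 2 * e < m)
    (h : ∀ t < e, d (m - 2 * t - 1) = -d (m - 2 * t - 2))
    (h₀ : ∀ j < m, m - 2 * e ≤ j → d' j = -d j) (h₂ : ∀ j < m - 2 * e, d' j = d j) :
    SignIntertwines d d' ((admCompl 0 e).map (lowFactor m A)).prod
      ((admCompl 0 e).map (lowFactor m (altCoeff A))).prod := by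
  induction e generalizing d with
  | zero => exact signIntertwines_one fun j hj => h₂ j (by omega)
  | succ e ih =>
    rw [admCompl, List.map_cons, List.prod_cons, List.map_cons, List.prod_cons, Nat.zero_add]
    have h1 : (-1 : ℤˣ) ^ (2 * e + 1) = -1 := neg_one_pow_eq_neg_one (by omega)
    refine (signIntertwines_lowFactor A (i := 2 * e + 1)
      (d' := fun j => if j < m - 2 * e then d' j else d j) (by omega) (by omega) ?_ ?_ ?_ ?_).mul
      (ih (by omega) (fun t ht => ?_) (fun j hjm hj => ?_) fun j hj => ?_)
    · rw [h1, neg_one_mul]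
      exact h e (by omega)
    · rw [h1, neg_one_mul, if_pos (by omega), h₀ _ (by omega) (by omega)]
    · rw [h1, neg_one_mul, if_pos (by omega), h₀ _ (by omega) (by omega)]
    · intro i hi h3 h4
      split_ifs with h5
      · exact h₂ i (by omega)
      · rfl
    · simp only [if_neg (show ¬ m - 2 * t - 1 < m - 2 * e by omega),
        if_neg (show ¬ m - 2 * t - 2 < m - 2 * e by omega)]
      exact h t (by omega)
    · simp only [if_neg (show ¬ j < m - 2 * e by omega)]
      exact h₀ j hjm (by omega)
    · simp only [if_pos hj]

/-- An odd index flips its pair of blocks. The following even index needs equal signs on its own two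
blocks, one of which has just been flipped; this is why `ht` asks for opposite signs. -/
theorem signIntertwines_admTuple_low (hm : 2 * e < m)
    (h : ∀ t < e, d (m - 2 * t - 1) = -d (m - 2 * t - 2))
    (hi : ∀ t, t + 1 < e → d (m - 2 * t - 3) = d (m - 2 * t - 2))
    (ht : 0 < e → d (m - 2 * e - 1) = -d (m - 2 * e))
    (h₀ : ∀ j < m, m - 2 * e ≤ j → d' j = -d j) (h₂ : ∀ j < m - 2 * e, d' j = d j) :
    SignIntertwines d d' ((admTuple 0 e).map (lowFactor m A)).prod
      ((admTuple 0 e).map (lowFactor m (altCoeff A))).prod := by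
  induction e generalizing d with
  | zero =>
    simp only [admTuple, zero_add, List.range_one, List.map_cons, List.map_nil,
      List.prod_singleton]
    exact signIntertwines_lowFactor_zero A fun j hj => h₂ j (by omega)
  | succ e ih =>
    rw [admTuple, List.map_cons, List.map_cons, List.prod_cons, List.prod_cons, List.map_cons,
      List.map_cons, List.prod_cons, List.prod_cons, Nat.zero_add]
    have h1 : (-1 : ℤˣ) ^ (2 * e + 1) = -1 := neg_one_pow_eq_neg_one (by omega)
    have h1' : (-1 : ℤˣ) ^ (2 * e + 2) = 1 := neg_one_pow_eq_one (by omega)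
    have hne : m - (2 * e + 2) < m - 2 * e := by omega
    have hne' : m - (2 * e + 2) - 1 < m - 2 * e := by omega
    have hS : SignIntertwines (fun j => if j < m - 2 * e then d' j else d j)
        (fun j => if j < m - 2 * e then d' j else d j)
        (lowFactor m A (2 * e + 2)) (lowFactor m (altCoeff A) (2 * e + 2)) := by
      refine signIntertwines_lowFactor A (by omega) (by omega) ?_ ?_ ?_ fun _ _ _ _ => rfl
      · rw [h1', one_mul, if_pos hne, if_pos hne', h₀ _ (by omega) (by omega), h₂ _ (by omega)]
        exact (ht (by omega)).symm
      · rw [h1', one_mul]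
      · rw [h1', one_mul]
    refine (signIntertwines_lowFactor A (i := 2 * e + 1)
      (d' := fun j => if j < m - 2 * e then d' j else d j) (by omega) (by omega) ?_ ?_ ?_ ?_).mul
      (hS.mul (ih (by omega) (fun t ht => ?_) (fun t ht => ?_) (fun h0 => ?_) (fun j hjm hj => ?_)
        fun j hj => ?_))
    · rw [h1, neg_one_mul]
      exact h e (by omega)
    · rw [h1, neg_one_mul, if_pos (by omega), h₀ _ (by omega) (by omega)]
    · rw [h1, neg_one_mul, if_pos (by omega), h₀ _ (by omega) (by omega)]
    · intro i hi h3 h4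
      split_ifs with h5
      · exact h₂ i (by omega)
      · rfl
    · simp only [if_neg (show ¬ m - 2 * t - 1 < m - 2 * e by omega),
        if_neg (show ¬ m - 2 * t - 2 < m - 2 * e by omega)]
      exact h t (by omega)
    · simp only [if_neg (show ¬ m - 2 * t - 3 < m - 2 * e by omega),
        if_neg (show ¬ m - 2 * t - 2 < m - 2 * e by omega)]
      exact hi t (by omega)
    · simp only [if_neg (show ¬ m - 2 * e < m - 2 * e by omega),
        if_pos (show m - 2 * e - 1 < m - 2 * e by omega)]
      rw [h₀ _ (by omega) (by omega)]
      have := hi (e - 1) (by omega)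
      rw [show m - 2 * (e - 1) - 3 = m - 2 * e - 1 by omega,
        show m - 2 * (e - 1) - 2 = m - 2 * e by omega] at this
      rw [this]
    · simp only [if_neg (show ¬ j < m - 2 * e by omega)]
      exact h₀ j hjm (by omega)
    · simp only [if_pos hj]

/-- The relations between consecutive signs of the quasi-identity matrix. -/
structure IsSignPattern (m e p s : ℕ) (d : ℕ → ℤˣ) : Prop where
  alternating : ∀ j < p, d (j + 1) = -d j
  odd_high : ∀ t < s, d (p + 2 * t + 1) = d (p + 2 * t)
  even_high : ∀ t < s, d (p + 2 * t + 2) = -d (p + 2 * t + 1)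
  middle : 0 < e → d (p + 2 * s + 1) = -d (p + 2 * s)
  odd_low : ∀ t < e, d (m - 2 * t - 1) = -d (m - 2 * t - 2)
  even_low : ∀ t, t + 1 < e → d (m - 2 * t - 3) = d (m - 2 * t - 2)

/-- Each condition fixes the ratio of one pair of consecutive signs, and no pair is addressed twice.
The signs are the partial products of the prescribed ratios `ρ`. -/
theorem exists_isSignPattern (hm : m = 2 * e + 1 + (p + 2 * s)) : ∃ d, IsSignPattern m e p s d := by
  set ρ : ℕ → ℤˣ := fun j => if j < p then -1 else if j < p + 2 * s then
    (if (j - p) % 2 = 0 then 1 else -1) else if j = p + 2 * s then -1 else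
    (if (m - j) % 2 = 0 then -1 else 1) with hρ
  refine ⟨fun j => ∏ i ∈ Finset.range j, ρ i, ⟨fun j hj => ?_, fun t ht => ?_, fun t ht => ?_,
    fun he => ?_, fun t ht => ?_, fun t ht => ?_⟩⟩
  · rw [Finset.prod_range_succ, hρ]
    simp only [if_pos hj, mul_neg_one]
  · rw [Finset.prod_range_succ]
    have : ρ (p + 2 * t) = 1 := by
      simp only [hρ]
      rw [if_neg (by omega), if_pos (by omega), if_pos (by omega)]
    rw [this, mul_one]
  · rw [Finset.prod_range_succ]
    have : ρ (p + 2 * t + 1) = -1 := by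
      simp only [hρ]
      rw [if_neg (by omega), if_pos (by omega), if_neg (by omega)]
    rw [this, mul_neg_one]
  · rw [Finset.prod_range_succ]
    have : ρ (p + 2 * s) = -1 := by
      simp only [hρ]
      rw [if_neg (by omega), if_neg (by omega), if_pos trivial]
    rw [this, mul_neg_one]
  · rw [show m - 2 * t - 1 = m - 2 * t - 2 + 1 by omega, Finset.prod_range_succ]
    have : ρ (m - 2 * t - 2) = -1 := by
      simp only [hρ]
      rw [if_neg (by omega), if_neg (by omega), if_neg (by omega), if_pos (by omega)]
    rw [this, mul_neg_one]
  · rw [show m - 2 * t - 2 = m - 2 * t - 3 + 1 by omega, Finset.prod_range_succ]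
    have : ρ (m - 2 * t - 3) = 1 := by
      simp only [hρ]
      rw [if_neg (by omega), if_neg (by omega), if_neg (by omega), if_neg (by omega)]
    rw [this, mul_one]

/-- z flips the blocks up to p + 2s, c_w flips the remaining ones, and c_z changes nothing. The
overall flip is the skew-symmetry required of the coefficient of λ. -/
theorem IsSignPattern.leadBlock (hd : IsSignPattern m e p s d)
    (hm : m = 2 * e + 1 + (p + 2 * s)) :
    SignIntertwines d (-d) (leadBlock m e p s A) (leadBlock m e p s (altCoeff A)) := by
  refine ((signIntertwines_admTuple A (d' := fun j => if j ≤ p + 2 * s then -d j else d j)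
    (by omega) (by omega) hd.alternating hd.odd_high hd.even_high (fun j hj => if_pos hj)
    fun j _ hj => if_neg (by omega)).mul
    (signIntertwines_admCompl_low A (d' := -d) (by omega) (fun t ht => ?_) (fun j hj h1 => ?_)
      fun j hj => ?_)).mul (signIntertwines_admCompl A (by omega) (by omega) (fun j hj => ?_)
      fun t ht => ?_)
  · rw [if_neg (by omega), if_neg (by omega)]
    exact hd.odd_low t ht
  · rw [if_neg (by omega), Pi.neg_apply]
  · rw [if_pos (by omega), Pi.neg_apply]
  · rw [Pi.neg_apply, Pi.neg_apply, hd.alternating j hj]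
  · rw [Pi.neg_apply, Pi.neg_apply, hd.odd_high t ht]

/-- w flips the last 2e blocks and c_w flips them back, so the constant coefficient becomes
symmetric. -/
theorem IsSignPattern.constBlock (hd : IsSignPattern m e p s d)
    (hm : m = 2 * e + 1 + (p + 2 * s)) :
    SignIntertwines d d (constBlock m e p s A) (constBlock m e p s (altCoeff A)) := by
  refine ((signIntertwines_admTuple_low A (d' := fun j => if j < m - 2 * e then d j else -d j)
    (by omega) hd.odd_low hd.even_low (fun h0 => ?_) (fun j hj h1 => if_neg (by omega))
    fun j hj => if_pos hj).mul
    (signIntertwines_admCompl_low A (d' := d) (by omega) (fun t ht => ?_) (fun j hj h1 => ?_)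
      fun j hj => ?_)).mul (signIntertwines_admCompl A (by omega) (by omega) hd.alternating
      hd.odd_high)
  · have := hd.middle h0
    rw [show m - 2 * e - 1 = p + 2 * s by omega, show m - 2 * e = p + 2 * s + 1 by omega, this,
      neg_neg]
  · rw [if_neg (by omega), if_neg (by omega), hd.odd_low t ht]
  · rw [if_neg (by omega), neg_neg]
  · rw [if_pos (by omega)]

end Signs

/-! ### Transposes of Fiedler products -/

section Transpose

variable {m n : ℕ}

/-- The transpose of a block matrix. -/
def blockTranspose (M : Matrix (Fin m) (Fin m) (Matrix (Fin n) (Fin n) ℂ)) :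
    Matrix (Fin m) (Fin m) (Matrix (Fin n) (Fin n) ℂ) := Matrix.of fun a b => (M b a)ᵀ

theorem comp_blockTranspose (M : Matrix (Fin m) (Fin m) (Matrix (Fin n) (Fin n) ℂ)) :
    Matrix.comp _ _ _ _ ℂ (blockTranspose M) = (Matrix.comp _ _ _ _ ℂ M)ᵀ := rfl

theorem blockTranspose_mul (M N : Matrix (Fin m) (Fin m) (Matrix (Fin n) (Fin n) ℂ)) :
    blockTranspose (M * N) = blockTranspose N * blockTranspose M := by
  apply (Matrix.compRingEquiv (Fin m) (Fin n) ℂ).injective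
  change Matrix.comp _ _ _ _ ℂ _ = Matrix.comp _ _ _ _ ℂ _
  rw [comp_mul, comp_blockTranspose, comp_blockTranspose, comp_blockTranspose, comp_mul,
    Matrix.transpose_mul]

theorem blockTranspose_one :
    blockTranspose (1 : Matrix (Fin m) (Fin m) (Matrix (Fin n) (Fin n) ℂ)) = 1 := by
  refine Matrix.ext fun a b => ?_
  rw [blockTranspose, Matrix.of_apply, Matrix.one_apply, Matrix.one_apply]
  simp only [eq_comm (a := b)]
  split_ifs <;> simp

theorem blockTranspose_list_prod {ι : Type*}
    (g : ι → Matrix (Fin m) (Fin m) (Matrix (Fin n) (Fin n) ℂ)) (t : List ι) :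
    blockTranspose (t.map g).prod = (t.reverse.map fun i => blockTranspose (g i)).prod := by
  induction t with
  | nil => exact blockTranspose_one
  | cons i t ih =>
    rw [List.map_cons, List.prod_cons, blockTranspose_mul, ih, List.reverse_cons, List.map_append,
      List.prod_append, List.map_cons, List.map_nil, List.prod_singleton]

theorem blockTranspose_lowFactor {A : ℕ → Matrix (Fin n) (Fin n) ℂ} {i : ℕ}
    (hA : (A i)ᵀ = altCoeff A i) :
    blockTranspose (lowFactor m A i) = lowFactor m (altCoeff A) i := by
  refine Matrix.ext fun a b => ?_
  rw [blockTranspose, Matrix.of_apply, lowFactor, lowFactor]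
  rcases Nat.eq_zero_or_pos i with rfl | hi0
  · rw [Nat.cast_zero, blockElem_zero_apply, blockElem_zero_apply, ← hA]
    split_ifs <;> first | (exfalso; omega) | simp
  · rw [blockElem_pos_apply hi0, blockElem_pos_apply hi0, ← hA]
    split_ifs <;> first | (exfalso; omega) | simp

theorem blockTranspose_highFactor {A : ℕ → Matrix (Fin n) (Fin n) ℂ} {j : ℕ} (hj : j < m)
    (hA : (A (m - j))ᵀ = altCoeff A (m - j)) :
    blockTranspose (highFactor m A j) = highFactor m (altCoeff A) j := by
  refine Matrix.ext fun a b => ?_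
  rw [blockTranspose, Matrix.of_apply, highFactor, highFactor]
  rcases Nat.eq_zero_or_pos j with rfl | hj0
  · rw [Nat.sub_zero] at hA ⊢
    rw [blockElem_top_apply hj, blockElem_top_apply hj, ← hA]
    split_ifs <;> first | (exfalso; omega) | simp
  · rw [blockElem_neg_apply (by omega) (by omega), blockElem_neg_apply (by omega) (by omega), ← hA]
    split_ifs <;> first | (exfalso; omega) | simp

theorem blockTranspose_prod_low {A : ℕ → Matrix (Fin n) (Fin n) ℂ} (hA : ∀ i, (A i)ᵀ = altCoeff A i)
    (t : List ℕ) : blockTranspose (t.map (lowFactor m A)).prod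
      = (t.reverse.map (lowFactor m (altCoeff A))).prod := by
  rw [blockTranspose_list_prod]
  exact congrArg List.prod (List.map_congr_left fun i _ => blockTranspose_lowFactor (hA i))

theorem blockTranspose_prod_high {A : ℕ → Matrix (Fin n) (Fin n) ℂ}
    (hA : ∀ i, (A i)ᵀ = altCoeff A i) (t : List ℕ) (ht : ∀ j ∈ t, j < m) :
    blockTranspose (t.map (highFactor m A)).prod
      = (t.reverse.map (highFactor m (altCoeff A))).prod := by
  rw [blockTranspose_list_prod]
  exact congrArg List.prod (List.map_congr_left fun j hj =>
    blockTranspose_highFactor (ht j (List.mem_reverse.1 hj)) (hA _))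

theorem commute_prod_low_high {S : Type*} [Ring S] (A : ℕ → S) {t u : List ℕ}
    (h : ∀ i ∈ t, ∀ j ∈ u, i + j + 2 ≤ m) :
    Commute (t.map (lowFactor m A)).prod (u.map (highFactor m A)).prod :=
  commute_prod_map _ _ _ fun j hj => (commute_prod_map _ _ _ fun i hi =>
    (commute_lowFactor_highFactor A (h i hi j hj)).symm).symm

variable {e p s : ℕ} {A : ℕ → Matrix (Fin n) (Fin n) ℂ}

/-- The reversed product is c_z c_w z reversed, c_z and c_w being palindromes. Since c_w commutes
with both z and c_z, the palindrome (z, c_z) can be reassembled around it. -/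
theorem blockTranspose_leadBlock (hm : m = 2 * e + 1 + (p + 2 * s))
    (hA : ∀ i, (A i)ᵀ = altCoeff A i) :
    blockTranspose (leadBlock m e p s A) = leadBlock m e p s (altCoeff A) := by
  have hlow : ∀ i j, j ≤ 0 + 2 * e → i + 2 ≤ j →
      Commute (lowFactor m (altCoeff A) i) (lowFactor m (altCoeff A) j) :=
    fun i j hj hij => commute_lowFactor _ (by omega) hij
  have hhigh : ∀ i j, j ≤ p + 2 * s → i + 2 ≤ j →
      Commute (highFactor m (altCoeff A) i) (highFactor m (altCoeff A) j) :=
    fun i j hj hij => commute_highFactor _ (by omega) hij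
  have hz := prod_reverse_admTuple_append _ hhigh
  have hcz := prod_reverse_admCompl _ hhigh
  have hc : Commute ((admCompl 0 e).map (lowFactor m (altCoeff A))).prod
      ((admCompl p s).map (highFactor m (altCoeff A))).prod :=
    commute_prod_low_high _ fun i hi j hj => by
      have := lt_of_mem_admCompl hi
      have := lt_of_mem_admCompl hj
      omega
  have hc' : Commute ((admCompl 0 e).map (lowFactor m (altCoeff A))).prod
      ((admTuple p s).map (highFactor m (altCoeff A))).prod :=
    commute_prod_low_high _ fun i hi j hj => by
      have := lt_of_mem_admCompl hi
      have := mem_admTuple.1 hj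
      omega
  rw [leadBlock, leadBlock, blockTranspose_mul, blockTranspose_mul, blockTranspose_prod_low hA,
    blockTranspose_prod_high hA, blockTranspose_prod_high hA, hcz, prod_reverse_admCompl _ hlow]
  · rw [List.reverse_append, List.map_append, List.prod_append, List.map_append, List.prod_append,
      hcz] at hz
    rw [← mul_assoc, ← hc.eq, mul_assoc, hz, ← mul_assoc, hc'.eq]
  · intro j hj
    have := mem_admTuple.1 hj
    omega
  · intro j hj
    have := lt_of_mem_admCompl hj
    omega

theorem blockTranspose_constBlock (hm : m = 2 * e + 1 + (p + 2 * s))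
    (hA : ∀ i, (A i)ᵀ = altCoeff A i) :
    blockTranspose (constBlock m e p s A) = constBlock m e p s (altCoeff A) := by
  have hlow : ∀ i j, j ≤ 0 + 2 * e → i + 2 ≤ j →
      Commute (lowFactor m (altCoeff A) i) (lowFactor m (altCoeff A) j) :=
    fun i j hj hij => commute_lowFactor _ (by omega) hij
  have hhigh : ∀ i j, j ≤ p + 2 * s → i + 2 ≤ j →
      Commute (highFactor m (altCoeff A) i) (highFactor m (altCoeff A) j) :=
    fun i j hj hij => commute_highFactor _ (by omega) hij
  have hw := prod_reverse_admTuple_append _ hlow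
  have hcw := prod_reverse_admCompl _ hlow
  have hc : Commute ((admTuple 0 e ++ admCompl 0 e).map (lowFactor m (altCoeff A))).prod
      ((admCompl p s).map (highFactor m (altCoeff A))).prod :=
    commute_prod_low_high _ fun i hi j hj => by
      have : i ≤ 0 + 2 * e := by
        rcases List.mem_append.1 hi with hi | hi
        · exact mem_admTuple.1 hi
        · exact (lt_of_mem_admCompl hi).le
      have := lt_of_mem_admCompl hj
      omega
  rw [constBlock, constBlock, blockTranspose_mul, blockTranspose_mul, blockTranspose_prod_low hA,
    blockTranspose_prod_low hA, blockTranspose_prod_high hA, prod_reverse_admCompl _ hhigh]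
  · rw [List.reverse_append, List.map_append, List.prod_append] at hw
    rw [hw, ← hc.eq, List.map_append, List.prod_append]
  · intro j hj
    have := lt_of_mem_admCompl hj
    omega

end Transpose

/-! ### `T`-even pencils -/

section TEven

variable {ι : Type}

theorem isTEven_iff {P : Matrix ι ι ℂ[X]} :
    IsTEven P ↔ ∀ k, (coeffMat P k)ᵀ = (-1 : ℤˣ) ^ k • coeffMat P k := by
  have hcoeff : ∀ (q : ℂ[X]) k, (q.comp (-Polynomial.X)).coeff k = (-1) ^ k * q.coeff k :=
    fun q k => by
    have h : -Polynomial.X = Polynomial.C (-1 : ℂ) * Polynomial.X := by simp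
    rw [h, Polynomial.comp_C_mul_X_coeff, mul_comm]
  have hsmul : ∀ (k : ℕ) (x : ℂ), (-1 : ℤˣ) ^ k • x = (-1) ^ k * x := fun k x => by
    rw [Units.smul_def, zsmul_eq_mul]
    simp
  have hsq : ∀ k : ℕ, (-1 : ℂ) ^ k * (-1) ^ k = 1 := fun k => by
    rw [← mul_pow, neg_mul_neg, one_mul, one_pow]
  constructor
  · intro h k
    refine Matrix.ext fun a b => ?_
    have := congrArg (fun q : ℂ[X] => q.coeff k) (congrFun (congrFun h a) b)
    simp only [Matrix.transpose_apply, Matrix.map_apply, hcoeff] at this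
    rw [Matrix.transpose_apply, Matrix.smul_apply, hsmul, coeffMat, Matrix.map_apply,
      Matrix.map_apply, ← this, ← mul_assoc, hsq, one_mul]
  · intro h
    refine Matrix.ext fun a b => Polynomial.ext fun k => ?_
    have := congrFun (congrFun (h k) a) b
    rw [Matrix.transpose_apply, Matrix.smul_apply, hsmul, coeffMat, Matrix.map_apply,
      Matrix.map_apply] at this
    rw [Matrix.transpose_apply, Matrix.map_apply, hcoeff, this, ← mul_assoc, hsq, one_mul]

/-- By comparison of coefficients: degree one changes sign under λ ↦ −λ, degree zero does not, and
the others vanish. -/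
theorem isTEven_pencil_iff {M N : Matrix ι ι ℂ} :
    IsTEven ((Polynomial.X : ℂ[X]) • toPoly M - toPoly N) ↔ Mᵀ = -M ∧ Nᵀ = N := by
  have h₀ : coeffMat ((Polynomial.X : ℂ[X]) • toPoly M - toPoly N) 0 = -N := by
    ext; simp [coeffMat, toPoly]
  have h₁ : coeffMat ((Polynomial.X : ℂ[X]) • toPoly M - toPoly N) 1 = M := by
    ext; simp [coeffMat, toPoly, Polynomial.coeff_C]
  have h₂ : ∀ k, coeffMat ((Polynomial.X : ℂ[X]) • toPoly M - toPoly N) (k + 2) = 0 := fun k => by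
    ext; simp [coeffMat, toPoly]
  rw [isTEven_iff]
  constructor
  · intro h
    have h0 := h 0
    have h1 := h 1
    rw [h₀, pow_zero, one_smul, Matrix.transpose_neg, neg_inj] at h0
    rw [h₁, pow_one, Units.neg_smul, one_smul] at h1
    exact ⟨h1, h0⟩
  · rintro ⟨hM, hN⟩ k
    rcases k with _ | _ | k
    · rw [h₀, pow_zero, one_smul, Matrix.transpose_neg, hN]
    · rw [zero_add, h₁, pow_one, Units.neg_smul, one_smul, hM]
    · rw [h₂, Matrix.transpose_zero, smul_zero]

variable {m e p s n : ℕ}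

theorem isTEven_quasiIdentity_mul_pencilL_iff (hm : m = 2 * e + 1 + (p + 2 * s))
    (P : Matrix (Fin n) (Fin n) ℂ[X]) (ε : Fin m → ℤˣ) :
    IsTEven (toPoly (quasiIdentity n ε) * pencilL m (2 * e) p P) ↔
      (∀ a b, ε a • (leadBlock m e p s (coeffMat P) a b)ᵀ
        = -(ε b • leadBlock m e p s (coeffMat P) b a)) ∧
      ∀ a b, ε a • (constBlock m e p s (coeffMat P) a b)ᵀ
        = ε b • constBlock m e p s (coeffMat P) b a := by
  have hQ : ∀ (M : Matrix (Fin m) (Fin m) (Matrix (Fin n) (Fin n) ℂ)) (a b : Fin m) (α β : Fin n),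
      (quasiIdentity n ε * Matrix.comp _ _ _ _ ℂ M) (a, α) (b, β) = ε a • M a b α β :=
    fun M a b α β => by
    rw [quasiIdentity, Matrix.diagonal_mul, Units.smul_def, zsmul_eq_mul]
    rfl
  rw [pencilL_eq hm, mul_sub, Matrix.mul_smul, ← toPoly_mul, ← toPoly_mul, isTEven_pencil_iff]
  refine and_congr ⟨fun h a b => Matrix.ext fun β α => ?_, fun h => ?_⟩
    ⟨fun h a b => Matrix.ext fun β α => ?_, fun h => ?_⟩
  · have := congrFun (congrFun h (b, β)) (a, α)
    rw [Matrix.transpose_apply, Matrix.neg_apply, hQ, hQ] at this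
    exact this
  · refine Matrix.ext fun x y => ?_
    obtain ⟨b, β⟩ := x
    obtain ⟨a, α⟩ := y
    rw [Matrix.transpose_apply, Matrix.neg_apply, hQ, hQ]
    exact congrFun (congrFun (h a b) β) α
  · have := congrFun (congrFun h (b, β)) (a, α)
    rw [Matrix.transpose_apply, hQ, hQ] at this
    exact this
  · refine Matrix.ext fun x y => ?_
    obtain ⟨b, β⟩ := x
    obtain ⟨a, α⟩ := y
    rw [Matrix.transpose_apply, hQ, hQ]
    exact congrFun (congrFun (h a b) β) α

/-- The sign pattern makes `Q L(λ)` a `T`-even pencil. -/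
theorem IsSignPattern.isTEven {d : ℕ → ℤˣ} (hd : IsSignPattern m e p s d)
    (hm : m = 2 * e + 1 + (p + 2 * s)) {P : Matrix (Fin n) (Fin n) ℂ[X]} (hP : IsTEven P) :
    IsTEven (toPoly (quasiIdentity n fun a : Fin m => d a) * pencilL m (2 * e) p P) := by
  have hA : ∀ i, (coeffMat P i)ᵀ = altCoeff (coeffMat P) i := isTEven_iff.1 hP
  rw [isTEven_quasiIdentity_mul_pencilL_iff hm]
  constructor
  · intro a b
    have h := hd.leadBlock (coeffMat P) hm b a
    rw [← blockTranspose_leadBlock hm hA, blockTranspose, Matrix.of_apply, Pi.neg_apply,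
      Units.neg_smul] at h
    rw [h, neg_neg]
  · intro a b
    have h := hd.constBlock (coeffMat P) hm b a
    rw [← blockTranspose_constBlock hm hA, blockTranspose, Matrix.of_apply] at h
    rw [h]

end TEven

/-! ### Nonzero blocks of the coefficients of `L(λ)` -/

section Rows

variable {S : Type*} [Ring S] {m : ℕ} (A : ℕ → S)

theorem supportedOn_prod_range {q : ℕ} (hq : q < m) :
    SupportedOn 0 q ((List.range (q + 1)).map (highFactor m A)).prod :=
  SupportedOn.list_prod _ _ fun i hi => by
    have := List.mem_range.1 hi
    exact (supportedOn_highFactor A (by omega)).mono (by omega) (by omega)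

theorem supportedOn_prod_hankel {q : ℕ} (hq : q ≤ m) :
    SupportedOn 0 (q - 1) ((hankelTuple q).map (highFactor m A)).prod :=
  SupportedOn.list_prod _ _ fun i hi => by
    have := lt_of_mem_hankelTuple hi
    exact (supportedOn_highFactor A (by omega)).mono (by omega) (by omega)

theorem vecMul_prod_hankel_of_le {q j : ℕ} (hq : q ≤ j) (hj : j < m) :
    basisVec m S j ᵥ* ((hankelTuple q).map (highFactor m A)).prod = basisVec m S j := by
  rcases Nat.eq_zero_or_pos q with rfl | hq0
  · simp [hankelTuple]
  · exact (supportedOn_prod_hankel A (by omega)).vecMul hj (by omega)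

theorem vecMul_prod_range_zero {q : ℕ} (hq : q < m) :
    basisVec m S 0 ᵥ* ((List.range (q + 1)).map (highFactor m A)).prod
      = A m • basisVec m S q := by
  induction q with
  | zero => simpa using vecMul_highFactor_zero A hq
  | succ q ih =>
    rw [List.range_succ, List.map_append, List.prod_append, ← Matrix.vecMul_vecMul, ih (by omega),
      Matrix.smul_vecMul]
    simp only [List.map_cons, List.map_nil, List.prod_singleton]
    rw [vecMul_highFactor A hq]

theorem vecMul_prod_range_succ {q b : ℕ} (hq : q < m) (hb : b < q) :
    basisVec m S (b + 1) ᵥ* ((List.range (q + 1)).map (highFactor m A)).prod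
      = basisVec m S b + A (m - (b + 1)) • basisVec m S q := by
  induction q with
  | zero => omega
  | succ q ih =>
    rw [List.range_succ, List.map_append, List.prod_append, ← Matrix.vecMul_vecMul]
    simp only [List.map_cons, List.map_nil, List.prod_singleton]
    rcases (Nat.lt_succ_iff.1 hb).eq_or_lt with rfl | hbq
    · rw [(supportedOn_prod_range A (by omega)).vecMul hq (by omega), vecMul_highFactor_succ A hq]
    · rw [ih (by omega) hbq, Matrix.add_vecMul, Matrix.smul_vecMul, vecMul_highFactor A hq,
        (supportedOn_highFactor A hq).vecMul (by omega) (by omega)]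

/-- The block Hankel structure of the product over `(0:q-1, …, 0:1, 0)`. -/
theorem vecMul_prod_hankel_apply {q b : ℕ} (hq : q ≤ m) (hb : b < q) (c : Fin m)
    (hc : (c : ℕ) = q - 1 - b) :
    (basisVec m S b ᵥ* ((hankelTuple q).map (highFactor m A)).prod) c = A m := by
  induction q generalizing b with
  | zero => omega
  | succ q ih =>
    rw [hankelTuple, List.map_append, List.prod_append, ← Matrix.vecMul_vecMul]
    rcases b with _ | b
    · rw [vecMul_prod_range_zero A (by omega), Matrix.smul_vecMul,
        vecMul_prod_hankel_of_le A le_rfl (by omega), Pi.smul_apply, basisVec, if_pos (by omega)]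
      simp
    · rw [vecMul_prod_range_succ A (by omega) (by omega), Matrix.add_vecMul, Matrix.smul_vecMul,
        vecMul_prod_hankel_of_le A le_rfl (by omega), Pi.add_apply, Pi.smul_apply,
        ih (by omega) (by omega) (by omega), basisVec, if_neg (by omega), smul_zero, add_zero]

variable {p s e : ℕ}

theorem vecMul_prod_admCompl_of_lt {b : ℕ} (h : p + 2 * s < m) (hb : b < p) :
    basisVec m S b ᵥ* ((admCompl p s).map (highFactor m A)).prod
      = basisVec m S b ᵥ* ((hankelTuple p).map (highFactor m A)).prod := by
  induction s with
  | zero => rfl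
  | succ s ih =>
    rw [admCompl, List.map_cons, List.prod_cons, ← Matrix.vecMul_vecMul,
      (supportedOn_highFactor A (by omega)).vecMul (by omega) (by omega), ih (by omega)]

theorem vecMul_prod_admCompl_of_le {b : ℕ} (hb : p + 2 * s ≤ b) (hbm : b < m) :
    basisVec m S b ᵥ* ((admCompl p s).map (highFactor m A)).prod = basisVec m S b := by
  induction s with
  | zero => exact vecMul_prod_hankel_of_le A hb hbm
  | succ s ih =>
    rw [admCompl, List.map_cons, List.prod_cons, ← Matrix.vecMul_vecMul,
      (supportedOn_highFactor A (by omega)).vecMul (by omega) (by omega), ih (by omega)]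

/-- Here and in its analogues the row is a basis vector, so the nonzero block found is an identity
block and exists whatever the coefficients are. -/
theorem vecMul_prod_admCompl_even {t : ℕ} (h : p + 2 * s < m) (ht : t < s) :
    basisVec m S (p + 2 * t) ᵥ* ((admCompl p s).map (highFactor m A)).prod
      = basisVec m S (p + 2 * t + 1) := by
  induction s with
  | zero => omega
  | succ s ih =>
    rw [admCompl, List.map_cons, List.prod_cons, ← Matrix.vecMul_vecMul]
    rcases (Nat.lt_succ_iff.1 ht).eq_or_lt with rfl | hts
    · rw [vecMul_highFactor A (by omega), vecMul_prod_admCompl_of_le A (by omega) (by omega)]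
    · rw [(supportedOn_highFactor A (by omega)).vecMul (by omega) (by omega), ih (by omega) hts]

theorem vecMul_prod_admTuple_of_lt {b : ℕ} (h : p + 2 * s < m) (hb : b < p) :
    basisVec m S b ᵥ* ((admTuple p s).map (highFactor m A)).prod
      = basisVec m S b ᵥ* ((List.range (p + 1)).map (highFactor m A)).prod := by
  induction s with
  | zero => rfl
  | succ s ih =>
    rw [admTuple, List.map_cons, List.prod_cons, List.map_cons, List.prod_cons,
      ← Matrix.vecMul_vecMul, ← Matrix.vecMul_vecMul,
      (supportedOn_highFactor A (by omega)).vecMul (by omega) (by omega),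
      (supportedOn_highFactor A (by omega)).vecMul (by omega) (by omega), ih (by omega)]

theorem supportedOn_prod_admTuple (h : p + 2 * s < m) :
    SupportedOn 0 (p + 2 * s) ((admTuple p s).map (highFactor m A)).prod :=
  SupportedOn.list_prod _ _ fun i hi => by
    have := mem_admTuple.1 hi
    exact (supportedOn_highFactor A (by omega)).mono (by omega) (by omega)

theorem vecMul_prod_admTuple_even {t : ℕ} (h : p + 2 * s < m) (ht : t < s) :
    basisVec m S (p + 2 * t) ᵥ* ((admTuple p s).map (highFactor m A)).prod
      = basisVec m S (p + 2 * t + 2) := by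
  induction s with
  | zero => omega
  | succ s ih =>
    rw [admTuple, List.map_cons, List.prod_cons, List.map_cons, List.prod_cons,
      ← Matrix.vecMul_vecMul, ← Matrix.vecMul_vecMul]
    rcases (Nat.lt_succ_iff.1 ht).eq_or_lt with rfl | hts
    · rw [vecMul_highFactor A (by omega), vecMul_highFactor A (by omega),
        (supportedOn_prod_admTuple A (by omega)).vecMul (by omega) (by omega)]
    · rw [(supportedOn_highFactor A (by omega)).vecMul (by omega) (by omega),
        (supportedOn_highFactor A (by omega)).vecMul (by omega) (by omega), ih (by omega) hts]

theorem supportedOn_prod_admCompl_low (h : 2 * e < m) :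
    SupportedOn (m - 2 * e) (m - 1) ((admCompl 0 e).map (lowFactor m A)).prod :=
  SupportedOn.list_prod _ _ fun i hi => by
    have := lt_of_mem_admCompl hi
    have := pos_of_mem_admCompl_zero hi
    exact (supportedOn_lowFactor A (by omega)).mono (by omega) (by omega)

theorem supportedOn_prod_admTuple_low (h : 2 * e < m) :
    SupportedOn (m - 2 * e - 1) m ((admTuple 0 e).map (lowFactor m A)).prod :=
  SupportedOn.list_prod _ _ fun i hi => by
    have := mem_admTuple.1 hi
    exact (supportedOn_lowFactor A (by omega)).mono (by omega) (by omega)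

theorem vecMul_prod_admCompl_low_odd {t : ℕ} (h : 2 * e < m) (ht : t < e) :
    basisVec m S (m - 2 * t - 1) ᵥ* ((admCompl 0 e).map (lowFactor m A)).prod
      = basisVec m S (m - 2 * t - 2) := by
  induction e with
  | zero => omega
  | succ e ih =>
    rw [admCompl, List.map_cons, List.prod_cons, ← Matrix.vecMul_vecMul, Nat.zero_add]
    rcases (Nat.lt_succ_iff.1 ht).eq_or_lt with rfl | hte
    · have := vecMul_lowFactor A (i := 2 * t + 1) (m := m) (by omega) (by omega)
      rw [show m - 2 * t - 1 = m - (2 * t + 1) by omega, this,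
        show m - 2 * t - 2 = m - (2 * t + 1) - 1 by omega]
      exact (supportedOn_prod_admCompl_low A (by omega)).vecMul (by omega) (by omega)
    · rw [(supportedOn_lowFactor A (by omega)).vecMul (by omega) (by omega), ih (by omega) hte]

theorem vecMul_prod_admTuple_low_odd {t : ℕ} (h : 2 * e < m) (ht : t < e) :
    basisVec m S (m - 2 * t - 1) ᵥ* ((admTuple 0 e).map (lowFactor m A)).prod
      = basisVec m S (m - 2 * t - 3) := by
  induction e with
  | zero => omega
  | succ e ih =>
    rw [admTuple, List.map_cons, List.prod_cons, List.map_cons, List.prod_cons,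
      ← Matrix.vecMul_vecMul, ← Matrix.vecMul_vecMul, Nat.zero_add]
    rcases (Nat.lt_succ_iff.1 ht).eq_or_lt with rfl | hte
    · have h₁ := vecMul_lowFactor A (i := 2 * t + 1) (m := m) (by omega) (by omega)
      have h₂ := vecMul_lowFactor A (i := 2 * t + 2) (m := m) (by omega) (by omega)
      rw [show m - 2 * t - 1 = m - (2 * t + 1) by omega, h₁,
        show m - (2 * t + 1) - 1 = m - (2 * t + 2) by omega, h₂,
        show m - 2 * t - 3 = m - (2 * t + 2) - 1 by omega]
      exact (supportedOn_prod_admTuple_low A (by omega)).vecMul (by omega) (by omega)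
    · rw [(supportedOn_lowFactor A (by omega)).vecMul (by omega) (by omega),
        (supportedOn_lowFactor A (by omega)).vecMul (by omega) (by omega), ih (by omega) hte]

/-- The blocks `a` and `b` are linked by a nonzero block of `M`. -/
def BlockLinked (M : Matrix (Fin m) (Fin m) S) (a b : ℕ) : Prop :=
  ∃ (_ : a < m) (j : Fin m), (j : ℕ) = b ∧ (basisVec m S a ᵥ* M) j ≠ 0

theorem blockLinked_of_eq [Nontrivial S] {M : Matrix (Fin m) (Fin m) S} {a b : ℕ} (ha : a < m)
    (hb : b < m) (h : basisVec m S a ᵥ* M = basisVec m S b) : BlockLinked M a b :=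
  ⟨ha, ⟨b, hb⟩, rfl, by rw [h, basisVec, if_pos rfl]; exact one_ne_zero⟩

/-- A function that is constant along the nonzero blocks of the two coefficients of `L(λ)` is
constant. -/
theorem eq_of_blockLinked [Nontrivial S] (hm : m = 2 * e + 1 + (p + 2 * s)) (hA : A m ≠ 0)
    {α : Type*} (f : ℕ → α) (h₁ : ∀ a b, BlockLinked (leadBlock m e p s A) a b → f a = f b)
    (h₀ : ∀ a b, BlockLinked (constBlock m e p s A) a b → f a = f b) :
    ∀ j < m, f j = f (p + 2 * s) := by
  have hlead : ∀ a, basisVec m S a ᵥ* leadBlock m e p s A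
      = basisVec m S a ᵥ* ((admTuple p s).map (highFactor m A)).prod
        ᵥ* ((admCompl 0 e).map (lowFactor m A)).prod
        ᵥ* ((admCompl p s).map (highFactor m A)).prod := fun a => by
    rw [leadBlock, Matrix.vecMul_vecMul, Matrix.vecMul_vecMul, mul_assoc]
  have hconst : ∀ a, basisVec m S a ᵥ* constBlock m e p s A
      = basisVec m S a ᵥ* ((admTuple 0 e).map (lowFactor m A)).prod
        ᵥ* ((admCompl 0 e).map (lowFactor m A)).prod
        ᵥ* ((admCompl p s).map (highFactor m A)).prod := fun a => by
    rw [constBlock, Matrix.vecMul_vecMul, Matrix.vecMul_vecMul, mul_assoc]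
  -- the lower blocks
  have hcl := supportedOn_prod_admCompl_low A (m := m) (e := e) (by omega)
  have htl := supportedOn_prod_admTuple_low A (m := m) (e := e) (by omega)
  have hth := supportedOn_prod_admTuple A (m := m) (p := p) (s := s) (by omega)
  have hl₁ : ∀ t < e, f (m - 2 * t - 1) = f (m - 2 * t - 2) := fun t ht => by
    refine h₁ _ _ (blockLinked_of_eq (by omega) (by omega) ?_)
    rw [hlead, hth.vecMul (by omega) (by omega), vecMul_prod_admCompl_low_odd A (by omega) ht,
      vecMul_prod_admCompl_of_le A (by omega) (by omega)]
  have hl₂ : ∀ t, t + 1 < e → f (m - 2 * t - 1) = f (m - 2 * t - 4) := fun t ht => by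
    refine h₀ _ _ (blockLinked_of_eq (by omega) (by omega) ?_)
    have := vecMul_prod_admCompl_low_odd A (m := m) (e := e) (t := t + 1) (by omega) ht
    rw [show m - 2 * (t + 1) - 1 = m - 2 * t - 3 by omega,
      show m - 2 * (t + 1) - 2 = m - 2 * t - 4 by omega] at this
    rw [hconst, vecMul_prod_admTuple_low_odd A (by omega) (by omega), this,
      vecMul_prod_admCompl_of_le A (by omega) (by omega)]
  have hl₃ : ∀ t, t + 1 = e → f (m - 2 * t - 1) = f (p + 2 * s) := fun t ht => by
    refine h₀ _ _ (blockLinked_of_eq (by omega) (by omega) ?_)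
    rw [hconst, vecMul_prod_admTuple_low_odd A (by omega) (by omega),
      show m - 2 * t - 3 = p + 2 * s by omega, hcl.vecMul (by omega) (by omega),
      vecMul_prod_admCompl_of_le A (by omega) (by omega)]
  -- The constant coefficient links block m − 2t − 1 to the first block of the next pair, the
  -- leading one links the two blocks of that pair, and the zigzag ends at p + 2s.
  have hlow : ∀ r t, t + 1 + r = e → f (m - 2 * t - 1) = f (p + 2 * s) := by
    intro r
    induction r with
    | zero => exact fun t ht => hl₃ t ht
    | succ r ih =>
      intro t ht
      rw [hl₂ t (by omega), ← ih (t + 1) (by omega), hl₁ (t + 1) (by omega),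
        show m - 2 * (t + 1) - 2 = m - 2 * t - 4 by omega]
  -- the middle blocks
  have hm₁ : ∀ t < s, f (p + 2 * t) = f (p + 2 * t + 1) := fun t ht => by
    refine h₀ _ _ (blockLinked_of_eq (by omega) (by omega) ?_)
    rw [hconst, htl.vecMul (by omega) (by omega), hcl.vecMul (by omega) (by omega),
      vecMul_prod_admCompl_even A (by omega) ht]
  have hm₂ : ∀ t, t + 1 < s → f (p + 2 * t) = f (p + 2 * t + 3) := fun t ht => by
    refine h₁ _ _ (blockLinked_of_eq (by omega) (by omega) ?_)
    rw [hlead, vecMul_prod_admTuple_even A (by omega) (by omega), hcl.vecMul (by omega) (by omega)]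
    exact vecMul_prod_admCompl_even A (t := t + 1) (by omega) ht
  have hm₃ : ∀ t, t + 1 = s → f (p + 2 * t) = f (p + 2 * s) := fun t ht => by
    refine h₁ _ _ (blockLinked_of_eq (by omega) (by omega) ?_)
    rw [hlead, vecMul_prod_admTuple_even A (by omega) (by omega), hcl.vecMul (by omega) (by omega),
      vecMul_prod_admCompl_of_le A (by omega) (by omega), show p + 2 * t + 2 = p + 2 * s by omega]
  have hmid : ∀ r t, t + r = s → f (p + 2 * t) = f (p + 2 * s) := by
    intro r
    induction r with
    | zero => exact fun t ht => by rw [show t = s by omega]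
    | succ r ih =>
      intro t ht
      rcases Nat.eq_zero_or_pos r with rfl | hr
      · exact hm₃ t (by omega)
      · rw [hm₂ t (by omega), ← ih (t + 1) (by omega)]
        exact (hm₁ (t + 1) (by omega)).symm
  -- the upper blocks
  have hp₁ : ∀ b < p, f b = f (p - 1 - b) := fun b hb => by
    refine h₀ _ _ ⟨by omega, ⟨p - 1 - b, by omega⟩, rfl, ?_⟩
    rw [hconst, htl.vecMul (by omega) (by omega), hcl.vecMul (by omega) (by omega),
      vecMul_prod_admCompl_of_lt A (by omega) hb, vecMul_prod_hankel_apply A (by omega) hb _ rfl]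
    exact hA
  -- The relevant row of the leading coefficient is a Hankel row plus a multiple of the row of block
  -- p. The second summand vanishes in the columns below p, so the entry read off is A m itself.
  have hck : ∀ c : Fin m, (c : ℕ) < p →
      (basisVec m S p ᵥ* ((admCompl p s).map (highFactor m A)).prod) c = 0 := fun c hc => by
    rcases Nat.eq_zero_or_pos s with rfl | hs
    · rw [vecMul_prod_admCompl_of_le A (by omega) (by omega), basisVec, if_neg (by omega)]
    · have := vecMul_prod_admCompl_even A (m := m) (p := p) (s := s) (t := 0) (by omega) hs
      rw [mul_zero, add_zero] at this
      rw [this, basisVec, if_neg (by omega)]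
  have hp₂ : ∀ b, b + 1 < p → f (b + 1) = f (p - 1 - b) := fun b hb => by
    refine h₁ _ _ ⟨by omega, ⟨p - 1 - b, by omega⟩, rfl, ?_⟩
    rw [hlead, vecMul_prod_admTuple_of_lt A (by omega) hb,
      vecMul_prod_range_succ A (by omega) (by omega), Matrix.add_vecMul, Matrix.add_vecMul,
      Matrix.smul_vecMul, Matrix.smul_vecMul, hcl.vecMul (by omega) (by omega),
      hcl.vecMul (by omega) (by omega), Pi.add_apply, Pi.smul_apply,
      vecMul_prod_admCompl_of_lt A (by omega) (by omega),
      vecMul_prod_hankel_apply A (by omega) (by omega) _ rfl, hck _ (by simp; omega), smul_zero,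
      add_zero]
    exact hA
  -- Row 0 of the leading coefficient is A m times a basis vector, at p without pairs and at p + 1
  -- otherwise.
  have hp₀ : 0 < p → f 0 = f p := fun h0 => by
    have hrow : basisVec m S 0 ᵥ* leadBlock m e p s A
        = A m • (basisVec m S p ᵥ* ((admCompl p s).map (highFactor m A)).prod) := by
      rw [hlead, vecMul_prod_admTuple_of_lt A (by omega) h0, vecMul_prod_range_zero A (by omega),
        Matrix.smul_vecMul, Matrix.smul_vecMul, hcl.vecMul (by omega) (by omega)]
    rcases Nat.eq_zero_or_pos s with rfl | hs
    · refine h₁ _ _ ⟨by omega, ⟨p, by omega⟩, rfl, ?_⟩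
      rw [hrow, vecMul_prod_admCompl_of_le A (by omega) (by omega), Pi.smul_apply, basisVec,
        if_pos rfl, smul_eq_mul, mul_one]
      exact hA
    · have h₂ := vecMul_prod_admCompl_even A (m := m) (p := p) (s := s) (t := 0) (by omega) hs
      have h₃ := hm₁ 0 hs
      rw [mul_zero, add_zero] at h₂ h₃
      rw [h₃]
      refine h₁ _ _ ⟨by omega, ⟨p + 1, by omega⟩, rfl, ?_⟩
      rw [hrow, h₂, Pi.smul_apply, basisVec, if_pos rfl, smul_eq_mul, mul_one]
      exact hA
  -- Block p − 1 − b is linked to b by the constant and to b + 1 by the leading coefficient, so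
  -- consecutive upper blocks are connected.
  have hup : ∀ b < p, f b = f (p + 2 * s) := by
    intro b
    induction b with
    | zero => exact fun h0 => (hp₀ h0).trans (hmid s 0 (by omega))
    | succ b ih => exact fun hb => by rw [hp₂ b hb, ← hp₁ b (by omega), ih (by omega)]
  intro j hj
  rcases lt_or_ge j p with hjp | hjp
  · exact hup j hjp
  rcases le_or_gt j (p + 2 * s) with hjk | hjk
  · rcases Nat.even_or_odd' (j - p) with ⟨t, ht | ht⟩
    · rw [show j = p + 2 * t by omega]
      exact hmid (s - t) t (by omega)
    · rw [show j = p + 2 * t + 1 by omega, ← hm₁ t (by omega)]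
      exact hmid (s - t) t (by omega)
  · rcases Nat.even_or_odd' (m - 1 - j) with ⟨t, ht | ht⟩
    · rw [show j = m - 2 * t - 1 by omega]
      exact hlow (e - t - 1) t (by omega)
    · rw [show j = m - 2 * t - 2 by omega, ← hl₁ t (by omega)]
      exact hlow (e - t - 1) t (by omega)

end Rows

/-! ### Uniqueness of the signs -/

section Uniqueness

variable {m e p s n : ℕ}

/-- A nonzero vector is not its own negative, so the relation between x and y determines the ratio
of the signs. -/
theorem mul_eq_mul_of_smul_eq {V : Type*} [AddCommGroup V] [Module ℂ V] {u v u' v' : ℤˣ} {x y : V}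
    (hx : x ≠ 0) (h : u • x = v • y) (h' : u' • x = v' • y) : u' * u = v' * v := by
  have hy : y = (v * u) • x := by rw [mul_smul, h, smul_smul, Int.units_mul_self, one_smul]
  have h2 : (v' * u' * (v * u)) • x = x := by
    rw [mul_smul, ← hy, mul_comm, mul_smul, ← h', smul_smul, Int.units_mul_self, one_smul]
  have hne : v' * u' * (v * u) = 1 := by
    rcases Int.units_eq_one_or (v' * u' * (v * u)) with h3 | h3
    · exact h3
    · rw [h3, Units.neg_smul, one_smul, neg_eq_iff_add_eq_zero, ← two_smul ℂ] at h2
      exact absurd ((smul_eq_zero.1 h2).resolve_left two_ne_zero) hx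
  have h3 : u' * u * (v' * v) = 1 := by rw [← hne]; ac_rfl
  rw [eq_inv_of_mul_eq_one_left h3, Int.units_inv_eq_self]

/-- At a nonzero block (a, b) evenness fixes the ratio of the a-th and b-th signs, so the product
ε'ε takes the same value at a and b. Connectedness makes it a global sign. -/
theorem eq_or_eq_neg_of_isTEven (hm : m = 2 * e + 1 + (p + 2 * s)) {P : Matrix (Fin n) (Fin n) ℂ[X]}
    (hP : coeffMat P m ≠ 0) {ε ε' : Fin m → ℤˣ}
    (h : IsTEven (toPoly (quasiIdentity n ε) * pencilL m (2 * e) p P))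
    (h' : IsTEven (toPoly (quasiIdentity n ε') * pencilL m (2 * e) p P)) : ε' = ε ∨ ε' = -ε := by
  have : Nontrivial (Matrix (Fin n) (Fin n) ℂ) := ⟨⟨_, _, hP⟩⟩
  rw [isTEven_quasiIdentity_mul_pencilL_iff hm] at h h'
  set f : ℕ → ℤˣ := fun j => if hj : j < m then ε' ⟨j, hj⟩ * ε ⟨j, hj⟩ else 1 with hf
  have hfv : ∀ a : Fin m, f a = ε' a * ε a := fun a => dif_pos a.2
  have hT : ∀ {M : Matrix (Fin n) (Fin n) ℂ}, M ≠ 0 → Mᵀ ≠ 0 := fun hM h0 =>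
    hM (Matrix.transpose_eq_zero.1 h0)
  have key := eq_of_blockLinked (coeffMat P) hm hP f
    (fun a b hab => by
      obtain ⟨ha, b, rfl, hne⟩ := hab
      rw [basisVec_vecMul ha] at hne
      have := mul_eq_mul_of_smul_eq (hT hne) ((h.1 ⟨a, ha⟩ b).trans (smul_neg _ _).symm)
        ((h'.1 ⟨a, ha⟩ b).trans (smul_neg _ _).symm)
      rw [hfv, ← this]
      exact hfv ⟨a, ha⟩)
    (fun a b hab => by
      obtain ⟨ha, b, rfl, hne⟩ := hab
      rw [basisVec_vecMul ha] at hne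
      have := mul_eq_mul_of_smul_eq (hT hne) (h.2 ⟨a, ha⟩ b) (h'.2 ⟨a, ha⟩ b)
      rw [hfv, ← this]
      exact hfv ⟨a, ha⟩)
  have hε : ∀ a, ε' a = f (p + 2 * s) * ε a := fun a => by
    rw [← key a a.2, hfv, mul_assoc, Int.units_mul_self, mul_one]
  rcases Int.units_eq_one_or (f (p + 2 * s)) with h1 | h1
  · exact Or.inl (funext fun a => by rw [hε, h1, one_mul])
  · exact Or.inr (funext fun a => by rw [hε, h1, neg_one_mul, Pi.neg_apply])

end Uniqueness

/-! ### Hamiltonian system matrices -/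

section Hamiltonian

variable {ι κ : Type}

/-- The substitution `λ ↦ -λ` in a matrix polynomial. -/
def compNeg (P : Matrix ι κ ℂ[X]) : Matrix ι κ ℂ[X] := P.map fun p => p.comp (-Polynomial.X)

theorem negSubst_algebraMap (q : ℂ[X]) : negSubst (algebraMap ℂ[X] (RatFunc ℂ) q)
    = algebraMap ℂ[X] (RatFunc ℂ) (q.comp (-Polynomial.X)) := by
  have h := RatFunc.map_apply_div (K := ℂ) (R := ℂ) (Polynomial.algEquivAevalNegX : ℂ[X] ≃ₐ[ℂ] ℂ[X])
    (nonZeroDivisors_le_comap_nonZeroDivisors_of_injective _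
      (Polynomial.algEquivAevalNegX : ℂ[X] ≃ₐ[ℂ] ℂ[X]).injective) q 1
  rw [map_one, map_one, map_one, div_one, div_one] at h
  exact h

theorem toRat_map_negSubst (P : Matrix ι κ ℂ[X]) : (toRat P).map negSubst = toRat (compNeg P) := by
  ext a b
  exact negSubst_algebraMap _

theorem compNeg_toPoly (M : Matrix ι κ ℂ) : compNeg (toPoly M) = toPoly M := by
  ext : 2
  simp [compNeg, toPoly]

theorem isTEven_fromBlocks_iff {P : Matrix ι ι ℂ[X]} {C : Matrix ι κ ℂ} {B : Matrix κ ι ℂ}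
    {D : Matrix κ κ ℂ[X]} : IsTEven (Matrix.fromBlocks P (toPoly C) (toPoly B) D) ↔
      IsTEven P ∧ B = Cᵀ ∧ IsTEven D := by
  have hinj : Function.Injective (toPoly : Matrix κ ι ℂ → Matrix κ ι ℂ[X]) :=
    Matrix.map_injective Polynomial.C_injective
  have hT : ∀ {ι κ : Type} (M : Matrix ι κ ℂ), (compNeg (toPoly M))ᵀ = toPoly Mᵀ := fun M => by
    rw [compNeg_toPoly]
    rfl
  have h : IsTEven (Matrix.fromBlocks P (toPoly C) (toPoly B) D) ↔
      Matrix.fromBlocks (compNeg P)ᵀ (compNeg (toPoly B))ᵀ (compNeg (toPoly C))ᵀ (compNeg D)ᵀ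
        = Matrix.fromBlocks P (toPoly C) (toPoly B) D := by
    rw [IsTEven, Matrix.fromBlocks_map, Matrix.fromBlocks_transpose]
    rfl
  rw [h, Matrix.fromBlocks_inj, hT, hT]
  constructor
  · rintro ⟨h₁, -, h₃, h₄⟩
    exact ⟨h₁, (hinj h₃).symm, h₄⟩
  · rintro ⟨h₁, rfl, h₄⟩
    exact ⟨h₁, by rw [Matrix.transpose_transpose], rfl, h₄⟩

variable {ℓ : ℕ}

theorem transpose_J : (J ℓ)ᵀ = -J ℓ := by
  rw [J, Matrix.fromBlocks_transpose, Matrix.fromBlocks_neg]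
  simp

theorem isHamiltonianSystem_iff [Fintype ι] [DecidableEq ι] {S : SystemData ι (Fin ℓ ⊕ Fin ℓ)} :
    IsHamiltonianSystem S ↔
      S.E = 1 ∧ IsTEven S.P ∧ J ℓ * S.B = S.Cᵀ ∧ (J ℓ * S.A)ᵀ = J ℓ * S.A := by
  refine and_congr_right fun hE => ?_
  have h : Matrix.fromBlocks 1 0 0 (toPoly (J ℓ)) * S.toMatrix
      = Matrix.fromBlocks S.P (toPoly S.C) (toPoly (J ℓ * S.B))
        ((Polynomial.X : ℂ[X]) • toPoly (-J ℓ) - toPoly (-(J ℓ * S.A))) := by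
    have hneg : ∀ M : Matrix (Fin ℓ ⊕ Fin ℓ) (Fin ℓ ⊕ Fin ℓ) ℂ, toPoly (-M) = -toPoly M :=
      fun M => by ext : 2; simp [toPoly]
    rw [SystemData.toMatrix, Matrix.fromBlocks_multiply, hE, toPoly_mul, hneg, hneg, toPoly_mul,
      toPoly_one, mul_sub, Matrix.mul_smul, mul_one, smul_neg, sub_neg_eq_add, neg_add_eq_sub]
    simp
  rw [h, isTEven_fromBlocks_iff, isTEven_pencil_iff, Matrix.transpose_neg, Matrix.transpose_neg,
    transpose_J, neg_inj]
  simp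

/-- The transfer function of a Hamiltonian system matrix is Hamiltonian. -/
theorem IsHamiltonianSystem.isHamiltonianRat_transfer [Fintype ι] [DecidableEq ι]
    {S : SystemData ι (Fin ℓ ⊕ Fin ℓ)} (hS : IsHamiltonianSystem S) :
    IsHamiltonianRat S.transfer := by
  obtain ⟨hE, hP, hB, hA⟩ := isHamiltonianSystem_iff.1 hS
  have hC : S.C = S.Bᵀ * (J ℓ)ᵀ := (eq_transpose_mul_J hB).symm
  set M := toRat ((Polynomial.X : ℂ[X]) • toPoly S.E - toPoly S.A) with hM
  have hMM : M * M⁻¹ = 1 := Matrix.mul_nonsing_inv _ (isUnit_det_toRat_pencil S.isUnit_det_E)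
  set j := toRat (toPoly (J ℓ)) with hj
  have hTr : ∀ {ι κ : Type} (N : Matrix ι κ ℂ), ((toRat (toPoly N)).map negSubst)ᵀ
      = toRat (toPoly Nᵀ) := fun N => by
    rw [toRat_map_negSubst, compNeg_toPoly]
    rfl
  -- For M(λ) = λI − A, symmetry of JA and skew-symmetry of J give (J M(−λ))ᵀ = J M(λ).
  have hjM : (M.map negSubst)ᵀ * jᵀ = j * M := by
    have hX : compNeg ((Polynomial.X : ℂ[X]) • toPoly S.E - toPoly S.A)
        = -((Polynomial.X : ℂ[X]) • (1 : Matrix _ _ ℂ[X])) - toPoly S.A := by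
      rw [hE]
      ext : 2
      simp [compNeg, toPoly, Matrix.one_apply]
      split_ifs <;> simp
    have hJA : (toPoly (J ℓ * S.A))ᵀ = toPoly (J ℓ * S.A) := congrArg toPoly hA
    have hJ : (toPoly (J ℓ))ᵀ = -toPoly (J ℓ) := by
      have : (toPoly (J ℓ))ᵀ = toPoly (J ℓ)ᵀ := rfl
      rw [this, transpose_J]
      ext : 2
      simp [toPoly]
    have hpoly : (compNeg ((Polynomial.X : ℂ[X]) • toPoly S.E - toPoly S.A))ᵀ * (toPoly (J ℓ))ᵀ
        = toPoly (J ℓ) * ((Polynomial.X : ℂ[X]) • toPoly S.E - toPoly S.A) := by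
      rw [← Matrix.transpose_mul, hX, hE, toPoly_one, mul_sub, mul_neg, Matrix.mul_smul, mul_one,
        ← toPoly_mul, Matrix.transpose_sub, Matrix.transpose_neg, Matrix.transpose_smul, hJ, hJA,
        smul_neg, neg_neg, mul_sub, Matrix.mul_smul, mul_one, ← toPoly_mul]
    have h := congrArg toRat hpoly
    rw [toRat_mul, toRat_mul] at h
    rw [hM, toRat_map_negSubst]
    exact h
  have hN : (M⁻¹.map negSubst)ᵀ * (M.map negSubst)ᵀ = 1 := by
    rw [← Matrix.transpose_mul, ← Matrix.map_mul, hMM]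
    simp
  -- The same relation for the resolvent; with C = BᵀJᵀ it makes C M⁻¹ B invariant under
  -- transposition combined with λ ↦ −λ.
  have hNj : (M⁻¹.map negSubst)ᵀ * j = jᵀ * M⁻¹ := by
    rw [← mul_one (_ * j), ← hMM, ← mul_assoc, mul_assoc _ j, ← hjM, ← mul_assoc, hN, one_mul]
  have hc : toRat (toPoly S.C) = (toRat (toPoly S.B))ᵀ * jᵀ := by
    rw [hC, toPoly_mul, toRat_mul]
    rfl
  have hcT : ((toRat (toPoly S.C)).map negSubst)ᵀ = j * toRat (toPoly S.B) := by
    rw [hTr, ← hB, toPoly_mul, toRat_mul]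
  have hPr : ((toRat S.P).map negSubst)ᵀ = toRat S.P := by
    rw [toRat_map_negSubst]
    exact congrArg toRat hP
  rw [IsHamiltonianRat, SystemData.transfer, ← hM,
    Matrix.map_add negSubst (fun a b => map_add negSubst a b), Matrix.map_mul, Matrix.map_mul,
    Matrix.transpose_add, Matrix.transpose_mul, Matrix.transpose_mul, hPr, hcT, hTr, hc,
    ← Matrix.mul_assoc (M⁻¹.map negSubst)ᵀ, hNj, Matrix.mul_assoc jᵀ,
    Matrix.mul_assoc _ M⁻¹, Matrix.mul_assoc _ jᵀ]
  rfl

/-- Evenness survives the scalar s, and the two borders are J-adjoint by construction, both being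
placed at the same position. -/
theorem isHamiltonianSystem_borderedPencil {m e p n : ℕ} (ε : Fin m → ℤˣ)
    {S : SystemData (Fin n) (Fin ℓ ⊕ Fin ℓ)} (hA : (J ℓ * S.A)ᵀ = J ℓ * S.A)
    (h : IsTEven (toPoly (quasiIdentity n ε) * pencilL m (2 * e) p S.P)) :
    IsHamiltonianSystem (borderedPencil m (2 * e) p ε S) := by
  refine isHamiltonianSystem_iff.2 ⟨rfl, ?_, ?_, hA⟩
  · have hP : (borderedPencil m (2 * e) p ε S).P
        = toPoly (parameter ε (position m (2 * e)) • quasiIdentity n ε)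
          * pencilL m (2 * e) p S.P := rfl
    have hs : ∀ c : ℂ, toPoly (c • quasiIdentity n ε) = Polynomial.C c • toPoly (quasiIdentity n ε) :=
      fun c => by ext : 2; simp [toPoly]
    rw [hP, hs, Matrix.smul_mul, isTEven_iff]
    intro k
    have hk : ∀ (c : ℂ) (N : Matrix (Fin m × Fin n) (Fin m × Fin n) ℂ[X]),
        coeffMat (Polynomial.C c • N) k = c • coeffMat N k := fun c N => by
      ext; simp [coeffMat]
    rw [hk, Matrix.transpose_smul, isTEven_iff.1 h k, smul_comm]
  · refine Matrix.ext fun i x => ?_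
    change (J ℓ * rowBlock m (position m (2 * e)) S.B) i x
      = if (x.1 : ℕ) + 1 = position m (2 * e) then (S.Bᵀ * (J ℓ)ᵀ) x.2 i else 0
    rw [← Matrix.transpose_mul, Matrix.transpose_apply, Matrix.mul_apply, Matrix.mul_apply]
    simp only [rowBlock, Matrix.of_apply]
    split_ifs <;> simp

end Hamiltonian

end HamLin

end

theorem theorem4p16 (m n ℓ h p : ℕ)
    -- `0 ≤ h ≤ m - 1` is even, and `p = Ind(z + m)` is the index of an admissible tuple
    -- `z + m` of `{0:m-h-1}`
    (hm : h < m) (hh : Even h) (hp : p ≤ m - h - 1) (hp' : Even (m - h - 1 - p))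
    -- `G(λ)` is Hamiltonian and `S` is a minimal Hamiltonian realization of it
    (G : Matrix (Fin n) (Fin n) (RatFunc ℂ)) (hG : HamLin.IsHamiltonianRat G)
    (S : HamLin.SystemData (Fin n) (Fin ℓ ⊕ Fin ℓ))
    (hS : HamLin.IsHamiltonianRealization G S) (hmin : S.IsMinimal)
    (hdeg : HamLin.HasDegree S.P m)
    -- `Ind(z + m) = 0` when the leading coefficient of `P(λ)` is singular
    (hsing : ¬ IsUnit (HamLin.coeffMat S.P m).det → p = 0) :
    -- there is a quasi-identity matrix `Q` that makes `Q L(λ)` a `T`-even pencil for all `T`-even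
    -- matrix polynomials of degree `m`,
    (∃ ε : Fin m → ℤˣ, ∀ (k : ℕ) (P : Matrix (Fin k) (Fin k) (Polynomial ℂ)),
      HamLin.HasDegree P m → HamLin.IsTEven P →
        HamLin.IsTEven (HamLin.toPoly (HamLin.quasiIdentity k ε) * HamLin.pencilL m h p P)) ∧
    -- `Q` is unique up to the sign,
    (∀ ε ε' : Fin m → ℤˣ,
      HamLin.IsTEven (HamLin.toPoly (HamLin.quasiIdentity n ε) * HamLin.pencilL m h p S.P) →
      HamLin.IsTEven (HamLin.toPoly (HamLin.quasiIdentity n ε') * HamLin.pencilL m h p S.P) →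
        ε' = ε ∨ ε' = -ε) ∧
    -- and, for this `Q`, the pencil `𝕋(λ)` is a Hamiltonian Rosenbrock strong linearization of
    -- `G(λ)` with Hamiltonian transfer function
    ∀ ε : Fin m → ℤˣ,
      HamLin.IsTEven (HamLin.toPoly (HamLin.quasiIdentity n ε) * HamLin.pencilL m h p S.P) →
        HamLin.IsHamiltonianSystem (HamLin.borderedPencil m h p ε S) ∧
        HamLin.IsRosenbrockStrongLinearization S (HamLin.borderedPencil m h p ε S) ∧
        HamLin.IsHamiltonianRat (HamLin.borderedPencil m h p ε S).transfer := by
  -- `e` and `s` are the numbers of pairs in w and in z + m.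
  obtain ⟨e, rfl⟩ := even_iff_exists_two_mul.1 hh
  obtain ⟨s, hs⟩ := even_iff_exists_two_mul.1 hp'
  have hm' : m = 2 * e + 1 + (p + 2 * s) := by omega
  have hA : IsUnit (HamLin.coeffMat S.P m) ∨ p = 0 := by
    rw [Matrix.isUnit_iff_isUnit_det]
    exact or_iff_not_imp_left.2 hsing
  -- The signs are chosen before any polynomial enters, which gives the uniformity in the size and
  -- in P.
  obtain ⟨d, hd⟩ := HamLin.exists_isSignPattern hm'
  refine ⟨⟨fun a => d a, fun k P _ hP => hd.isTEven hm' hP⟩,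
    fun ε ε' => HamLin.eq_or_eq_neg_of_isTEven hm' hdeg.1, fun ε hε => ?_⟩
  have hH := HamLin.isHamiltonianSystem_borderedPencil ε hS.hamiltonian_A hε
  exact ⟨hH, HamLin.isRosenbrockStrongLinearization_borderedPencil hm' ε S hS.E_eq_one hS.J_mul_B
    hdeg.2 hA hmin, hH.isHamiltonianRat_transfer⟩
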